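/- **Setting.** Let $0=\xi_0>\xi_1\ge\xi_2\ge\dots$ be the eigenvalues, with multiplicity, of the Laplacian of the round unit sphere $S^2\subset\mathbb R^3$, let $A_0,A_1,\dots$ be corresponding $L^2$-orthonormal smooth eigenfunctions, and let $\|f\|_{W^{m,2}(S^2)}^2=\sum_{n}(1+|\xi_n|)^m\big(\int_{S^2}fA_n\big)^2$. Write $r=|x|$, $\theta=x/|x|$, and extend functions on $S^2$ to $\mathbb R^3\setminus\{0\}$ constantly along rays. Let $g$ be a Riemannian metric on $\{|x|>R_0\}\subset\mathbb R^3$, $R_0>0$, of the form $$g_{ij}=\delta_{ij}+\frac{h^1_{ij}(\theta)}r+Q_{ij},$$ where $h^1_{ij}\in C^5(S^2)$, $Q_{ij}\in C^5$ and $\sup r^{2+k}|\partial^kQ|<\infty$ for $k=0,\dots,5$. On $S^2$ put $$F_k=\tfrac12\sum_j\Big[2\big(\partial_jh^1_{jk}-h^1_{jk}x^j\big)-\big(\partial_kh^1_{jj}-h^1_{jj}x^k\big)\Big],\qquad \lambda^k_n=\int_{S^2}F_kA_n ,$$ and define the asymptotically harmonic coordinates $$y^k=x^k+\lambda^k_0A_0\log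 r+\sum_{n\ge1}\frac{\lambda^k_n}{\xi_n}A_n(\theta),\qquad k=1,2,3.$$ **Lemma 5.2.** For every real $m>2$ there is $\varepsilon>0$, depending only on $m$, such that the following holds for every such $g$. If $\|h^1_{ij}-\delta_{ij}\|_{W^{m,2}(S^2)}\le\varepsilon$ for all $i,j$, then the series defining $y$ converges at every $x$ with $|x|>R_0$, and there is $R_1\ge R_0$ such that: * $y=(y^1,y^2,y^3)$ is a $C^1$ coordinate system on $\{|x|>R_1\}$ (it is $C^1$, injective, with invertible Jacobian), its image contains $\{|z|>R'\}$ for some $R'$, and $y\neq0$ there; * with $\tilde g_{ij}=g(\partial/\partial y^i,\partial/\partial y^j)=\delta_{ij}+\tilde h_{ij}$, one has $\tilde h_{ij}=O(|y|^{-1})$: there is a constant $C$ with $|\tilde h_{ij}|\le C/|y|$ on $\{|x|>R_1\}$; * $|y|\tilde h_{ij}$ is uniformly elliptic on $\{|x|>R_1\}$: there are constants $0<c\le C'$ with $c|v|^2\le|y|\sum_{i,j}\tilde h_{ij}v^iv^j\le C'|v|^2$ for all $|x|>R_1$ and $v\in\mathbb R^3$. -/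

import Mathlib

open MeasureTheory Metric
open scoped Manifold ContDiff ENNReal

noncomputable section

/-- Euclidean three-space. -/
abbrev E3 : Type := EuclideanSpace ℝ (Fin 3)

/-- The round unit sphere in Euclidean three-space. -/
abbrev S2 : Type := sphere (0 : E3) 1

/-- The exterior region of the points at distance more than `R` from the origin. -/
def ext (R : ℝ) : Set E3 := {x | R < ‖x‖}

/-- The direction `x / |x|` of a nonzero vector (an arbitrary fixed point when `x = 0`). -/
def dir (x : E3) : S2 :=
  if hx : x = 0 then ⟨EuclideanSpace.single 0 1, by simp⟩
  else ⟨‖x‖⁻¹ • x, by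
    have : ‖x‖ ≠ 0 := norm_ne_zero_iff.mpr hx
    simp [norm_smul, this]⟩

/-- The extension of a function on the sphere that is constant along the rays from the origin. -/
def radialExt (f : S2 → ℝ) : E3 → ℝ := fun x => f (dir x)

/-- The `j`-th partial derivative of a function on Euclidean three-space. -/
def partialD (j : Fin 3) (f : E3 → ℝ) (x : E3) : ℝ := fderiv ℝ f x (EuclideanSpace.single j 1)

/-- The Laplace-Beltrami operator of the round unit sphere, on smooth functions: the Euclidean
Laplacian of the extension that is constant along rays, at a point of the sphere. -/
def sphereLaplacian (f : S2 → ℝ) (θ : S2) : ℝ := Laplacian.laplacian (radialExt f) (θ : E3)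

/-- The surface measure of the unit sphere (of total mass `4 π`). -/
def surfaceMeasure : Measure S2 := (volume : Measure E3).toSphere

/-- The pairing of two functions in `L²` of the sphere. -/
def sphereInner (f u : S2 → ℝ) : ℝ := ∫ θ, f θ * u θ ∂surfaceMeasure

/-- `u` is a smooth function on the sphere with `Δ u = μ u` (the function `0` is allowed). -/
def IsEigenfunction (μ : ℝ) (u : S2 → ℝ) : Prop :=
  ContMDiff (𝓡 2) 𝓘(ℝ, ℝ) ∞ u ∧ ∀ θ, sphereLaplacian u θ = μ * u θ

/-- `0 = ξ 0 > ξ 1 ≥ ξ 2 ≥ …` is the list of the eigenvalues of the Laplacian of the unit sphere,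
with multiplicity, and the `A n` are corresponding orthonormal eigenfunctions. That nothing is
missing from the list is the last field: each eigenfunction is a finite linear combination of
the `A n`. -/
structure IsSphericalEigensystem (ξ : ℕ → ℝ) (A : ℕ → S2 → ℝ) : Prop where
  zero : ξ 0 = 0
  one_neg : ξ 1 < 0
  antitone : Antitone ξ
  eigen : ∀ n, IsEigenfunction (ξ n) (A n)
  orthonormal : ∀ n k, sphereInner (A n) (A k) = if n = k then 1 else 0
  exhaustive : ∀ (μ : ℝ) (u : S2 → ℝ), IsEigenfunction μ u → u ∈ Submodule.span ℝ (Set.range A)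

/-- The norm of the Sobolev space `W^{m,2}` of the sphere, for a real order `m`, that is the
`L²` norm of `(1 - Δ)^{m/2} f`, written in the eigenfunctions of the Laplacian. It is `∞` exactly
when the (continuous) function `f` is not in `W^{m,2}`. -/
def sobolevNorm (ξ : ℕ → ℝ) (A : ℕ → S2 → ℝ) (m : ℝ) (f : S2 → ℝ) : ℝ≥0∞ :=
  (∑' n, ENNReal.ofReal ((1 - ξ n) ^ m * sphereInner f (A n) ^ 2)) ^ (1 / 2 : ℝ)

/-- `q` is `C^5` on the exterior region of radius `R₀`, and `|x|^{2+k} |∂^k q|` is bounded there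
for `k = 0, …, 5`. -/
def IsO5 (R₀ : ℝ) (q : E3 → ℝ) : Prop :=
  ContDiffOn ℝ 5 q (ext R₀) ∧
    ∃ C : ℝ, ∀ k : ℕ, k ≤ 5 → ∀ x ∈ ext R₀, ‖x‖ ^ (2 + k) * ‖iteratedFDeriv ℝ k q x‖ ≤ C

/-- `g_{ij} = δ_{ij} + h_{ij}(θ) / r + Q_{ij}` is a Riemannian metric on the exterior region of
radius `R₀`, where `h` is `C^5` on the sphere and `Q = O_5(|x|^{-2})`. -/
structure IsExpandedMetric (R₀ : ℝ) (g : E3 → Matrix (Fin 3) (Fin 3) ℝ)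
    (h : Fin 3 → Fin 3 → S2 → ℝ) (Q : Fin 3 → Fin 3 → E3 → ℝ) : Prop where
  radius_pos : 0 < R₀
  posDef : ∀ x ∈ ext R₀, (g x).PosDef
  smooth : ∀ i j, ContMDiff (𝓡 2) 𝓘(ℝ, ℝ) 5 (h i j)
  decay : ∀ i j, IsO5 R₀ (Q i j)
  expansion : ∀ x ∈ ext R₀, ∀ i j,
    g x i j = (1 : Matrix (Fin 3) (Fin 3) ℝ) i j + radialExt (h i j) x / ‖x‖ + Q i j x

/-- The functions `f_{lij}` on the sphere, built from the first derivatives of `h_{ij}(θ) / r`. -/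
def fTensor (h : Fin 3 → Fin 3 → S2 → ℝ) (l i j : Fin 3) (θ : S2) : ℝ :=
  (partialD j (radialExt (h l i)) θ - h l i θ * (θ : E3) j)
    + (partialD l (radialExt (h j i)) θ - h j i θ * (θ : E3) l)
    - (partialD i (radialExt (h j l)) θ - h j l θ * (θ : E3) i)

/-- The function `(1/2) ∑_j f_{jkj}` on the sphere; the Laplacian of the metric takes the
coordinate `x^k` to minus `r^{-2}` times this function, up to `O(r^{-3})`. -/
def source (h : Fin 3 → Fin 3 → S2 → ℝ) (k : Fin 3) (θ : S2) : ℝ :=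
  (1 / 2) * ∑ j, fTensor h j k j θ

/-- The coefficients `λ_n^k` of `(1/2) ∑_j f_{jkj}` in the eigenfunctions `A n`. -/
def coeff (A : ℕ → S2 → ℝ) (h : Fin 3 → Fin 3 → S2 → ℝ) (k : Fin 3) (n : ℕ) : ℝ :=
  sphereInner (source h k) (A n)

/-- The radial functions `f_0^k(r) = λ_0^k log r` and `f_n^k(r) = λ_n^k / ξ_n` for `n ≥ 1`. -/
def radialCoeff (ξ : ℕ → ℝ) (A : ℕ → S2 → ℝ) (h : Fin 3 → Fin 3 → S2 → ℝ)
    (k : Fin 3) (n : ℕ) (r : ℝ) : ℝ :=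
  if n = 0 then coeff A h k 0 * Real.log r else coeff A h k n / ξ n

/-- The asymptotically harmonic coordinates `y^k = x^k + ∑_n f_n^k(r) A_n(θ)`. -/
def harmonicCoord (ξ : ℕ → ℝ) (A : ℕ → S2 → ℝ) (h : Fin 3 → Fin 3 → S2 → ℝ) (x : E3) : E3 :=
  WithLp.toLp 2 fun k => x k + ∑' n, radialCoeff ξ A h k n ‖x‖ * radialExt (A n) x

/-- The Jacobian matrix `∂y^k/∂x^i` (row `k`, column `i`). -/
def jacobian (y : E3 → E3) (x : E3) : Matrix (Fin 3) (Fin 3) ℝ :=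
  Matrix.of fun k i => partialD i (fun z => y z k) x

/-- The map `y` is a `C^1` coordinate system on the exterior region of radius `R`, whose range
contains a neighbourhood of infinity. -/
structure IsCoordinateSystemAtInfinity (y : E3 → E3) (R : ℝ) : Prop where
  contDiffOn : ContDiffOn ℝ 1 y (ext R)
  injOn : Set.InjOn y (ext R)
  det_ne_zero : ∀ x ∈ ext R, (jacobian y x).det ≠ 0
  range : ∃ R' : ℝ, ext R' ⊆ y '' ext R

/-- The components `g(∂/∂y^i, ∂/∂y^j) = ∑_{a,b} (∂x^a/∂y^i) (∂x^b/∂y^j) g_{ab}` of the metric in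
the coordinates `y`, at the point with coordinates `x`. -/
def metricInCoord (g : E3 → Matrix (Fin 3) (Fin 3) ℝ) (y : E3 → E3) (x : E3) :
    Matrix (Fin 3) (Fin 3) ℝ :=
  ((jacobian y x)⁻¹).transpose * g x * (jacobian y x)⁻¹

/-- The matrix field `a` is uniformly elliptic on the set `s`. -/
def UniformlyEllipticOn (a : E3 → Matrix (Fin 3) (Fin 3) ℝ) (s : Set E3) : Prop :=
  ∃ c C : ℝ, 0 < c ∧ c ≤ C ∧ ∀ x ∈ s, ∀ v : Fin 3 → ℝ,
    c * ∑ i, v i ^ 2 ≤ ∑ i, ∑ j, a x i j * v i * v j ∧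
      ∑ i, ∑ j, a x i j * v i * v j ≤ C * ∑ i, v i ^ 2

end

noncomputable section

/-! ### Calculus on the sphere through extensions constant along rays -/

/-! Write h = δ + f with f small, s = 1/|x| and θ = x/|x|. For h = δ the source is θ_k / 2, and θ_k
is an eigenfunction of eigenvalue -2, so it contributes -θ/4 to y. The Euclidean metric in the
y-coordinates then pulls back to 1 - (s/2)(1 - θθᵀ) + O(s²), whereas g = 1 + s + O(s²). The
difference s(1 + (1 - θθᵀ)/2) + O(s²) lies between about s and 3s/2. This definite margin survives a
perturbation in which f and the angular coefficients of the Jacobian change by at most 1/100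
(`metric_sub_pullback_estimate`, `metricInCoord_estimate`). Since y - x has size o(|x|) and
derivative O(1/|x|), a mean value argument and a contraction make y a coordinate system near
infinity.

It remains to make f, the coefficient c of the logarithm, and the angular part u with its gradient
uniformly small. If f is small in W^{2,2}, then the source of f is small in W^{1,2}
(`coeff_sphereD_sub_le`), division by ξ_n puts u in W^{3,2}, and the gradient of u is in W^{2,2},
which embeds in C⁰ (`sphere_sobolev`, `exists_series`). Only m ≥ 2 enters.

The Sobolev inequality comes from the Fourier transform on ℝ³, applied to extensions cut off near
the sphere. The spectral facts come from the axioms of the eigensystem: the operators D_j + a x_j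
act as ladder operators, which gives the gap ξ_n ≤ -2 for n ≥ 1 and the invariance of the span of
the A_n under multiplication by polynomials. Completeness is then the Stone–Weierstrass theorem
(`eq_zero_of_forall_coeff`). -/

lemma dir_of_ne_zero {x : E3} (hx : x ≠ 0) : (dir x : E3) = ‖x‖⁻¹ • x := by
  simp [dir, hx]

lemma norm_S2 (θ : S2) : ‖(θ : E3)‖ = 1 := by simp

lemma S2_ne_zero (θ : S2) : (θ : E3) ≠ 0 := ne_zero_of_mem_unit_sphere θ

lemma dir_S2 (θ : S2) : dir θ = θ := by
  apply Subtype.ext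
  rw [dir_of_ne_zero (S2_ne_zero θ), norm_S2]
  simp

lemma dir_smul {t : ℝ} (ht : 0 < t) (x : E3) : dir (t • x) = dir x := by
  by_cases hx : x = 0
  · simp [hx]
  · apply Subtype.ext
    rw [dir_of_ne_zero hx, dir_of_ne_zero (smul_ne_zero ht.ne' hx), norm_smul, smul_smul,
      Real.norm_eq_abs, abs_of_pos ht]
    congr 1
    field_simp

lemma norm_smul_dir (x : E3) : ‖x‖ • (dir x : E3) = x := by
  by_cases hx : x = 0
  · simp [hx]
  · rw [dir_of_ne_zero hx, smul_smul, mul_inv_cancel₀ (norm_ne_zero_iff.2 hx), one_smul]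

lemma radialExt_S2 (u : S2 → ℝ) (θ : S2) : radialExt u θ = u θ := by
  rw [radialExt, dir_S2]

lemma radialExt_smul (u : S2 → ℝ) {t : ℝ} (ht : 0 < t) (x : E3) :
    radialExt u (t • x) = radialExt u x := by
  rw [radialExt, dir_smul ht, radialExt]

lemma sum_sq_S2 (θ : S2) : ∑ i, (θ : E3) i ^ 2 = 1 := by
  have := EuclideanSpace.real_norm_sq_eq (θ : E3)
  rw [norm_S2] at this
  linarith

/-- The bridge from smoothness on the manifold to calculus in `E3`: away from the origin the
extension is the composition with the normalisation map, which is smooth into the sphere.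
`contMDiff_restrict` goes back. -/
lemma contDiffAt_radialExt {n : ℕ∞ω} {u : S2 → ℝ} (hu : ContMDiff (𝓡 2) 𝓘(ℝ, ℝ) n u)
    {x : E3} (hx : x ≠ 0) : ContDiffAt ℝ n (radialExt u) x := by
  have : Fact (Module.finrank ℝ E3 = 2 + 1) := ⟨by simp⟩
  let U : TopologicalSpace.Opens E3 := ⟨{0}ᶜ, isOpen_compl_singleton⟩
  have hU : ∀ y : U, (y : E3) ≠ 0 := fun y => y.2
  let φ : E3 → E3 := fun y => ‖y‖⁻¹ • y
  have hφ : ∀ y ≠ (0 : E3), ContDiffAt ℝ n φ y := fun y hy =>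
    ((contDiffAt_norm ℝ hy).inv (norm_ne_zero_iff.2 hy)).smul contDiffAt_id
  have hφU : ContMDiff 𝓘(ℝ, E3) 𝓘(ℝ, E3) n fun y : U => φ y := fun y =>
    contMDiffAt_subtype_iff.2 (hφ y (hU y)).contMDiffAt
  have hs : ∀ y : U, φ y ∈ sphere (0 : E3) 1 := fun y => by
    simp [φ, norm_smul, norm_ne_zero_iff.2 (hU y)]
  have hc : ContMDiff 𝓘(ℝ, E3) 𝓘(ℝ, ℝ) n fun y : U => radialExt u y := by
    have h := hu.comp (hφU.codRestrict_sphere hs)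
    convert h using 1
    ext y
    rw [radialExt, Function.comp_apply]
    congr 1
    exact Subtype.ext (dir_of_ne_zero (hU y))
  exact (contMDiffAt_subtype_iff.1 (hc ⟨x, hx⟩)).contDiffAt

lemma contMDiff_restrict {n : ℕ∞ω} {f : E3 → ℝ} (hf : ∀ θ : S2, ContDiffAt ℝ n f θ) :
    ContMDiff (𝓡 2) 𝓘(ℝ, ℝ) n fun θ : S2 => f θ := fun θ =>
  have : Fact (Module.finrank ℝ E3 = 2 + 1) := ⟨by simp⟩
  ((hf θ).contMDiffAt).comp θ (contMDiff_coe_sphere θ)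

/-- The `j`-th component of the tangential gradient of a function on the sphere. -/
def sphereD (j : Fin 3) (u : S2 → ℝ) (θ : S2) : ℝ := partialD j (radialExt u) θ

/-- The restriction of the `i`-th coordinate to the sphere. -/
def coordFn (i : Fin 3) (θ : S2) : ℝ := (θ : E3) i

lemma contDiff_coord (n : ℕ∞ω) (i : Fin 3) : ContDiff ℝ n fun x : E3 => x i :=
  (EuclideanSpace.proj (𝕜 := ℝ) i).contDiff

lemma contMDiff_coordFn (n : ℕ∞ω) (i : Fin 3) : ContMDiff (𝓡 2) 𝓘(ℝ, ℝ) n (coordFn i) :=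
  contMDiff_restrict fun _ => (contDiff_coord n i).contDiffAt

lemma contDiffAt_partialD {n m : ℕ∞ω} {f : E3 → ℝ} {x : E3} (hf : ContDiffAt ℝ n f x)
    (hm : m + 1 ≤ n) (j : Fin 3) : ContDiffAt ℝ m (partialD j f) x :=
  (hf.fderiv_right hm).clm_apply contDiffAt_const

lemma contMDiff_sphereD {n m : ℕ∞ω} {u : S2 → ℝ} (hu : ContMDiff (𝓡 2) 𝓘(ℝ, ℝ) n u)
    (hm : m + 1 ≤ n) (j : Fin 3) : ContMDiff (𝓡 2) 𝓘(ℝ, ℝ) m (sphereD j u) :=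
  contMDiff_restrict fun θ => contDiffAt_partialD (contDiffAt_radialExt hu (S2_ne_zero θ)) hm j

lemma fderiv_radialExt_smul (u : S2 → ℝ) {t : ℝ} (ht : 0 < t) (x : E3) :
    fderiv ℝ (radialExt u) x = t • fderiv ℝ (radialExt u) (t • x) := by
  rw [← fderiv_comp_smul]
  congr 1
  ext y
  exact (radialExt_smul u ht y).symm

lemma partialD_radialExt (u : S2 → ℝ) {x : E3} (hx : x ≠ 0) (j : Fin 3) :
    partialD j (radialExt u) x = ‖x‖⁻¹ * radialExt (sphereD j u) x := by
  have ht : 0 < ‖x‖⁻¹ := inv_pos.2 (norm_pos_iff.2 hx)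
  rw [partialD, fderiv_radialExt_smul u ht, radialExt, sphereD, partialD, dir_of_ne_zero hx]
  rfl

lemma differentiableAt_radialExt {u : S2 → ℝ} (hu : ContMDiff (𝓡 2) 𝓘(ℝ, ℝ) 1 u)
    {x : E3} (hx : x ≠ 0) : DifferentiableAt ℝ (radialExt u) x :=
  (contDiffAt_radialExt hu hx).differentiableAt one_ne_zero

lemma partialD_mul {f g : E3 → ℝ} {x : E3} (hf : DifferentiableAt ℝ f x)
    (hg : DifferentiableAt ℝ g x) (j : Fin 3) :
    partialD j (fun y => f y * g y) x = f x * partialD j g x + g x * partialD j f x := by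
  simp [partialD, fderiv_fun_mul hf hg]

lemma partialD_add {f g : E3 → ℝ} {x : E3} (hf : DifferentiableAt ℝ f x)
    (hg : DifferentiableAt ℝ g x) (j : Fin 3) :
    partialD j (fun y => f y + g y) x = partialD j f x + partialD j g x := by
  simp [partialD, fderiv_fun_add hf hg]

lemma partialD_congr {f g : E3 → ℝ} {x : E3} (h : f =ᶠ[nhds x] g) (j : Fin 3) :
    partialD j f x = partialD j g x := by
  rw [partialD, h.fderiv_eq, partialD]

lemma fderiv_apply_eq_sum (f : E3 → ℝ) (x v : E3) :
    fderiv ℝ f x v = ∑ j, v j * partialD j f x := by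
  conv_lhs => rw [← (EuclideanSpace.basisFun (Fin 3) ℝ).sum_repr v]
  simp [partialD]

lemma sphereD_mul {u v : S2 → ℝ} (hu : ContMDiff (𝓡 2) 𝓘(ℝ, ℝ) 1 u)
    (hv : ContMDiff (𝓡 2) 𝓘(ℝ, ℝ) 1 v) (j : Fin 3) (θ : S2) :
    sphereD j (fun η => u η * v η) θ = u θ * sphereD j v θ + v θ * sphereD j u θ := by
  have := partialD_mul (differentiableAt_radialExt hu (S2_ne_zero θ))
    (differentiableAt_radialExt hv (S2_ne_zero θ)) j
  rw [radialExt_S2, radialExt_S2] at this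
  exact this

lemma sphereD_add {u v : S2 → ℝ} (hu : ContMDiff (𝓡 2) 𝓘(ℝ, ℝ) 1 u)
    (hv : ContMDiff (𝓡 2) 𝓘(ℝ, ℝ) 1 v) (j : Fin 3) (θ : S2) :
    sphereD j (fun η => u η + v η) θ = sphereD j u θ + sphereD j v θ :=
  partialD_add (differentiableAt_radialExt hu (S2_ne_zero θ))
    (differentiableAt_radialExt hv (S2_ne_zero θ)) j

lemma sphereD_const (c : ℝ) (j : Fin 3) (θ : S2) : sphereD j (fun _ => c) θ = 0 := by
  have : radialExt (fun _ => c) = fun _ => c := rfl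
  simp [sphereD, partialD, this]

lemma sphereD_const_mul {u : S2 → ℝ} (hu : ContMDiff (𝓡 2) 𝓘(ℝ, ℝ) 1 u) (c : ℝ) (j : Fin 3)
    (θ : S2) : sphereD j (fun η => c * u η) θ = c * sphereD j u θ := by
  rw [sphereD_mul contMDiff_const hu, sphereD_const]
  ring

lemma hasStrictFDerivAt_norm_S2 (θ : S2) :
    HasFDerivAt (fun x : E3 => ‖x‖) (innerSL ℝ (θ : E3)) (θ : E3) := by
  have := ((hasStrictFDerivAt_norm_sq (θ : E3)).hasFDerivAt).sqrt (by simp)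
  simp only [Real.sqrt_sq (norm_nonneg _), norm_S2] at this
  have he : (1 / (2 * √((1 : ℝ) ^ 2))) • 2 • innerSL ℝ (θ : E3) = innerSL ℝ (θ : E3) := by
    ext v
    simp
  rwa [he] at this

lemma partialD_norm_S2 (θ : S2) (j : Fin 3) :
    partialD j (fun x : E3 => ‖x‖) θ = (θ : E3) j := by
  rw [partialD, (hasStrictFDerivAt_norm_S2 θ).fderiv]
  simp [EuclideanSpace.inner_single_right]

lemma partialD_coord (x : E3) (i j : Fin 3) :
    partialD j (fun x : E3 => x i) x = if i = j then 1 else 0 := by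
  have : HasFDerivAt (fun x : E3 => x i) (EuclideanSpace.proj (𝕜 := ℝ) i) x :=
    (EuclideanSpace.proj (𝕜 := ℝ) i).hasFDerivAt
  rw [partialD, this.fderiv]
  simp

lemma norm_mul_radialExt_coordFn (i : Fin 3) (x : E3) : ‖x‖ * radialExt (coordFn i) x = x i := by
  conv_rhs => rw [← norm_smul_dir x]
  rfl

/-- Differentiate the identity x_i = |x| θ_i at a point of the sphere. -/
lemma sphereD_coordFn (i j : Fin 3) (θ : S2) :
    sphereD j (coordFn i) θ = (if i = j then 1 else 0) - (θ : E3) i * (θ : E3) j := by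
  have h1 : (fun x : E3 => ‖x‖ * radialExt (coordFn i) x) = fun x => x i :=
    funext (norm_mul_radialExt_coordFn i)
  have h2 := partialD_mul (hasStrictFDerivAt_norm_S2 θ).differentiableAt
    (differentiableAt_radialExt (contMDiff_coordFn 1 i) (S2_ne_zero θ)) j
  rw [h1, partialD_coord, partialD_norm_S2, norm_S2, radialExt_S2] at h2
  rw [sphereD]
  simp only [coordFn] at h2
  linarith

/-- Euler's relation for functions homogeneous of degree 0: the gradient is tangential. -/
lemma sum_coord_mul_sphereD {u : S2 → ℝ} (hu : ContMDiff (𝓡 2) 𝓘(ℝ, ℝ) 1 u) (θ : S2) :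
    ∑ j, (θ : E3) j * sphereD j u θ = 0 := by
  have h := fderiv_apply_eq_sum (radialExt u) θ θ
  have hd := (differentiableAt_radialExt hu (S2_ne_zero θ)).hasFDerivAt
  have hl : HasDerivAt (fun t : ℝ => t • (θ : E3)) (θ : E3) 1 := by
    simpa using (hasDerivAt_id (1 : ℝ)).smul_const (θ : E3)
  have h1 : HasDerivAt (fun t : ℝ => radialExt u (t • (θ : E3)))
      (fderiv ℝ (radialExt u) θ θ) 1 := by
    have := HasFDerivAt.comp_hasDerivAt (1 : ℝ) (by simpa using hd) hl
    exact this
  have h2 : HasDerivAt (fun t : ℝ => radialExt u (t • (θ : E3))) 0 1 := by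
    refine (hasDerivAt_const (1 : ℝ) (u θ)).congr_of_eventuallyEq ?_
    filter_upwards [lt_mem_nhds (zero_lt_one (α := ℝ))] with t ht
    rw [radialExt_smul u ht, radialExt_S2]
  rw [h1.unique h2] at h
  exact h.symm

/-- The extension of D_j u constant along rays is |x| ∂_j of the extension of u, because ∂_j lowers
the degree of homogeneity by one. The extra term is the derivative of |x|. -/
lemma sphereD_sphereD {u : S2 → ℝ} (hu : ContMDiff (𝓡 2) 𝓘(ℝ, ℝ) 2 u) (i j : Fin 3) (θ : S2) :
    sphereD i (sphereD j u) θ =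
      (θ : E3) i * sphereD j u θ + partialD i (partialD j (radialExt u)) θ := by
  have he : radialExt (sphereD j u) =ᶠ[nhds (θ : E3)]
      fun x => ‖x‖ * partialD j (radialExt u) x := by
    filter_upwards [isOpen_ne.mem_nhds (S2_ne_zero θ)] with x hx
    rw [partialD_radialExt u hx, mul_inv_cancel_left₀ (norm_ne_zero_iff.2 hx)]
  rw [sphereD, partialD_congr he, partialD_mul (hasStrictFDerivAt_norm_S2 θ).differentiableAt,
    norm_S2, partialD_norm_S2, sphereD]
  · ring
  · exact (contDiffAt_partialD (contDiffAt_radialExt hu (S2_ne_zero θ)) (m := 1)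
      (by norm_num) j).differentiableAt one_ne_zero

lemma partialD_partialD {f : E3 → ℝ} {x : E3} (hf : ContDiffAt ℝ 2 f x) (i j : Fin 3) :
    partialD i (partialD j f) x =
      iteratedFDeriv ℝ 2 f x ![EuclideanSpace.single i 1, EuclideanSpace.single j 1] := by
  have hd : DifferentiableAt ℝ (fderiv ℝ f) x :=
    (hf.fderiv_right (m := 1) (by norm_num)).differentiableAt one_ne_zero
  rw [iteratedFDeriv_two_apply, partialD]
  have : partialD j f = fun y => fderiv ℝ f y (EuclideanSpace.single j 1) := rfl
  rw [this, fderiv_clm_apply hd (differentiableAt_const _)]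
  simp

lemma partialD_comm {f : E3 → ℝ} {x : E3} (hf : ContDiffAt ℝ 2 f x) (i j : Fin 3) :
    partialD i (partialD j f) x = partialD j (partialD i f) x := by
  rw [partialD_partialD hf, partialD_partialD hf, iteratedFDeriv_two_apply,
    iteratedFDeriv_two_apply]
  exact (hf.isSymmSndFDerivAt (by simp)).eq _ _

lemma laplacian_eq_sum_partialD {f : E3 → ℝ} {x : E3} (hf : ContDiffAt ℝ 2 f x) :
    Laplacian.laplacian f x = ∑ j, partialD j (partialD j f) x := by
  rw [InnerProductSpace.laplacian_eq_iteratedFDeriv_orthonormalBasis f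
    (EuclideanSpace.basisFun (Fin 3) ℝ)]
  simp [partialD_partialD hf]

lemma sphereD_comm {u : S2 → ℝ} (hu : ContMDiff (𝓡 2) 𝓘(ℝ, ℝ) 2 u) (i j : Fin 3) (θ : S2) :
    sphereD i (sphereD j u) θ = sphereD j (sphereD i u) θ
      + (θ : E3) i * sphereD j u θ - (θ : E3) j * sphereD i u θ := by
  rw [sphereD_sphereD hu, sphereD_sphereD hu,
    partialD_comm (contDiffAt_radialExt hu (S2_ne_zero θ))]
  ring

lemma sphereLaplacian_eq_sum {u : S2 → ℝ} (hu : ContMDiff (𝓡 2) 𝓘(ℝ, ℝ) 2 u) (θ : S2) :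
    sphereLaplacian u θ = ∑ j, sphereD j (sphereD j u) θ := by
  rw [sphereLaplacian, laplacian_eq_sum_partialD (contDiffAt_radialExt hu (S2_ne_zero θ))]
  simp only [sphereD_sphereD hu, Finset.sum_add_distrib]
  rw [sum_coord_mul_sphereD (hu.of_le (by norm_num)), zero_add]

/-! ### Commutation relations on the sphere -/

/-- Smooth real functions on the sphere. -/
abbrev SphereSmooth (u : S2 → ℝ) : Prop := ContMDiff (𝓡 2) 𝓘(ℝ, ℝ) ∞ u

lemma SphereSmooth.one {u : S2 → ℝ} (hu : SphereSmooth u) : ContMDiff (𝓡 2) 𝓘(ℝ, ℝ) 1 u :=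
  hu.of_le (by exact_mod_cast le_top)

lemma SphereSmooth.two {u : S2 → ℝ} (hu : SphereSmooth u) : ContMDiff (𝓡 2) 𝓘(ℝ, ℝ) 2 u :=
  hu.of_le (WithTop.coe_le_coe.2 (le_top : (2 : ℕ∞) ≤ ⊤))

lemma SphereSmooth.diff {u : S2 → ℝ} (hu : SphereSmooth u) (j : Fin 3) :
    SphereSmooth (sphereD j u) := contMDiff_sphereD hu (by simp) j

lemma sphereSmooth_coordFn (j : Fin 3) : SphereSmooth (coordFn j) := contMDiff_coordFn _ j

lemma SphereSmooth.coord_mul {u : S2 → ℝ} (hu : SphereSmooth u) (j : Fin 3) :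
    SphereSmooth fun θ => coordFn j θ * u θ := (sphereSmooth_coordFn j).mul hu

lemma SphereSmooth.mul {u v : S2 → ℝ} (hu : SphereSmooth u) (hv : SphereSmooth v) :
    SphereSmooth fun θ => u θ * v θ := ContMDiff.mul hu hv

lemma SphereSmooth.add {u v : S2 → ℝ} (hu : SphereSmooth u) (hv : SphereSmooth v) :
    SphereSmooth fun θ => u θ + v θ := ContMDiff.add hu hv

lemma SphereSmooth.sub {u v : S2 → ℝ} (hu : SphereSmooth u) (hv : SphereSmooth v) :
    SphereSmooth fun θ => u θ - v θ := ContMDiff.sub hu hv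

lemma sphereSmooth_const (c : ℝ) : SphereSmooth fun _ => c := contMDiff_const

lemma SphereSmooth.const_mul {u : S2 → ℝ} (hu : SphereSmooth u) (c : ℝ) :
    SphereSmooth fun θ => c * u θ := contMDiff_const.mul hu

lemma SphereSmooth.sum {ι : Type*} {s : Finset ι} {u : ι → S2 → ℝ}
    (hu : ∀ i ∈ s, SphereSmooth (u i)) : SphereSmooth fun θ => ∑ i ∈ s, u i θ :=
  contMDiff_finsetSum hu

lemma sphereD_sum {ι : Type*} {s : Finset ι} {u : ι → S2 → ℝ}
    (hu : ∀ i ∈ s, ContMDiff (𝓡 2) 𝓘(ℝ, ℝ) 1 (u i)) (j : Fin 3) (θ : S2) :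
    sphereD j (fun η => ∑ i ∈ s, u i η) θ = ∑ i ∈ s, sphereD j (u i) θ := by
  classical
  induction s using Finset.induction_on with
  | empty => simpa using sphereD_const 0 j θ
  | insert a s ha ih =>
    simp only [Finset.sum_insert ha]
    rw [sphereD_add (hu a (by simp)) (contMDiff_finsetSum fun i hi => hu i (by simp [hi])),
      ih fun i hi => hu i (by simp [hi])]

lemma sphereD_sub {u v : S2 → ℝ} (hu : ContMDiff (𝓡 2) 𝓘(ℝ, ℝ) 1 u)
    (hv : ContMDiff (𝓡 2) 𝓘(ℝ, ℝ) 1 v) (j : Fin 3) (θ : S2) :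
    sphereD j (fun η => u η - v η) θ = sphereD j u θ - sphereD j v θ := by
  have hv' : ContMDiff (𝓡 2) 𝓘(ℝ, ℝ) 1 fun η => -1 * v η := contMDiff_const.mul hv
  have h := sphereD_add hu hv' j θ
  rw [sphereD_const_mul hv] at h
  simp only [neg_mul, one_mul, ← sub_eq_add_neg] at h
  exact h

lemma SphereSmooth.laplacian {u : S2 → ℝ} (hu : SphereSmooth u) :
    SphereSmooth (sphereLaplacian u) := by
  have : sphereLaplacian u = fun θ => ∑ j, sphereD j (sphereD j u) θ :=
    funext (sphereLaplacian_eq_sum hu.two)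
  rw [this]
  exact SphereSmooth.sum fun j _ => (hu.diff j).diff j

lemma sphereLaplacian_add {u v : S2 → ℝ} (hu : SphereSmooth u) (hv : SphereSmooth v) (θ : S2) :
    sphereLaplacian (fun η => u η + v η) θ = sphereLaplacian u θ + sphereLaplacian v θ := by
  rw [sphereLaplacian_eq_sum (hu.add hv).two, sphereLaplacian_eq_sum hu.two,
    sphereLaplacian_eq_sum hv.two, ← Finset.sum_add_distrib]
  refine Finset.sum_congr rfl fun j _ => ?_
  rw [funext (sphereD_add hu.one hv.one j), sphereD_add (hu.diff j).one (hv.diff j).one]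

lemma sphereLaplacian_const_mul {u : S2 → ℝ} (hu : SphereSmooth u) (c : ℝ) (θ : S2) :
    sphereLaplacian (fun η => c * u η) θ = c * sphereLaplacian u θ := by
  rw [sphereLaplacian_eq_sum (hu.const_mul c).two, sphereLaplacian_eq_sum hu.two, Finset.mul_sum]
  refine Finset.sum_congr rfl fun j _ => ?_
  rw [funext (sphereD_const_mul hu.one c j), sphereD_const_mul (hu.diff j).one]

lemma sphereLaplacian_sub {u v : S2 → ℝ} (hu : SphereSmooth u) (hv : SphereSmooth v) (θ : S2) :
    sphereLaplacian (fun η => u η - v η) θ = sphereLaplacian u θ - sphereLaplacian v θ := by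
  have h := sphereLaplacian_add hu (hv.const_mul (-1)) θ
  rw [sphereLaplacian_const_mul hv] at h
  simp only [neg_mul, one_mul, ← sub_eq_add_neg] at h
  exact h

lemma sphereLaplacian_sum {ι : Type*} {s : Finset ι} {u : ι → S2 → ℝ}
    (hu : ∀ i ∈ s, SphereSmooth (u i)) (θ : S2) :
    sphereLaplacian (fun η => ∑ i ∈ s, u i η) θ = ∑ i ∈ s, sphereLaplacian (u i) θ := by
  rw [sphereLaplacian_eq_sum (SphereSmooth.sum hu).two,
    Finset.sum_congr rfl fun i hi => sphereLaplacian_eq_sum (hu i hi).two θ, Finset.sum_comm]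
  refine Finset.sum_congr rfl fun j _ => ?_
  rw [funext (sphereD_sum (fun i hi => (hu i hi).one) j),
    sphereD_sum fun i hi => ((hu i hi).diff j).one]

lemma sphereD_coord_mul {u : S2 → ℝ} (hu : ContMDiff (𝓡 2) 𝓘(ℝ, ℝ) 1 u) (i j : Fin 3) (θ : S2) :
    sphereD i (fun η => coordFn j η * u η) θ = coordFn j θ * sphereD i u θ
      + u θ * ((if j = i then 1 else 0) - coordFn j θ * coordFn i θ) := by
  rw [sphereD_mul (contMDiff_coordFn 1 j) hu, sphereD_coordFn]
  rfl

/-- The product rule with Δx_j = -2 x_j. The cross term is the j-th component of the gradient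
itself, since the gradient is tangential. -/
lemma sphereLaplacian_coord_mul {u : S2 → ℝ} (hu : SphereSmooth u) (j : Fin 3) (θ : S2) :
    sphereLaplacian (fun η => coordFn j η * u η) θ
      = 2 * sphereD j u θ - 2 * (coordFn j θ * u θ) + coordFn j θ * sphereLaplacian u θ := by
  have key : ∀ i, sphereD i (sphereD i fun η => coordFn j η * u η) θ =
      coordFn j θ * sphereD i (sphereD i u) θ
      + sphereD i u θ * (2 * ((if j = i then 1 else 0) - coordFn j θ * coordFn i θ))
      - u θ * (coordFn j θ * (1 - coordFn i θ ^ 2)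
        + coordFn i θ * ((if j = i then 1 else 0) - coordFn j θ * coordFn i θ)) := by
    intro i
    have h1 : sphereD i (fun η => coordFn j η * u η) = fun η => coordFn j η * sphereD i u η
        + u η * ((if j = i then 1 else 0) - coordFn j η * coordFn i η) :=
      funext fun η => sphereD_coord_mul hu.one i j η
    have h2 : SphereSmooth fun η => coordFn j η * coordFn i η :=
      (sphereSmooth_coordFn j).mul (sphereSmooth_coordFn i)
    have h3 : SphereSmooth fun η => (if j = i then (1 : ℝ) else 0) - coordFn j η * coordFn i η :=
      (sphereSmooth_const _).sub h2
    rw [h1, sphereD_add ((hu.diff i).coord_mul j).one (hu.mul h3).one,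
      sphereD_coord_mul (hu.diff i).one, sphereD_mul hu.one h3.one,
      sphereD_sub contMDiff_const h2.one, sphereD_const,
      sphereD_coord_mul (contMDiff_coordFn 1 i), sphereD_coordFn]
    simp only [coordFn, if_true]
    ring
  have h0 := sum_coord_mul_sphereD hu.one θ
  have h1 := sum_sq_S2 θ
  rw [sphereLaplacian_eq_sum (hu.coord_mul j).two, sphereLaplacian_eq_sum hu.two]
  simp only [Fin.sum_univ_three] at h0 h1 ⊢
  rw [key, key, key]
  clear key
  simp only [coordFn]
  fin_cases j <;> simp <;> first
    | linear_combination (-2 * (θ : E3) 0) * h0 + (2 * u θ * (θ : E3) 0) * h1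
    | linear_combination (-2 * (θ : E3) 1) * h0 + (2 * u θ * (θ : E3) 1) * h1
    | linear_combination (-2 * (θ : E3) 2) * h0 + (2 * u θ * (θ : E3) 2) * h1

/-- Together with `sphereLaplacian_coord_mul` this shows that, for an eigenfunction u, the space
spanned by D_j u and x_j u is invariant under Δ; the ladder operators diagonalise Δ there. -/
lemma sphereLaplacian_sphereD {u : S2 → ℝ} (hu : SphereSmooth u) (j : Fin 3) (θ : S2) :
    sphereLaplacian (sphereD j u) θ
      = sphereD j (sphereLaplacian u) θ - 2 * (coordFn j θ * sphereLaplacian u θ) := by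
  have key : ∀ i, sphereD i (sphereD i (sphereD j u)) θ =
      sphereD j (sphereD i (sphereD i u)) θ
      + coordFn i θ * sphereD j (sphereD i u) θ
      + sphereD j u θ * (1 - coordFn i θ ^ 2) + coordFn i θ * sphereD i (sphereD j u) θ
      - 2 * coordFn j θ * sphereD i (sphereD i u) θ
      - sphereD i u θ * ((if j = i then 1 else 0) - coordFn j θ * coordFn i θ) := by
    intro i
    have h1 : sphereD i (sphereD j u) = fun η => sphereD j (sphereD i u) η
        + coordFn i η * sphereD j u η - coordFn j η * sphereD i u η :=
      funext fun η => sphereD_comm hu.two i j η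
    have e1 : sphereD i (sphereD i (sphereD j u)) θ = sphereD i (sphereD j (sphereD i u)) θ
        + (coordFn i θ * sphereD i (sphereD j u) θ + sphereD j u θ * (1 - coordFn i θ ^ 2))
        - (coordFn j θ * sphereD i (sphereD i u) θ
          + sphereD i u θ * ((if j = i then 1 else 0) - coordFn j θ * coordFn i θ)) := by
      conv_lhs => rw [h1]
      rw [sphereD_sub ((((hu.diff i).diff j)).add ((hu.diff j).coord_mul i)).one
        ((hu.diff i).coord_mul j).one, sphereD_add ((hu.diff i).diff j).one
        ((hu.diff j).coord_mul i).one, sphereD_coord_mul (hu.diff j).one,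
        sphereD_coord_mul (hu.diff i).one, if_pos rfl]
      ring
    rw [e1, sphereD_comm (hu.diff i).two i j]
    simp only [coordFn]
    ring
  have h0 := sum_coord_mul_sphereD hu.one θ
  have h1 := sum_sq_S2 θ
  have h2 := sum_coord_mul_sphereD (hu.diff j).one θ
  -- Euler's relation for u, differentiated by D_j.
  have h3 : ∑ i, ((θ : E3) i * sphereD j (sphereD i u) θ
      + sphereD i u θ * ((if i = j then 1 else 0) - (θ : E3) i * (θ : E3) j)) = 0 := by
    have e : (fun η => ∑ i, coordFn i η * sphereD i u η) = fun _ => 0 :=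
      funext fun η => sum_coord_mul_sphereD hu.one η
    have h := sphereD_sum (s := Finset.univ)
      (fun i _ => ((hu.diff i).coord_mul i).one) j θ
    rw [e, sphereD_const] at h
    simp only [sphereD_coord_mul (hu.diff _).one] at h
    exact h.symm
  rw [sphereLaplacian_eq_sum (hu.diff j).two, funext (sphereLaplacian_eq_sum hu.two),
    sphereD_sum fun i _ => ((hu.diff i).diff i).one]
  simp only [Fin.sum_univ_three] at h0 h1 h2 h3 ⊢
  rw [key, key, key]
  clear key
  simp only [coordFn]
  fin_cases j <;> simp at h2 h3 ⊢ <;> first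
    | linear_combination h3 + h2 - sphereD 0 u θ * h1 + 2 * (θ : E3) 0 * h0
    | linear_combination h3 + h2 - sphereD 1 u θ * h1 + 2 * (θ : E3) 1 * h0
    | linear_combination h3 + h2 - sphereD 2 u θ * h1 + 2 * (θ : E3) 2 * h0

/-! ### Integration in polar coordinates -/

instance : IsFiniteMeasure surfaceMeasure := by unfold surfaceMeasure; infer_instance

instance : surfaceMeasure.IsOpenPosMeasure := by unfold surfaceMeasure; infer_instance

lemma integral_radial_mul_radialExt (a : ℝ → ℝ) (u : S2 → ℝ) :
    ∫ x : E3, a ‖x‖ * radialExt u x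
      = (∫ r in Set.Ioi (0 : ℝ), r ^ 2 * a r) * ∫ θ, u θ ∂surfaceMeasure := by
  have h3 : Module.finrank ℝ E3 - 1 = 2 := by simp
  calc
    ∫ x : E3, a ‖x‖ * radialExt u x
      = ∫ x : ({(0 : E3)}ᶜ : Set E3), a ‖x.1‖ * radialExt u x.1 ∂(volume.comap Subtype.val) := by
      rw [integral_subtype_comap (measurableSet_singleton _).compl
        fun x => a ‖x‖ * radialExt u x, _root_.MeasureTheory.restrict_compl_singleton]
    _ = ∫ p : S2 × Set.Ioi (0 : ℝ), u p.1 * a p.2 ∂(surfaceMeasure.prod (.volumeIoiPow 2)) := by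
      have h := (volume : Measure E3).measurePreserving_homeomorphUnitSphereProd.integral_comp
        (Homeomorph.measurableEmbedding _) fun p : S2 × Set.Ioi (0 : ℝ) => u p.1 * a p.2
      rw [h3] at h
      rw [surfaceMeasure, ← h]
      congr 1
      ext x
      rw [mul_comm, homeomorphUnitSphereProd_apply_snd_coe, radialExt]
      congr 2
      apply Subtype.ext
      rw [dir_of_ne_zero x.2, homeomorphUnitSphereProd_apply_fst_coe]
    _ = (∫ θ, u θ ∂surfaceMeasure) * ∫ r : Set.Ioi (0 : ℝ), a r ∂.volumeIoiPow 2 :=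
      -- No integrability is needed: the product formula also holds when an integral takes its
      -- default value 0.
      integral_prod_mul u fun r : Set.Ioi (0 : ℝ) => a r
    _ = _ := by
      rw [mul_comm]
      congr 1
      simp only [Measure.volumeIoiPow, ENNReal.ofReal]
      rw [integral_withDensity_eq_integral_smul,
        integral_subtype_comap measurableSet_Ioi fun r => Real.toNNReal (r ^ 2) • a r,
        setIntegral_congr_fun measurableSet_Ioi fun x hx => ?_]
      · simp only [NNReal.smul_def, smul_eq_mul]
        rw [Real.coe_toNNReal _ (pow_nonneg (le_of_lt hx) _)]
      · exact (measurable_subtype_coe.pow_const _).real_toNNReal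

/-- A smooth cutoff on the half-line of radii, equal to `1` at `1`. -/
def radialBump : ContDiffBump (1 : ℝ) := ⟨1 / 4, 1 / 2, by norm_num, by norm_num⟩

lemma radialBump_one : radialBump (1 : ℝ) = 1 :=
  radialBump.one_of_mem_closedBall (by simp [radialBump])

lemma radialBump_zero {r : ℝ} (hr : r ≤ 1 / 2 ∨ 3 / 2 ≤ r) : radialBump r = 0 := by
  refine radialBump.zero_of_le_dist ?_
  rw [Real.dist_eq]
  simp only [radialBump]
  rcases hr with hr | hr
  · rw [abs_of_neg (by linarith)]; linarith
  · rw [abs_of_pos (by linarith)]; linarith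

lemma radialBump_contDiff : ContDiff ℝ ∞ radialBump := radialBump.contDiff

lemma deriv_radialBump_zero {r : ℝ} (hr : r < 1 / 2 ∨ 3 / 2 < r) : deriv radialBump r = 0 := by
  have : radialBump =ᶠ[nhds r] fun _ => (0 : ℝ) := by
    rcases hr with hr | hr
    · filter_upwards [gt_mem_nhds hr] with y hy using radialBump_zero (.inl hy.le)
    · filter_upwards [lt_mem_nhds hr] with y hy using radialBump_zero (.inr hy.le)
  rw [this.deriv_eq]
  simp

/-- The extension of a function on the sphere, constant along rays and cut off near the
sphere. -/
def cutoffExt (u : S2 → ℝ) (x : E3) : ℝ := radialBump ‖x‖ * radialExt u x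

lemma contDiff_cutoffExt {n : ℕ∞ω} (hn : n ≤ (⊤ : ℕ∞)) {u : S2 → ℝ}
    (hu : ContMDiff (𝓡 2) 𝓘(ℝ, ℝ) n u) : ContDiff ℝ n (cutoffExt u) := by
  rw [contDiff_iff_contDiffAt]
  intro x
  by_cases hx : x = 0
  · have : cutoffExt u =ᶠ[nhds x] fun _ => 0 := by
      have hb : Metric.ball x (1 / 2) ∈ nhds x := Metric.ball_mem_nhds _ (by norm_num)
      filter_upwards [hb] with y hy
      rw [cutoffExt, radialBump_zero, zero_mul]
      left
      simpa [hx] using (Metric.mem_ball.1 hy).le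
    exact contDiffAt_const.congr_of_eventuallyEq this
  · exact ((radialBump_contDiff.of_le hn).contDiffAt.comp x (contDiffAt_norm ℝ hx)).mul
      (contDiffAt_radialExt hu hx)

lemma hasCompactSupport_cutoffExt (u : S2 → ℝ) : HasCompactSupport (cutoffExt u) := by
  refine HasCompactSupport.intro (isCompact_closedBall (0 : E3) (3 / 2)) fun x hx => ?_
  rw [cutoffExt, radialBump_zero, zero_mul]
  right
  simpa using (not_le.1 fun h => hx (by simpa using h)).le

lemma cutoffExt_S2 (u : S2 → ℝ) (θ : S2) : cutoffExt u θ = u θ := by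
  rw [cutoffExt, norm_S2, radialBump_one, one_mul, radialExt_S2]

lemma hasFDerivAt_norm_E3 {x : E3} (hx : x ≠ 0) :
    HasFDerivAt (fun y : E3 => ‖y‖) (‖x‖⁻¹ • innerSL ℝ x) x := by
  have hx' : ‖x‖ ≠ 0 := norm_ne_zero_iff.2 hx
  have := ((hasStrictFDerivAt_norm_sq x).hasFDerivAt).sqrt (by simpa using hx)
  simp only [Real.sqrt_sq (norm_nonneg _)] at this
  have he : (1 / (2 * ‖x‖)) • 2 • innerSL ℝ x = ‖x‖⁻¹ • innerSL ℝ x := by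
    ext v
    simp
    field_simp
  rwa [he] at this

lemma partialD_radial {a : ℝ → ℝ} {x : E3} (hx : x ≠ 0) (ha : DifferentiableAt ℝ a ‖x‖)
    (j : Fin 3) :
    partialD j (fun y => a ‖y‖) x = deriv a ‖x‖ * radialExt (coordFn j) x := by
  have h := ha.hasDerivAt.comp_hasFDerivAt x (hasFDerivAt_norm_E3 hx)
  have h2 : fderiv ℝ (fun y : E3 => a ‖y‖) x = deriv a ‖x‖ • ‖x‖⁻¹ • innerSL ℝ x := h.fderiv
  rw [partialD, h2]
  simp only [_root_.smul_apply, smul_eq_mul, radialExt, coordFn, dir_of_ne_zero hx]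
  simp [EuclideanSpace.inner_single_right]

lemma partialD_radial_mul_radialExt {a : ℝ → ℝ} {u : S2 → ℝ} {x : E3} (hx : x ≠ 0)
    (ha : DifferentiableAt ℝ a ‖x‖) (hu : ContMDiff (𝓡 2) 𝓘(ℝ, ℝ) 1 u) (j : Fin 3) :
    partialD j (fun y => a ‖y‖ * radialExt u y) x =
      deriv a ‖x‖ * radialExt (fun θ => coordFn j θ * u θ) x
        + (‖x‖⁻¹ * a ‖x‖) * radialExt (sphereD j u) x := by
  have hd : DifferentiableAt ℝ (fun y : E3 => a ‖y‖) x :=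
    ha.comp x (hasFDerivAt_norm_E3 hx).differentiableAt
  rw [partialD_mul hd (differentiableAt_radialExt hu hx), partialD_radialExt u hx,
    partialD_radial hx ha]
  simp only [radialExt]
  ring

lemma partialD_cutoffExt {u : S2 → ℝ} (hu : ContMDiff (𝓡 2) 𝓘(ℝ, ℝ) 1 u) (j : Fin 3) (x : E3) :
    partialD j (cutoffExt u) x =
      deriv radialBump ‖x‖ * radialExt (fun θ => coordFn j θ * u θ) x
        + (‖x‖⁻¹ * radialBump ‖x‖) * radialExt (sphereD j u) x := by
  by_cases hx : x = 0
  -- At the origin both sides vanish, since the cutoff is 0 near it.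
  · have : cutoffExt u =ᶠ[nhds x] fun _ => 0 := by
      have hb : Metric.ball x (1 / 2) ∈ nhds x := Metric.ball_mem_nhds _ (by norm_num)
      filter_upwards [hb] with y hy
      rw [cutoffExt, radialBump_zero, zero_mul]
      left
      simpa [hx] using (Metric.mem_ball.1 hy).le
    rw [partialD_congr this]
    simp [partialD, hx, deriv_radialBump_zero (r := 0) (by norm_num)]
  · exact partialD_radial_mul_radialExt hx
      (radialBump_contDiff.differentiable (by simp) _) hu j

lemma integral_partialD_eq_zero {f : E3 → ℝ} (hf : ContDiff ℝ 1 f) (hc : HasCompactSupport f)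
    (j : Fin 3) : ∫ x, partialD j f x = 0 := by
  have hi : Integrable fun x => fderiv ℝ f x (EuclideanSpace.single j 1) := by
    refine Continuous.integrable_of_hasCompactSupport ?_ (hc.fderiv_apply ℝ _)
    exact (hf.continuous_fderiv one_ne_zero).clm_apply continuous_const
  have h := integral_mul_fderiv_eq_neg_fderiv_mul_of_integrable (μ := (volume : Measure E3))
    (f := fun _ => (1 : ℝ)) (g := f) (v := EuclideanSpace.single j 1) (by simp)
    (by simpa using hi) (by simpa using hf.continuous.integrable_of_hasCompactSupport hc)
    (fun _ _ => differentiableAt_const _)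
    fun x _ => hf.differentiable one_ne_zero x
  simpa [partialD] using h

lemma integrable_of_continuous_S2 {u : S2 → ℝ} (hu : Continuous u) :
    Integrable u surfaceMeasure :=
  hu.integrable_of_hasCompactSupport (HasCompactSupport.of_compactSpace u)

lemma continuous_radial_mul_radialExt {a : ℝ → ℝ} (ha : ContinuousOn a (Set.Ioi 0))
    (h0 : ∀ r, r < 1 / 2 → a r = 0) {u : S2 → ℝ} (hu : Continuous u) :
    Continuous fun x : E3 => a ‖x‖ * radialExt u x := by
  rw [continuous_iff_continuousAt]
  intro x
  by_cases hx : x = 0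
  · have : (fun x : E3 => a ‖x‖ * radialExt u x) =ᶠ[nhds x] fun _ => 0 := by
      have hb : Metric.ball x (1 / 2) ∈ nhds x := Metric.ball_mem_nhds _ (by norm_num)
      filter_upwards [hb] with y hy
      rw [h0, zero_mul]
      simpa [hx] using Metric.mem_ball.1 hy
    exact continuousAt_const.congr this.symm
  · exact ((ha.continuousAt (Ioi_mem_nhds (norm_pos_iff.2 hx))).comp
      continuous_norm.continuousAt).mul
      (contDiffAt_radialExt (contMDiff_zero_iff.2 hu) hx).continuousAt

lemma integrable_radial_mul_radialExt {a : ℝ → ℝ} (ha : ContinuousOn a (Set.Ioi 0))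
    (h0 : ∀ r, r < 1 / 2 ∨ 3 / 2 < r → a r = 0) {u : S2 → ℝ} (hu : Continuous u) :
    Integrable fun x : E3 => a ‖x‖ * radialExt u x := by
  refine (continuous_radial_mul_radialExt ha (fun r hr => h0 r (.inl hr))
    hu).integrable_of_hasCompactSupport ?_
  refine HasCompactSupport.intro (isCompact_closedBall (0 : E3) (3 / 2)) fun x hx => ?_
  rw [h0, zero_mul]
  right
  simpa using hx

lemma integral_mul_radialBump_pos : 0 < ∫ r in Set.Ioi (0 : ℝ), r * radialBump r := by
  rw [setIntegral_eq_integral_of_forall_compl_eq_zero]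
  · refine Continuous.integral_pos_of_hasCompactSupport_nonneg_nonzero (x := (1 : ℝ))
      (continuous_id.mul radialBump.continuous) radialBump.hasCompactSupport.mul_left
      (fun r => ?_) (by simp [radialBump_one])
    rcases le_total 0 r with hr | hr
    · exact mul_nonneg hr radialBump.nonneg
    · simp [radialBump_zero (r := r) (.inl (by linarith))]
  · intro r hr
    rw [Set.mem_Ioi, not_lt] at hr
    rw [radialBump_zero (.inl (by linarith)), mul_zero]

lemma integral_sq_mul_deriv_radialBump :
    ∫ r in Set.Ioi (0 : ℝ), r ^ 2 * deriv radialBump r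
      = -2 * ∫ r in Set.Ioi (0 : ℝ), r * radialBump r := by
  have hb : ContDiff ℝ 1 radialBump := radialBump.contDiff
  have hf : ContDiff ℝ 1 fun r : ℝ => r ^ 2 * radialBump r := (contDiff_id.pow 2).mul hb
  have h := HasCompactSupport.integral_Ioi_deriv_eq hf
    (radialBump.hasCompactSupport.mul_left (f := fun r : ℝ => r ^ 2)) 0
  have hd : ∀ r, deriv (fun r : ℝ => r ^ 2 * radialBump r) r
      = 2 * (r * radialBump r) + r ^ 2 * deriv radialBump r := by
    intro r
    rw [((hasDerivAt_pow 2 r).fun_mul (hb.differentiable one_ne_zero r).hasDerivAt).deriv]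
    simp
    ring
  simp only [hd] at h
  rw [integral_add] at h
  · rw [integral_const_mul] at h
    simp at h
    linarith
  · refine Integrable.integrableOn (Continuous.integrable_of_hasCompactSupport ?_ ?_)
    · exact continuous_const.mul (continuous_id.mul radialBump.continuous)
    · exact (radialBump.hasCompactSupport.mul_left (f := fun r : ℝ => r)).mul_left
        (f := fun _ : ℝ => (2 : ℝ))
  · refine Integrable.integrableOn (Continuous.integrable_of_hasCompactSupport ?_ ?_)
    · exact (continuous_id.pow 2).mul (hb.continuous_deriv le_rfl)
    · exact radialBump.hasCompactSupport.deriv.mul_left (f := fun r : ℝ => r ^ 2)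

/-- The divergence theorem on the sphere. -/
lemma integral_sphereD {u : S2 → ℝ} (hu : ContMDiff (𝓡 2) 𝓘(ℝ, ℝ) 1 u) (j : Fin 3) :
    ∫ θ, sphereD j u θ ∂surfaceMeasure = 2 * ∫ θ, coordFn j θ * u θ ∂surfaceMeasure := by
  -- The integral of ∂_j of the cut-off extension over space is zero. In polar coordinates it is a
  -- combination of the two sphere integrals, with radial factors ∫ r² b' = -2 ∫ r b and ∫ r b; the
  -- positive number ∫ r b cancels.
  have h0 := integral_partialD_eq_zero (contDiff_cutoffExt (by exact_mod_cast le_top) hu)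
    (hasCompactSupport_cutoffExt u) j
  have hb : ContDiff ℝ 1 radialBump := radialBump.contDiff
  have hc : Continuous fun θ => coordFn j θ * u θ :=
    (contMDiff_coordFn 1 j).continuous.mul hu.continuous
  have hinv : ContinuousOn (fun r : ℝ => r⁻¹ * radialBump r) (Set.Ioi 0) :=
    (continuousOn_inv₀.mono fun r hr => (Set.mem_Ioi.1 hr).ne').mul
      radialBump.continuous.continuousOn
  have hr : ∫ r in Set.Ioi (0 : ℝ), r ^ 2 * (r⁻¹ * radialBump r)
      = ∫ r in Set.Ioi (0 : ℝ), r * radialBump r :=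
    setIntegral_congr_fun measurableSet_Ioi fun r hr => by
      have : r ≠ 0 := (Set.mem_Ioi.1 hr).ne'
      field_simp
  simp only [partialD_cutoffExt hu] at h0
  rw [integral_add (integrable_radial_mul_radialExt (hb.continuous_deriv le_rfl).continuousOn
      (fun r => deriv_radialBump_zero) hc)
    (integrable_radial_mul_radialExt
      hinv
      (fun r hr => by rw [radialBump_zero (hr.imp le_of_lt le_of_lt), mul_zero])
      (contMDiff_sphereD hu (m := 0) (by simp) j).continuous),
    integral_radial_mul_radialExt,
      integral_radial_mul_radialExt (fun r => r⁻¹ * radialBump r) (sphereD j u),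
    integral_sq_mul_deriv_radialBump, hr] at h0
  have hp := integral_mul_radialBump_pos
  have : (∫ r in Set.Ioi (0 : ℝ), r * radialBump r) *
      (∫ θ, sphereD j u θ ∂surfaceMeasure - 2 * ∫ θ, coordFn j θ * u θ ∂surfaceMeasure) = 0 := by
    linear_combination h0
  linarith [(mul_eq_zero.1 this).resolve_left hp.ne']

/-! ### The Sobolev inequality `W^{2,2} ⊂ C^0` -/

lemma sq_integral_mul_le {α : Type*} [MeasurableSpace α] {μ : Measure α} {f g : α → ℝ}
    (hf : Integrable (fun x => f x ^ 2) μ) (hg : Integrable (fun x => g x ^ 2) μ)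
    (hfg : Integrable (fun x => f x * g x) μ) :
    (∫ x, f x * g x ∂μ) ^ 2 ≤ (∫ x, f x ^ 2 ∂μ) * ∫ x, g x ^ 2 ∂μ := by
  have key : ∀ t : ℝ, 0 ≤ (∫ x, f x ^ 2 ∂μ) * (t * t) + (2 * ∫ x, f x * g x ∂μ) * t
      + ∫ x, g x ^ 2 ∂μ := by
    intro t
    have h : ∫ x, (t * f x + g x) ^ 2 ∂μ = (∫ x, f x ^ 2 ∂μ) * (t * t)
        + (2 * ∫ x, f x * g x ∂μ) * t + ∫ x, g x ^ 2 ∂μ := by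
      have e : ∀ x, (t * f x + g x) ^ 2 = (t * t) * f x ^ 2 + (2 * t) * (f x * g x) + g x ^ 2 :=
        fun x => by ring
      simp only [e]
      have h0 : Integrable (fun x => (t * t) * f x ^ 2 + (2 * t) * (f x * g x)) μ :=
        (hf.const_mul _).add (hfg.const_mul _)
      rw [integral_add h0 hg,
        integral_add (hf.const_mul _) (hfg.const_mul _), integral_const_mul, integral_const_mul]
      ring
    rw [← h]
    exact integral_nonneg fun x => sq_nonneg _
  have := discrim_le_zero key
  rw [discrim] at this
  nlinarith

-- The embedding of H²(ℝ³) in C⁰: f is bounded by the L¹ norm of its Fourier transform, and (1 +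
-- |y|²)⁻¹ is square-integrable because 4 > 3. The factor (2π)⁻² gives the operator the symbol 1 +
-- |y|².
open SchwartzMap FourierTransform Laplacian in
lemma schwartz_sup_le :
    ∃ K : ℝ, 0 ≤ K ∧ ∀ (f : 𝓢(E3, ℂ)) (x : E3),
      ‖f x‖ ^ 2 ≤ K * ∫ y, ‖f y - (((2 * Real.pi) ^ 2)⁻¹ : ℝ) • Δ (f : E3 → ℂ) y‖ ^ 2 := by
  refine ⟨∫ y : E3, ((1 + ‖y‖ ^ 2)⁻¹) ^ 2, integral_nonneg fun y => by positivity, fun f x => ?_⟩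
  have hw : Integrable fun y : E3 => ((1 + ‖y‖ ^ 2)⁻¹) ^ 2 := by
    have h := integrable_rpow_neg_one_add_norm_sq (E := E3) (μ := volume) (r := 4)
      (by simp; norm_num)
    refine h.congr (Filter.Eventually.of_forall fun y => ?_)
    have : (0 : ℝ) ≤ 1 + ‖y‖ ^ 2 := by positivity
    simp only
    rw [show (-4 / 2 : ℝ) = -(2 : ℕ) by norm_num, Real.rpow_neg this, Real.rpow_natCast, inv_pow]
  set c : ℝ := ((2 * Real.pi) ^ 2)⁻¹ with hc
  have hc0 : (2 * Real.pi) ^ 2 * c = 1 := mul_inv_cancel₀ (by positivity)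
  let g : 𝓢(E3, ℂ) := f + (-c) • Δ f
  have hg : ∀ y, g y = f y - c • Δ (f : E3 → ℂ) y := fun y => by
    simp [g, SchwartzMap.laplacian_apply, sub_eq_add_neg]
  have hFg : ∀ y, 𝓕 g y = (1 + ‖y‖ ^ 2 : ℝ) • 𝓕 f y := by
    intro y
    have h1 : 𝓕 g = 𝓕 f + (-c) • 𝓕 (Δ f) := by
      simp only [g, FourierTransform.fourier_add, FourierTransform.fourier_smul]
    have h2 : 𝓕 (Δ f) = -(2 * Real.pi) ^ 2 •
        smulLeftCLM ℂ (fun y : E3 => ‖y‖ ^ 2) (𝓕 f) := by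
      rw [SchwartzMap.laplacian_eq_fourierMultiplierCLM, SchwartzMap.fourierMultiplierCLM_apply]
      simp [FourierTransform.fourier_smul]
    rw [h1, h2, add_apply, smul_apply, smul_apply, smulLeftCLM_apply_apply (by fun_prop), smul_smul,
      smul_smul, add_smul, one_smul]
    congr 2
    linear_combination ‖y‖ ^ 2 * hc0
  have hF : ∀ y, ‖𝓕 f y‖ = (1 + ‖y‖ ^ 2)⁻¹ * ‖𝓕 g y‖ := by
    intro y
    have : (0 : ℝ) < 1 + ‖y‖ ^ 2 := by positivity
    rw [hFg, norm_smul, Real.norm_eq_abs, abs_of_pos this, inv_mul_cancel_left₀ this.ne']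
  have h1 : ‖f x‖ ≤ ∫ y, ‖𝓕 f y‖ := by
    have h : 𝓕⁻ (𝓕 f) = f := FourierTransform.fourierInv_fourier_eq f
    conv_lhs => rw [← h, SchwartzMap.fourierInv_coe, Real.fourierInv_eq]
    refine (norm_integral_le_integral_norm _).trans (le_of_eq ?_)
    simp
  have h2 : (∫ y, ‖𝓕 f y‖) ^ 2
      ≤ (∫ y : E3, ((1 + ‖y‖ ^ 2)⁻¹) ^ 2) * ∫ y, ‖𝓕 g y‖ ^ 2 := by
    have hi : Integrable fun y => ‖𝓕 f y‖ := (𝓕 f).integrable.norm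
    simp only [hF] at hi ⊢
    refine sq_integral_mul_le hw ?_ hi
    exact ((𝓕 g).memLp 2).integrable_norm_pow (by norm_num)
  rw [SchwartzMap.integral_norm_sq_fourier] at h2
  simp only [hg] at h2
  exact (pow_le_pow_left₀ (norm_nonneg _) h1 2).trans h2

/-- The Laplacian of ℝ³ in polar coordinates. The cutoff makes the formula valid at the origin too,
where both sides are 0. -/
lemma laplacian_cutoffExt {u : S2 → ℝ} (hu : SphereSmooth u) (x : E3) :
    Laplacian.laplacian (cutoffExt u) x =
      (deriv (deriv radialBump) ‖x‖ + 2 * (‖x‖⁻¹ * deriv radialBump ‖x‖)) * radialExt u x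
        + (‖x‖⁻¹ * (‖x‖⁻¹ * radialBump ‖x‖)) * radialExt (sphereLaplacian u) x := by
  have hb : ContDiff ℝ ∞ radialBump := radialBump.contDiff
  have hb' : ContDiff ℝ 1 (deriv radialBump) :=
    ContDiff.deriv' (radialBump.contDiff (n := 2))
  rw [laplacian_eq_sum_partialD (contDiff_cutoffExt (n := 2)
    (WithTop.coe_le_coe.2 (le_top : (2 : ℕ∞) ≤ ⊤))
    hu.two).contDiffAt]
  by_cases hx : x = 0
  · have : cutoffExt u =ᶠ[nhds x] fun _ => 0 := by
      have hb : Metric.ball x (1 / 2) ∈ nhds x := Metric.ball_mem_nhds _ (by norm_num)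
      filter_upwards [hb] with y hy
      rw [cutoffExt, radialBump_zero, zero_mul]
      left
      simpa [hx] using (Metric.mem_ball.1 hy).le
    have h2 : deriv radialBump =ᶠ[nhds 0] fun _ => (0 : ℝ) := by
      filter_upwards [gt_mem_nhds (show (0 : ℝ) < 1 / 2 by norm_num)] with r hr
      exact deriv_radialBump_zero (.inl hr)
    have h3 : ∀ j, partialD j (partialD j (cutoffExt u)) x = 0 := fun j => by
      have : partialD j (cutoffExt u) =ᶠ[nhds x] fun _ => 0 := by
        filter_upwards [this.eventuallyEq_nhds] with y hy
        rw [partialD_congr hy]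
        simp [partialD]
      rw [partialD_congr this]
      simp [partialD]
    simp only [h3]
    simp [hx, h2.deriv_eq]
  · have hr : ‖x‖ ≠ 0 := norm_ne_zero_iff.2 hx
    have hd : DifferentiableAt ℝ (fun r : ℝ => r⁻¹ * radialBump r) ‖x‖ :=
      (differentiableAt_inv hr).mul (hb.differentiable (by simp) _)
    have key : ∀ j, partialD j (partialD j (cutoffExt u)) x =
        deriv (deriv radialBump) ‖x‖ * (coordFn j (dir x) * (coordFn j (dir x) * u (dir x)))
        + (‖x‖⁻¹ * deriv radialBump ‖x‖) * (coordFn j (dir x) * sphereD j u (dir x)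
          + u (dir x) * (1 - coordFn j (dir x) * coordFn j (dir x)))
        + deriv (fun r : ℝ => r⁻¹ * radialBump r) ‖x‖ * (coordFn j (dir x) * sphereD j u (dir x))
        + (‖x‖⁻¹ * (‖x‖⁻¹ * radialBump ‖x‖)) * sphereD j (sphereD j u) (dir x) := by
      intro j
      have h1 : DifferentiableAt ℝ (fun y : E3 => deriv radialBump ‖y‖
          * radialExt (fun θ => coordFn j θ * u θ) y) x :=
        ((hb'.differentiable one_ne_zero _).comp x (hasFDerivAt_norm_E3 hx).differentiableAt).mul
          (differentiableAt_radialExt (hu.coord_mul j).one hx)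
      have h2 : DifferentiableAt ℝ (fun y : E3 => (‖y‖⁻¹ * radialBump ‖y‖)
          * radialExt (sphereD j u) y) x :=
        (DifferentiableAt.comp x hd (hasFDerivAt_norm_E3 hx).differentiableAt).mul
          (differentiableAt_radialExt (hu.diff j).one hx)
      rw [funext (partialD_cutoffExt hu.one j), partialD_add h1 h2,
        partialD_radial_mul_radialExt hx (hb'.differentiable one_ne_zero _) (hu.coord_mul j).one,
        partialD_radial_mul_radialExt (a := fun r => r⁻¹ * radialBump r) hx hd (hu.diff j).one]
      simp only [radialExt, sphereD_coord_mul hu.one, if_true]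
      ring
    have h0 := sum_coord_mul_sphereD hu.one (dir x)
    have h1 := sum_sq_S2 (dir x)
    simp only [key, radialExt, sphereLaplacian_eq_sum hu.two, coordFn, Fin.sum_univ_three]
      at h0 h1 ⊢
    linear_combination (‖x‖⁻¹ * deriv radialBump ‖x‖
      + deriv (fun r : ℝ => r⁻¹ * radialBump r) ‖x‖) * h0
      + (deriv (deriv radialBump) ‖x‖ - ‖x‖⁻¹ * deriv radialBump ‖x‖) * u (dir x) * h1

/-- The Sobolev inequality on the sphere. -/
lemma sphere_sobolev : ∃ K : ℝ, 0 ≤ K ∧ ∀ u : S2 → ℝ, SphereSmooth u → ∀ θ,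
    u θ ^ 2 ≤ K * (∫ η, u η ^ 2 ∂surfaceMeasure
      + ∫ η, sphereLaplacian u η ^ 2 ∂surfaceMeasure) := by
  obtain ⟨K, hK, hsob⟩ := schwartz_sup_le
  have hb' : ContDiff ℝ 1 (deriv radialBump) :=
    ContDiff.deriv' (radialBump.contDiff (n := 2))
  set c : ℝ := ((2 * Real.pi) ^ 2)⁻¹ with hc
  -- 1 - cΔ takes the cut-off extension of u to a₁(r) u - a₂(r) Δ_S u, so its L² norm is controlled
  -- by those of u and Δ_S u on the sphere, with constants that depend only on the cutoff.
  set a₁ : ℝ → ℝ := fun r => (radialBump r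
    - c * (deriv (deriv radialBump) r + 2 * (r⁻¹ * deriv radialBump r))) with ha₁
  set a₂ : ℝ → ℝ := fun r => c * (r⁻¹ * (r⁻¹ * radialBump r)) with ha₂
  have hinv : ContinuousOn (fun r : ℝ => r⁻¹) (Set.Ioi 0) :=
    continuousOn_inv₀.mono fun r hr => (Set.mem_Ioi.1 hr).ne'
  have hz : ∀ r : ℝ, r < 1 / 2 ∨ 3 / 2 < r → radialBump r = 0 := fun r hr =>
    radialBump_zero (hr.imp le_of_lt le_of_lt)
  have hz2 : ∀ r : ℝ, r < 1 / 2 ∨ 3 / 2 < r → deriv (deriv radialBump) r = 0 := fun r hr => by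
    have : deriv radialBump =ᶠ[nhds r] fun _ => (0 : ℝ) := by
      rcases hr with hr | hr
      · filter_upwards [gt_mem_nhds hr] with y hy using deriv_radialBump_zero (.inl hy)
      · filter_upwards [lt_mem_nhds hr] with y hy using deriv_radialBump_zero (.inr hy)
    rw [this.deriv_eq]
    simp
  have hc1 : ContinuousOn (fun r => 2 * a₁ r ^ 2) (Set.Ioi 0) := by
    refine continuousOn_const.mul (ContinuousOn.pow ?_ 2)
    refine radialBump.continuous.continuousOn.sub (continuousOn_const.mul
      ((hb'.continuous_deriv le_rfl).continuousOn.add (continuousOn_const.mul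
        (hinv.mul hb'.continuous.continuousOn))))
  have hc2 : ContinuousOn (fun r => 2 * a₂ r ^ 2) (Set.Ioi 0) :=
    continuousOn_const.mul ((continuousOn_const.mul
      (hinv.mul (hinv.mul radialBump.continuous.continuousOn))).pow 2)
  have h01 : ∀ r : ℝ, r < 1 / 2 ∨ 3 / 2 < r → 2 * a₁ r ^ 2 = 0 := fun r hr => by
    simp [ha₁, hz r hr, hz2 r hr, deriv_radialBump_zero hr]
  have h02 : ∀ r : ℝ, r < 1 / 2 ∨ 3 / 2 < r → 2 * a₂ r ^ 2 = 0 := fun r hr => by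
    simp [ha₂, hz r hr]
  set I₁ := ∫ r in Set.Ioi (0 : ℝ), r ^ 2 * (2 * a₁ r ^ 2)
  set I₂ := ∫ r in Set.Ioi (0 : ℝ), r ^ 2 * (2 * a₂ r ^ 2)
  have hI₁ : 0 ≤ I₁ := integral_nonneg fun r => by positivity
  have hI₂ : 0 ≤ I₂ := integral_nonneg fun r => by positivity
  refine ⟨K * (I₁ + I₂), by positivity, fun u hu θ => ?_⟩
  have hφ : ContDiff ℝ ∞ (cutoffExt u) := contDiff_cutoffExt le_rfl hu
  have hφc : ContDiff ℝ ∞ (Complex.ofRealCLM ∘ cutoffExt u) := Complex.ofRealCLM.contDiff.comp hφ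
  have hcc : HasCompactSupport (Complex.ofRealCLM ∘ cutoffExt u) :=
    (hasCompactSupport_cutoffExt u).comp_left (map_zero _)
  have h := hsob (hcc.toSchwartzMap hφc) θ
  have hL : ∀ y, Laplacian.laplacian (Complex.ofRealCLM ∘ cutoffExt u) y
      = (Laplacian.laplacian (cutoffExt u) y : ℂ) := fun y =>
    ContDiffAt.laplacian_CLM_comp_left (l := Complex.ofRealCLM)
      (contDiff_cutoffExt (n := 2) (WithTop.coe_le_coe.2 (le_top : (2 : ℕ∞) ≤ ⊤)) hu.two).contDiffAt
  have hpt : ∀ y : E3, ‖(hcc.toSchwartzMap hφc) y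
      - c • Laplacian.laplacian (hcc.toSchwartzMap hφc : E3 → ℂ) y‖ ^ 2
      ≤ (2 * a₁ ‖y‖ ^ 2) * radialExt (fun η => u η ^ 2) y
        + (2 * a₂ ‖y‖ ^ 2) * radialExt (fun η => sphereLaplacian u η ^ 2) y := by
    intro y
    have e : ((hcc.toSchwartzMap hφc : E3 → ℂ)) = Complex.ofRealCLM ∘ cutoffExt u := rfl
    rw [e, hL, laplacian_cutoffExt hu, Function.comp_apply, Complex.ofRealCLM_apply, cutoffExt,
      Complex.real_smul, ← Complex.ofReal_mul, ← Complex.ofReal_sub, Complex.norm_real,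
      Real.norm_eq_abs, sq_abs]
    simp only [radialExt, ha₁, ha₂]
    have := add_sq_le (a := a₁ ‖y‖ * u (dir y)) (b := -(a₂ ‖y‖ * sphereLaplacian u (dir y)))
    simp only [ha₁, ha₂] at this
    refine (le_of_eq ?_).trans (this.trans (le_of_eq ?_)) <;> ring
  have hu2 : Continuous fun η => u η ^ 2 := hu.continuous.pow 2
  have hl2 : Continuous fun η => sphereLaplacian u η ^ 2 := hu.laplacian.continuous.pow 2
  have hi1 := integrable_radial_mul_radialExt hc1 h01 hu2
  have hi2 := integrable_radial_mul_radialExt hc2 h02 hl2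
  have hle := integral_mono_of_nonneg (μ := (volume : Measure E3))
    (Filter.Eventually.of_forall fun y => by positivity) (hi1.add hi2)
    (Filter.Eventually.of_forall hpt)
  have e1 : ∫ y : E3, ((2 * a₁ ‖y‖ ^ 2) * radialExt (fun η => u η ^ 2) y
        + (2 * a₂ ‖y‖ ^ 2) * radialExt (fun η => sphereLaplacian u η ^ 2) y)
      = I₁ * ∫ η, u η ^ 2 ∂surfaceMeasure + I₂ * ∫ η, sphereLaplacian u η ^ 2 ∂surfaceMeasure := by
    rw [integral_add hi1 hi2, integral_radial_mul_radialExt (fun r => 2 * a₁ r ^ 2),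
      integral_radial_mul_radialExt (fun r => 2 * a₂ r ^ 2)]
  have hθ : ‖(hcc.toSchwartzMap hφc) θ‖ ^ 2 = u θ ^ 2 := by
    change ‖((cutoffExt u θ : ℝ) : ℂ)‖ ^ 2 = _
    rw [cutoffExt_S2, Complex.norm_real, Real.norm_eq_abs, sq_abs]
  rw [hθ] at h
  have hU : 0 ≤ ∫ η, u η ^ 2 ∂surfaceMeasure := integral_nonneg fun η => sq_nonneg _
  have hV : 0 ≤ ∫ η, sphereLaplacian u η ^ 2 ∂surfaceMeasure :=
    integral_nonneg fun η => sq_nonneg _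
  refine h.trans ((mul_le_mul_of_nonneg_left (hle.trans (le_of_eq e1)) hK).trans ?_)
  rw [mul_assoc]
  refine mul_le_mul_of_nonneg_left ?_ hK
  nlinarith [mul_nonneg hI₁ hV, mul_nonneg hI₂ hU]

/-! ### The pairing of functions on the sphere -/

lemma integrable_mul_S2 {f u : S2 → ℝ} (hf : Continuous f) (hu : Continuous u) :
    Integrable (fun θ => f θ * u θ) surfaceMeasure :=
  integrable_of_continuous_S2 (hf.mul hu)

lemma sphereInner_comm (f u : S2 → ℝ) : sphereInner f u = sphereInner u f := by
  simp only [sphereInner, mul_comm]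

lemma sphereInner_add_left {f g u : S2 → ℝ} (hf : Continuous f) (hg : Continuous g)
    (hu : Continuous u) :
    sphereInner (fun θ => f θ + g θ) u = sphereInner f u + sphereInner g u := by
  simp only [sphereInner, add_mul]
  exact integral_add (integrable_mul_S2 hf hu) (integrable_mul_S2 hg hu)

lemma sphereInner_const_mul_left (c : ℝ) (f u : S2 → ℝ) :
    sphereInner (fun θ => c * f θ) u = c * sphereInner f u := by
  simp only [sphereInner, mul_assoc]
  exact integral_const_mul _ _

lemma sphereInner_sub_left {f g u : S2 → ℝ} (hf : Continuous f) (hg : Continuous g)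
    (hu : Continuous u) :
    sphereInner (fun θ => f θ - g θ) u = sphereInner f u - sphereInner g u := by
  simp only [sphereInner, sub_mul]
  exact integral_sub (integrable_mul_S2 hf hu) (integrable_mul_S2 hg hu)

lemma sphereInner_sum_left {ι : Type*} {s : Finset ι} {f : ι → S2 → ℝ} {u : S2 → ℝ}
    (hf : ∀ i ∈ s, Continuous (f i)) (hu : Continuous u) :
    sphereInner (fun θ => ∑ i ∈ s, f i θ) u = ∑ i ∈ s, sphereInner (f i) u := by
  simp only [sphereInner, Finset.sum_mul]
  exact integral_finsetSum _ fun i hi => integrable_mul_S2 (hf i hi) hu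

lemma sphereInner_add_right {f g u : S2 → ℝ} (hf : Continuous f) (hg : Continuous g)
    (hu : Continuous u) :
    sphereInner u (fun θ => f θ + g θ) = sphereInner u f + sphereInner u g := by
  rw [sphereInner_comm, sphereInner_add_left hf hg hu, sphereInner_comm f, sphereInner_comm g]

lemma sphereInner_const_mul_right (c : ℝ) (f u : S2 → ℝ) :
    sphereInner u (fun θ => c * f θ) = c * sphereInner u f := by
  rw [sphereInner_comm, sphereInner_const_mul_left, sphereInner_comm]

lemma sphereInner_sub_right {f g u : S2 → ℝ} (hf : Continuous f) (hg : Continuous g)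
    (hu : Continuous u) :
    sphereInner u (fun θ => f θ - g θ) = sphereInner u f - sphereInner u g := by
  rw [sphereInner_comm, sphereInner_sub_left hf hg hu, sphereInner_comm f, sphereInner_comm g]

lemma sphereInner_sum_right {ι : Type*} {s : Finset ι} {f : ι → S2 → ℝ} {u : S2 → ℝ}
    (hf : ∀ i ∈ s, Continuous (f i)) (hu : Continuous u) :
    sphereInner u (fun θ => ∑ i ∈ s, f i θ) = ∑ i ∈ s, sphereInner u (f i) := by
  rw [sphereInner_comm, sphereInner_sum_left hf hu]
  exact Finset.sum_congr rfl fun i _ => sphereInner_comm _ _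

lemma sphereInner_self_nonneg (f : S2 → ℝ) : 0 ≤ sphereInner f f :=
  integral_nonneg fun _ => mul_self_nonneg _

lemma sphereInner_le_half {f g : S2 → ℝ} (hf : Continuous f) (hg : Continuous g) :
    sphereInner f g ≤ 1 / 2 * sphereInner f f + 1 / 2 * sphereInner g g := by
  have h := sphereInner_self_nonneg fun θ => f θ - g θ
  have hc : Continuous fun θ => f θ - g θ := hf.sub hg
  rw [sphereInner_sub_left hf hg hc, sphereInner_sub_right hf hg hf,
    sphereInner_sub_right hf hg hg, sphereInner_comm g f] at h
  linarith

lemma sphereInner_self_coord_mul_le {f : S2 → ℝ} (hf : Continuous f) (j : Fin 3) :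
    sphereInner (fun θ => coordFn j θ * f θ) (fun θ => coordFn j θ * f θ)
      ≤ sphereInner f f := by
  have hc := (contMDiff_coordFn 1 j).continuous
  refine integral_mono (integrable_mul_S2 (hc.mul hf) (hc.mul hf)) (integrable_mul_S2 hf hf)
    fun θ => ?_
  have h : coordFn j θ ^ 2 ≤ 1 := by
    rw [← sum_sq_S2 θ]
    exact Finset.single_le_sum (f := fun i => (θ : E3) i ^ 2) (fun i _ => sq_nonneg _)
      (Finset.mem_univ j)
  simp only
  nlinarith [mul_self_nonneg (f θ)]

lemma sphereInner_self_sub_le {f g : S2 → ℝ} (hf : Continuous f) (hg : Continuous g) :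
    sphereInner (fun θ => f θ - g θ) (fun θ => f θ - g θ)
      ≤ 2 * sphereInner f f + 2 * sphereInner g g := by
  have h := sphereInner_self_nonneg fun θ => f θ + g θ
  have hc : Continuous fun θ => f θ + g θ := hf.add hg
  have hc' : Continuous fun θ => f θ - g θ := hf.sub hg
  rw [sphereInner_add_left hf hg hc, sphereInner_add_right hf hg hf,
    sphereInner_add_right hf hg hg, sphereInner_comm g f] at h
  rw [sphereInner_sub_left hf hg hc', sphereInner_sub_right hf hg hf,
    sphereInner_sub_right hf hg hg, sphereInner_comm g f]
  linarith

/-- Integration by parts on the sphere. -/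
lemma sphereInner_sphereD {f v : S2 → ℝ} (hf : ContMDiff (𝓡 2) 𝓘(ℝ, ℝ) 1 f)
    (hv : ContMDiff (𝓡 2) 𝓘(ℝ, ℝ) 1 v) (j : Fin 3) :
    sphereInner (sphereD j f) v
      = 2 * sphereInner f (fun θ => coordFn j θ * v θ) - sphereInner f (sphereD j v) := by
  have h := integral_sphereD (u := fun θ => f θ * v θ) (hf.mul hv) j
  have hf' := (contMDiff_sphereD hf (m := 0) (by simp) j).continuous
  have hv' := (contMDiff_sphereD hv (m := 0) (by simp) j).continuous
  simp only [sphereD_mul hf hv] at h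
  rw [integral_add (integrable_mul_S2 hf.continuous hv')
    (integrable_mul_S2 hv.continuous hf')] at h
  simp only [sphereInner]
  have e1 : ∀ θ, sphereD j f θ * v θ = v θ * sphereD j f θ := fun θ => mul_comm _ _
  have e2 : ∀ θ, f θ * (coordFn j θ * v θ) = coordFn j θ * (f θ * v θ) := fun θ => by ring
  simp only [e1, e2]
  linarith

/-- Green's formula on the sphere. -/
lemma sum_sphereInner_sphereD {p q : S2 → ℝ} (hp : SphereSmooth p) (hq : SphereSmooth q) :
    ∑ j, sphereInner (sphereD j p) (sphereD j q) = - sphereInner p (sphereLaplacian q) := by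
  simp only [fun j => sphereInner_sphereD hp.one (hq.diff j).one j]
  rw [Finset.sum_sub_distrib, ← Finset.mul_sum,
    ← sphereInner_sum_right (fun j _ => ((hq.diff j).coord_mul j).continuous) hp.continuous,
    ← sphereInner_sum_right (fun j _ => ((hq.diff j).diff j).continuous) hp.continuous,
    ← funext (sphereLaplacian_eq_sum hq.two)]
  have : (fun θ => ∑ j, coordFn j θ * sphereD j q θ) = fun _ => 0 :=
    funext (sum_coord_mul_sphereD hq.one)
  rw [this]
  simp [sphereInner]

lemma sphereInner_sphereD_self_le {p : S2 → ℝ} (hp : SphereSmooth p) (j : Fin 3) :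
    sphereInner (sphereD j p) (sphereD j p) ≤ - sphereInner p (sphereLaplacian p) := by
  rw [← sum_sphereInner_sphereD hp hp]
  exact Finset.single_le_sum (f := fun j => sphereInner (sphereD j p) (sphereD j p))
    (fun i _ => sphereInner_self_nonneg _) (Finset.mem_univ j)

/-! ### Finite combinations of eigenfunctions -/

/-- A finite linear combination of the functions `A n`. -/
def combo (A : ℕ → S2 → ℝ) (S : Finset ℕ) (b : ℕ → ℝ) (θ : S2) : ℝ := ∑ n ∈ S, b n * A n θ

lemma combo_mem_span (A : ℕ → S2 → ℝ) (S : Finset ℕ) (b : ℕ → ℝ) :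
    combo A S b ∈ Submodule.span ℝ (Set.range A) := by
  have e : combo A S b = ∑ n ∈ S, b n • A n := by
    funext θ
    simp [combo]
  rw [e]
  exact Submodule.sum_mem _ fun n _ =>
    Submodule.smul_mem _ _ (Submodule.subset_span ⟨n, rfl⟩)

lemma isEigenfunction_const (c : ℝ) : IsEigenfunction 0 fun _ => c := by
  refine ⟨sphereSmooth_const c, fun θ => ?_⟩
  rw [sphereLaplacian_eq_sum (sphereSmooth_const c).two]
  have : ∀ j, sphereD j (fun _ : S2 => c) = fun _ => 0 := fun j => funext (sphereD_const c j)
  simp [this, sphereD_const]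

lemma isEigenfunction_coordFn (k : Fin 3) : IsEigenfunction (-2) (coordFn k) := by
  refine ⟨sphereSmooth_coordFn k, fun θ => ?_⟩
  have h := sphereLaplacian_coord_mul (sphereSmooth_const 1) k θ
  have h1 := (isEigenfunction_const 1).2 θ
  rw [h1, sphereD_const] at h
  simp only [mul_one] at h
  have e : (fun η => coordFn k η) = coordFn k := rfl
  rw [e] at h
  linarith

namespace IsSphericalEigensystem

variable {ξ : ℕ → ℝ} {A : ℕ → S2 → ℝ}

lemma smooth (hE : IsSphericalEigensystem ξ A) (n : ℕ) : SphereSmooth (A n) := (hE.eigen n).1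

lemma nonpos (hE : IsSphericalEigensystem ξ A) (n : ℕ) : ξ n ≤ 0 :=
  hE.zero ▸ hE.antitone (Nat.zero_le n)

lemma combo_smooth (hE : IsSphericalEigensystem ξ A) (S : Finset ℕ) (b : ℕ → ℝ) :
    SphereSmooth (combo A S b) :=
  SphereSmooth.sum fun n _ => (hE.smooth n).const_mul (b n)

lemma sphereInner_combo (hE : IsSphericalEigensystem ξ A) {f : S2 → ℝ} (hf : Continuous f)
    (S : Finset ℕ) (b : ℕ → ℝ) :
    sphereInner f (combo A S b) = ∑ n ∈ S, b n * sphereInner f (A n) := by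
  have h := sphereInner_sum_right (s := S) (f := fun n θ => b n * A n θ)
    (fun n _ => ((hE.smooth n).const_mul (b n)).continuous) hf
  simp only [sphereInner_const_mul_right] at h
  exact h

lemma combo_coeff (hE : IsSphericalEigensystem ξ A) (S : Finset ℕ) (b : ℕ → ℝ) (k : ℕ) :
    sphereInner (combo A S b) (A k) = if k ∈ S then b k else 0 := by
  rw [sphereInner_comm, hE.sphereInner_combo (hE.smooth k).continuous]
  simp [hE.orthonormal]

lemma sphereInner_combo_combo (hE : IsSphericalEigensystem ξ A) (S : Finset ℕ) (b c : ℕ → ℝ) :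
    sphereInner (combo A S b) (combo A S c) = ∑ n ∈ S, b n * c n := by
  rw [hE.sphereInner_combo (hE.combo_smooth S b).continuous]
  refine Finset.sum_congr rfl fun n hn => ?_
  rw [hE.combo_coeff, if_pos hn, mul_comm]

lemma laplacian_combo (hE : IsSphericalEigensystem ξ A) (S : Finset ℕ) (b : ℕ → ℝ) :
    sphereLaplacian (combo A S b) = combo A S fun n => ξ n * b n := by
  funext θ
  have h := sphereLaplacian_sum (s := S) (u := fun n θ => b n * A n θ)
    (fun n _ => (hE.smooth n).const_mul (b n)) θ
  refine h.trans (Finset.sum_congr rfl fun n _ => ?_)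
  rw [sphereLaplacian_const_mul (hE.smooth n), (hE.eigen n).2]
  ring

lemma exists_combo (hE : IsSphericalEigensystem ξ A) {u : S2 → ℝ}
    (hu : u ∈ Submodule.span ℝ (Set.range A)) :
    ∃ S : Finset ℕ, (∀ n ∉ S, sphereInner u (A n) = 0) ∧
      u = combo A S fun n => sphereInner u (A n) := by
  obtain ⟨c, hc⟩ := (Finsupp.mem_span_range_iff_exists_finsupp).1 hu
  have h : u = combo A c.support c := by
    rw [← hc]
    funext θ
    simp [Finsupp.sum, combo, Finset.sum_apply]
  refine ⟨c.support, fun n hn => ?_, ?_⟩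
  · rw [h, hE.combo_coeff, if_neg hn]
  · conv_lhs => rw [h]
    funext θ
    refine Finset.sum_congr rfl fun n hn => ?_
    simp only
    rw [h, hE.combo_coeff, if_pos hn]

/-! ### Ladder operators and the spectral gap -/

lemma eigenvalue_eq (hE : IsSphericalEigensystem ξ A) {μ : ℝ} {u : S2 → ℝ}
    (hu : IsEigenfunction μ u) {n : ℕ}
    (hn : sphereInner u (A n) ≠ 0) : ξ n = μ := by
  obtain ⟨S, hS, h⟩ := hE.exists_combo (hE.exhaustive μ u hu)
  have hnS : n ∈ S := by
    by_contra h0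
    exact hn (hS n h0)
  have h1 : sphereLaplacian u = fun θ => μ * u θ := funext hu.2
  -- The n-th coefficient of Δu is computed twice: from the eigenvalue equation, and from the
  -- expansion of u as a finite combination.
  have h2 : sphereInner (sphereLaplacian u) (A n) = μ * sphereInner u (A n) := by
    rw [h1, sphereInner_const_mul_left]
  have h3 : sphereInner (sphereLaplacian u) (A n) = ξ n * sphereInner u (A n) := by
    conv_lhs => rw [h, hE.laplacian_combo, hE.combo_coeff, if_pos hnS]
  exact mul_right_cancel₀ hn (h3.symm.trans h2)

/-- If ξ_n = -l(l+1), the two roots a = l and a = -(l+1) give the eigenvalues -(l-1)l and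
-(l+1)(l+2): these are the lowering and raising operators on spherical harmonics. Nothing here
requires l to be an integer. -/
lemma isEigenfunction_sphereD_add (hE : IsSphericalEigensystem ξ A) {a : ℝ} {n : ℕ}
    (ha : a ^ 2 + a + ξ n = 0) (j : Fin 3) :
    IsEigenfunction (ξ n + 2 * a) fun θ => sphereD j (A n) θ + a * (coordFn j θ * A n θ) := by
  have hA := hE.smooth n
  refine ⟨(hA.diff j).add ((hA.coord_mul j).const_mul a), fun θ => ?_⟩
  have h1 : sphereLaplacian (A n) = fun θ => ξ n * A n θ := funext (hE.eigen n).2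
  rw [sphereLaplacian_add (hA.diff j) ((hA.coord_mul j).const_mul a),
    sphereLaplacian_const_mul (hA.coord_mul j), sphereLaplacian_sphereD hA,
    sphereLaplacian_coord_mul hA, h1, sphereD_const_mul hA.one]
  linear_combination (-2 * coordFn j θ * A n θ) * ha

lemma exists_root (hE : IsSphericalEigensystem ξ A) (n : ℕ) : ∃ l :
    ℝ, 0 ≤ l ∧ l ^ 2 + l + ξ n = 0 := by
  have h : 1 ≤ √(1 - 4 * ξ n) := Real.one_le_sqrt.2 (by linarith [hE.nonpos n])
  refine ⟨(-1 + √(1 - 4 * ξ n)) / 2, by linarith, ?_⟩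
  have := Real.sq_sqrt (show 0 ≤ 1 - 4 * ξ n by linarith [hE.nonpos n])
  linear_combination (1 / 4) * this

/-- The lowered and raised functions belong to the span by exhaustiveness. Their difference is
(2l+1) x_j A_n; with weights l+1 and l they add up to (2l+1) D_j A_n. -/
lemma span_coord_mul_sphereD (hE : IsSphericalEigensystem ξ A) (n : ℕ) (j : Fin 3) :
    (fun θ => coordFn j θ * A n θ) ∈ Submodule.span ℝ (Set.range A) ∧
      sphereD j (A n) ∈ Submodule.span ℝ (Set.range A) := by
  obtain ⟨l, hl, hl2⟩ := hE.exists_root n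
  have h1 := hE.exhaustive _ _ (hE.isEigenfunction_sphereD_add hl2 j)
  have h2 := hE.exhaustive _ _ (hE.isEigenfunction_sphereD_add (a := -(l + 1))
    (by linear_combination hl2) j)
  have h0 : 2 * l + 1 ≠ 0 := by linarith
  constructor
  · convert Submodule.smul_mem _ (2 * l + 1)⁻¹ (Submodule.sub_mem _ h1 h2) using 1
    funext θ
    simp
    field_simp
    ring
  · convert Submodule.smul_mem _ (2 * l + 1)⁻¹
      (Submodule.add_mem _ (Submodule.smul_mem _ (l + 1) h1) (Submodule.smul_mem _ l h2)) using 1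
    funext θ
    simp
    field_simp
    ring

lemma coord_mul_mem_span (hE : IsSphericalEigensystem ξ A) {u : S2 → ℝ}
    (hu : u ∈ Submodule.span ℝ (Set.range A)) (j : Fin 3) :
    (fun θ => coordFn j θ * u θ) ∈ Submodule.span ℝ (Set.range A) := by
  obtain ⟨S, -, h⟩ := hE.exists_combo hu
  have e : (fun θ => coordFn j θ * u θ)
      = ∑ n ∈ S, sphereInner u (A n) • fun θ => coordFn j θ * A n θ := by
    funext θ
    conv_lhs => rw [h]
    simp only [combo, Finset.mul_sum, Finset.sum_apply, Pi.smul_apply, smul_eq_mul]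
    exact Finset.sum_congr rfl fun n _ => by ring
  rw [e]
  exact Submodule.sum_mem _ fun n _ =>
    Submodule.smul_mem _ _ (hE.span_coord_mul_sphereD n j).1

lemma sphereD_mem_span (hE : IsSphericalEigensystem ξ A) {u : S2 → ℝ}
    (hu : u ∈ Submodule.span ℝ (Set.range A)) (j : Fin 3) :
    sphereD j u ∈ Submodule.span ℝ (Set.range A) := by
  obtain ⟨S, -, h⟩ := hE.exists_combo hu
  have e : sphereD j u = ∑ n ∈ S, sphereInner u (A n) • sphereD j (A n) := by
    funext θ
    conv_lhs => rw [h]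
    have := sphereD_sum (s := S) (u := fun n θ => sphereInner u (A n) * A n θ)
      (fun n _ => ((hE.smooth n).const_mul _).one) j θ
    refine this.trans ?_
    simp only [Finset.sum_apply, Pi.smul_apply, smul_eq_mul]
    exact Finset.sum_congr rfl fun n _ => sphereD_const_mul (hE.smooth n).one _ _ _
  rw [e]
  exact Submodule.sum_mem _ fun n _ =>
    Submodule.smul_mem _ _ (hE.span_coord_mul_sphereD n j).2

lemma eq_zero_of_coeff (hE : IsSphericalEigensystem ξ A) {u : S2 → ℝ}
    (hu : u ∈ Submodule.span ℝ (Set.range A))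
    (h0 : ∀ n, sphereInner u (A n) = 0) (θ : S2) : u θ = 0 := by
  obtain ⟨S, -, h⟩ := hE.exists_combo hu
  rw [h]
  simp [combo, h0]

/-- If -2 < ξ_n < 0 then 0 < l < 1, and the lowered functions would have a positive eigenvalue, so
they vanish: D_j A_n = -l x_j A_n. Contraction with x and Euler's relation give A_n = 0, against its
normalisation. -/
lemma eigenvalue_le_neg_two (hE : IsSphericalEigensystem ξ A) {n : ℕ} (hn : n ≠ 0) : ξ n ≤ -2 := by
  by_contra! hlt
  have hneg : ξ n < 0 := (hE.antitone (Nat.one_le_iff_ne_zero.2 hn)).trans_lt hE.one_neg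
  obtain ⟨l, hl, hl2⟩ := hE.exists_root n
  have hl0 : 0 < l := by
    rcases hl.eq_or_lt with h | h
    · rw [← h] at hl2; linarith
    · exact h
  have hl1 : l < 1 := by nlinarith
  have hg : ∀ j θ, sphereD j (A n) θ + l * (coordFn j θ * A n θ) = 0 := by
    intro j
    have he := hE.isEigenfunction_sphereD_add hl2 j
    refine hE.eq_zero_of_coeff (hE.exhaustive _ _ he) fun k => ?_
    by_contra hk
    have := hE.eigenvalue_eq he hk
    -- The lowered eigenvalue is ξ_n + 2l = l(1 - l) > 0.
    nlinarith [hE.nonpos k]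
  have hz : ∀ θ, A n θ = 0 := by
    intro θ
    have h1 := sum_coord_mul_sphereD (hE.smooth n).one θ
    have h2 := sum_sq_S2 θ
    have h3 : l * A n θ = 0 := by
      simp only [Fin.sum_univ_three] at h1 h2
      have g0 := hg 0 θ
      have g1 := hg 1 θ
      have g2 := hg 2 θ
      simp only [coordFn] at g0 g1 g2
      linear_combination (θ : E3) 0 * g0 + (θ : E3) 1 * g1 + (θ : E3) 2 * g2 - h1
        - l * A n θ * h2
    exact (mul_eq_zero.1 h3).resolve_left hl0.ne'
  have := hE.orthonormal n n
  simp [sphereInner, hz] at this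

/-- The constant 1 has eigenvalue 0, so by the spectral gap only A_0 occurs in its expansion. -/
lemma exists_const (hE : IsSphericalEigensystem ξ A) : ∃ a : ℝ, a ≠ 0 ∧ A 0 = fun _ => a := by
  have he := isEigenfunction_const 1
  obtain ⟨S, hS, h⟩ := hE.exists_combo (hE.exhaustive _ _ he)
  have h0 : ∀ n, n ≠ 0 → sphereInner (fun _ => 1) (A n) = 0 := by
    intro n hn
    by_contra hk
    have := hE.eigenvalue_eq he hk
    linarith [hE.eigenvalue_le_neg_two hn]
  have h1 : ∀ θ, (1 : ℝ) = sphereInner (fun _ => 1) (A 0) * A 0 θ := by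
    intro θ
    have := congrFun h θ
    simp only [combo] at this
    rw [Finset.sum_eq_single 0 (fun n _ hn => by rw [h0 n hn, zero_mul])
      (fun h0 => by rw [hS 0 h0, zero_mul])] at this
    exact this
  have hc : sphereInner (fun _ => 1) (A 0) ≠ 0 := fun h0 => by
    have := h1 (dir 0)
    rw [h0, zero_mul] at this
    exact one_ne_zero this
  refine ⟨(sphereInner (fun _ => 1) (A 0))⁻¹, inv_ne_zero hc, funext fun θ => ?_⟩
  rw [← mul_right_inj' hc, mul_inv_cancel₀ hc]
  exact (h1 θ).symm

end IsSphericalEigensystem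

lemma continuous_sphereInner {f : S2 → ℝ} (hf : Continuous f) :
    Continuous fun p : C(S2, ℝ) => sphereInner f p := by
  refine continuous_iff_continuousAt.2 fun p => ?_
  obtain ⟨M, hM⟩ := (isCompact_range hf).isBounded.exists_norm_le
  refine continuousAt_of_dominated (bound := fun _ => M * (‖p‖ + 1))
    (Filter.Eventually.of_forall fun q => (hf.mul q.continuous).aestronglyMeasurable) ?_
    (integrable_const _) (Filter.Eventually.of_forall fun η =>
      (continuous_const.mul (continuous_eval_const η)).continuousAt)
  filter_upwards [Metric.ball_mem_nhds p one_pos] with q hq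
  refine Filter.Eventually.of_forall fun η => ?_
  rw [norm_mul]
  have h1 : ‖q‖ ≤ ‖p‖ + 1 := by
    have := norm_sub_norm_le q p
    rw [Metric.mem_ball, dist_eq_norm] at hq
    linarith
  exact mul_le_mul (hM _ ⟨η, rfl⟩) ((q.norm_coe_le_norm η).trans h1) (norm_nonneg _)
    ((norm_nonneg _).trans (hM _ ⟨η, rfl⟩))

namespace IsSphericalEigensystem

variable {ξ : ℕ → ℝ} {A : ℕ → S2 → ℝ}

/-! ### Completeness -/

/-- The span of the A_n is a module over the algebra generated by the coordinates. As it contains 1,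
it contains every polynomial. -/
lemma polynomial_mem_span (hE : IsSphericalEigensystem ξ A) {f : C(S2, ℝ)}
    (hf : f ∈ Algebra.adjoin ℝ (Set.range fun i : Fin 3 =>
      (⟨coordFn i, (sphereSmooth_coordFn i).continuous⟩ : C(S2, ℝ)))) :
    ∀ u ∈ Submodule.span ℝ (Set.range A),
      (fun θ => f θ * u θ) ∈ Submodule.span ℝ (Set.range A) := by
  induction hf using Algebra.adjoin_induction with
  | mem x hx =>
    obtain ⟨i, rfl⟩ := hx
    exact fun u hu => hE.coord_mul_mem_span hu i
  | algebraMap r =>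
    intro u hu
    exact Submodule.smul_mem _ r hu
  | add x y _ _ hx hy =>
    intro u hu
    convert Submodule.add_mem _ (hx u hu) (hy u hu) using 1
    funext θ
    simp [add_mul]
  | mul x y _ _ hx hy =>
    intro u hu
    convert hx _ (hy u hu) using 1
    funext θ
    simp [mul_assoc]

/-- Completeness: f is orthogonal to all polynomials, hence by Stone–Weierstrass to every continuous
function, and so to itself. -/
lemma eq_zero_of_forall_coeff (hE : IsSphericalEigensystem ξ A) {f : S2 → ℝ} (hf : Continuous f)
    (h0 : ∀ n, sphereInner f (A n) = 0) (θ : S2) : f θ = 0 := by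
  let X : Fin 3 → C(S2, ℝ) := fun i => ⟨coordFn i, (sphereSmooth_coordFn i).continuous⟩
  let P := Algebra.adjoin ℝ (Set.range X)
  have hsep : P.SeparatesPoints := by
    intro x y hxy
    by_contra! hc
    apply hxy
    apply Subtype.ext
    ext i
    exact hc _ ⟨X i, Algebra.subset_adjoin ⟨i, rfl⟩, rfl⟩
  have hdense := ContinuousMap.subalgebra_topologicalClosure_eq_top_of_separatesPoints P hsep
  have hone : (fun _ => (1 : ℝ)) ∈ Submodule.span ℝ (Set.range A) :=
    hE.exhaustive _ _ (isEigenfunction_const 1)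
  let L : C(S2, ℝ) → ℝ := fun p => ∫ η, f η * p η ∂surfaceMeasure
  have hL : Continuous L := continuous_sphereInner hf
  have hLP : ∀ p ∈ P, L p = 0 := by
    intro p hp
    have h1 := hE.polynomial_mem_span hp _ hone
    simp only [mul_one] at h1
    obtain ⟨S, -, h⟩ := hE.exists_combo h1
    change sphereInner f (fun θ => p θ) = 0
    rw [h, hE.sphereInner_combo hf]
    simp [h0]
  have hLall : ∀ p, L p = 0 := by
    intro p
    have hp : p ∈ P.topologicalClosure := by rw [hdense]; trivial
    have hcl : IsClosed {p | L p = 0} := isClosed_eq hL continuous_const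
    exact closure_minimal (fun q hq => hLP q hq) hcl hp
  have hff := hLall ⟨f, hf⟩
  have hcont : Continuous fun η => f η * f η := hf.mul hf
  by_contra hne
  have hpos := Continuous.integral_pos_of_hasCompactSupport_nonneg_nonzero (μ := surfaceMeasure)
    (x := θ) hcont (HasCompactSupport.of_compactSpace _) (fun η => mul_self_nonneg _)
    (mul_self_ne_zero.2 hne)
  exact hpos.ne' hff

/-! ### Bounds for finite combinations -/

lemma sq_mul_le_weight (hE : IsSphericalEigensystem ξ A) (n : ℕ) (x : ℝ) :
    x ^ 2 + (ξ n * x) ^ 2 ≤ (1 - ξ n) ^ 2 * x ^ 2 := by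
  nlinarith [mul_nonneg (neg_nonneg.2 (hE.nonpos n)) (sq_nonneg x)]

lemma combo_sup_le (hE : IsSphericalEigensystem ξ A) {K : ℝ} (hK0 : 0 ≤ K)
    (hK : ∀ u : S2 → ℝ, SphereSmooth u → ∀ θ, u θ ^ 2 ≤ K * (∫ η, u η ^ 2 ∂surfaceMeasure
      + ∫ η, sphereLaplacian u η ^ 2 ∂surfaceMeasure)) (S : Finset ℕ) (b : ℕ → ℝ) (θ : S2) :
    combo A S b θ ^ 2 ≤ K * ∑ n ∈ S, (1 - ξ n) ^ 2 * b n ^ 2 := by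
  refine (hK _ (hE.combo_smooth S b) θ).trans (mul_le_mul_of_nonneg_left ?_ hK0)
  have h1 := hE.sphereInner_combo_combo S b b
  have h2 := hE.sphereInner_combo_combo S (fun n => ξ n * b n) fun n => ξ n * b n
  simp only [sphereInner, ← sq] at h1 h2
  rw [hE.laplacian_combo, h1, h2, ← Finset.sum_add_distrib]
  exact Finset.sum_le_sum fun n _ => hE.sq_mul_le_weight n (b n)

/-- The Sobolev inequality for D_i u. With p = Δu, the commutation relation gives ΔD_i u = D_i p - 2
x_i p, and Green's formula turns the L² norms of gradients into sums over coefficients. -/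
lemma combo_gradient_sup_le (hE : IsSphericalEigensystem ξ A) {K : ℝ} (hK0 : 0 ≤ K)
    (hK : ∀ u : S2 → ℝ, SphereSmooth u → ∀ θ, u θ ^ 2 ≤ K * (∫ η, u η ^ 2 ∂surfaceMeasure
      + ∫ η, sphereLaplacian u η ^ 2 ∂surfaceMeasure)) (S : Finset ℕ) {b : ℕ → ℝ}
    (hb : b 0 = 0) (i : Fin 3) (θ : S2) :
    sphereD i (combo A S b) θ ^ 2 ≤ 9 * K * ∑ n ∈ S, (1 - ξ n) * (ξ n * b n) ^ 2 := by
  have hu := hE.combo_smooth S b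
  have hp := hE.combo_smooth S fun n => ξ n * b n
  refine (hK _ (hu.diff i) θ).trans ?_
  rw [mul_comm 9 K, mul_assoc]
  refine mul_le_mul_of_nonneg_left ?_ hK0
  have h1 := sphereInner_sphereD_self_le hu i
  have h2 := sphereInner_sphereD_self_le hp i
  rw [hE.laplacian_combo, hE.sphereInner_combo_combo] at h1 h2
  have h3 := sphereInner_self_sub_le (hp.diff i).continuous
    ((hp.coord_mul i).const_mul 2).continuous
  have h4 := sphereInner_self_coord_mul_le hp.continuous i
  rw [hE.sphereInner_combo_combo] at h4
  have hL : sphereLaplacian (sphereD i (combo A S b)) = fun η =>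
      sphereD i (combo A S fun n => ξ n * b n) η
        - 2 * (coordFn i η * combo A S (fun n => ξ n * b n) η) := by
    funext η
    rw [sphereLaplacian_sphereD hu, hE.laplacian_combo]
  rw [hL]
  rw [sphereInner_const_mul_left, sphereInner_const_mul_right] at h3
  have e1 : ∫ η, sphereD i (combo A S b) η ^ 2 ∂surfaceMeasure
      = sphereInner (sphereD i (combo A S b)) (sphereD i (combo A S b)) := by
    simp only [sphereInner, sq]
  have e2 : ∫ η, (sphereD i (combo A S fun n => ξ n * b n) η
        - 2 * (coordFn i η * combo A S (fun n => ξ n * b n) η)) ^ 2 ∂surfaceMeasure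
      = sphereInner (fun η => sphereD i (combo A S fun n => ξ n * b n) η
        - 2 * (coordFn i η * combo A S (fun n => ξ n * b n) η))
        (fun η => sphereD i (combo A S fun n => ξ n * b n) η
        - 2 * (coordFn i η * combo A S (fun n => ξ n * b n) η)) := by
    simp only [sphereInner, sq]
  rw [e1, e2]
  -- Termwise, with t = -ξ_n ≥ 2, this is t + 2t³ + 8t² ≤ 9(1 + t)t².
  have hsum : -(∑ n ∈ S, b n * (ξ n * b n))
      + (2 * -(∑ n ∈ S, ξ n * b n * (ξ n * (ξ n * b n)))
        + 8 * ∑ n ∈ S, ξ n * b n * (ξ n * b n))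
      ≤ 9 * ∑ n ∈ S, (1 - ξ n) * (ξ n * b n) ^ 2 := by
    rw [← Finset.sum_neg_distrib, ← Finset.sum_neg_distrib, Finset.mul_sum, Finset.mul_sum,
      Finset.mul_sum, ← Finset.sum_add_distrib, ← Finset.sum_add_distrib]
    refine Finset.sum_le_sum fun n _ => ?_
    by_cases hn : n = 0
    · rw [hn, hb]
      simp
    · have h := hE.eigenvalue_le_neg_two hn
      have hx : 0 ≤ (-ξ n - 1) * (-ξ n) * b n ^ 2 := by
        have : 0 ≤ -ξ n - 1 := by linarith
        have : 0 ≤ -ξ n := by linarith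
        positivity
      have hy : 0 ≤ (-ξ n) * (ξ n * b n) ^ 2 := by
        have : 0 ≤ -ξ n := by linarith
        positivity
      nlinarith
  linarith

/-- The first-order operators `D_j - x_j` lose one order of regularity, in the scale of weighted
`ℓ²` norms of the coefficients. -/
lemma coeff_sphereD_sub_le (hE : IsSphericalEigensystem ξ A) {φ : S2 → ℝ}
    (hφ : ContMDiff (𝓡 2) 𝓘(ℝ, ℝ) 1 φ) {Φ : ℝ}
    (hΦ : ∀ S : Finset ℕ, ∑ n ∈ S, (1 - ξ n) ^ 2 * sphereInner φ (A n) ^ 2 ≤ Φ)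
    (j : Fin 3) (S : Finset ℕ) :
    ∑ n ∈ S, (1 - ξ n) * sphereInner (fun θ => sphereD j φ θ - coordFn j θ * φ θ) (A n) ^ 2
      ≤ 14 * Φ := by
  have hw : ∀ n, 1 ≤ 1 - ξ n := fun n => by linarith [hE.nonpos n]
  have hw0 : ∀ n, 0 < 1 - ξ n := fun n => by linarith [hE.nonpos n]
  have hGc : Continuous fun θ => sphereD j φ θ - coordFn j θ * φ θ :=
    (contMDiff_sphereD hφ (m := 0) (by simp) j).continuous.sub
      ((sphereSmooth_coordFn j).continuous.mul hφ.continuous)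
  -- the operator and its formal adjoint
  have hadj : ∀ {f v : S2 → ℝ}, ContMDiff (𝓡 2) 𝓘(ℝ, ℝ) 1 f → SphereSmooth v →
      sphereInner (fun θ => sphereD j f θ - coordFn j θ * f θ) v
        = sphereInner f fun θ => coordFn j θ * v θ - sphereD j v θ := by
    intro f v hf hv
    have e : sphereInner (fun θ => coordFn j θ * f θ) v
        = sphereInner f fun θ => coordFn j θ * v θ := by
      simp only [sphereInner]
      congr 1
      funext θ
      ring
    have hc : Continuous fun θ => coordFn j θ * f θ :=
      (sphereSmooth_coordFn j).continuous.mul hf.continuous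
    rw [sphereInner_sub_left (contMDiff_sphereD hf (m := 0) (by simp) j).continuous hc
      hv.continuous,
      sphereInner_sphereD hf hv.one, e, sphereInner_sub_right (hv.coord_mul j).continuous
      (hv.diff j).continuous hf.continuous]
    ring
  -- The bound is proved by duality, so that φ itself need not be approximated. X is the quantity to
  -- bound. It equals the pairing of φ with the smooth function z, so X² ≤ ΦY, where Y is the
  -- squared W^{-2,2} norm of z.
  set β : ℕ → ℝ := fun n => sphereInner (fun θ => sphereD j φ θ - coordFn j θ * φ θ) (A n)
    with hβ
  set v := combo A S fun n => (1 - ξ n) * β n with hv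
  have hvs : SphereSmooth v := hE.combo_smooth S _
  set X := ∑ n ∈ S, (1 - ξ n) * β n ^ 2 with hX
  have hX0 : 0 ≤ X := Finset.sum_nonneg fun n _ => mul_nonneg (hw0 n).le (sq_nonneg _)
  have hzmem : (fun θ => coordFn j θ * v θ - sphereD j v θ) ∈ Submodule.span ℝ (Set.range A) :=
    Submodule.sub_mem _ (hE.coord_mul_mem_span (combo_mem_span A S _) j)
      (hE.sphereD_mem_span (combo_mem_span A S _) j)
  set z := fun θ => coordFn j θ * v θ - sphereD j v θ with hz
  obtain ⟨T, -, hzT⟩ := hE.exists_combo hzmem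
  set Z : ℕ → ℝ := fun n => sphereInner z (A n) with hZ
  set Y := ∑ n ∈ T, ((1 - ξ n) ^ 2)⁻¹ * Z n ^ 2 with hY
  have hY0 : 0 ≤ Y := Finset.sum_nonneg fun n _ => by positivity
  have hX1 : X = ∑ n ∈ T, Z n * sphereInner φ (A n) := by
    rw [← hE.sphereInner_combo hφ.continuous, ← hzT, hz, ← hadj hφ hvs, hv,
      hE.sphereInner_combo hGc]
    exact Finset.sum_congr rfl fun n _ => by simp only [hβ]; ring
  have hX2 : X ^ 2 ≤ Φ * Y := by
    have hcs := Finset.sum_mul_sq_le_sq_mul_sq T (fun n => (1 - ξ n) * sphereInner φ (A n))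
      fun n => (1 - ξ n)⁻¹ * Z n
    have e1 : ∑ n ∈ T, (1 - ξ n) * sphereInner φ (A n) * ((1 - ξ n)⁻¹ * Z n) = X := by
      rw [hX1]
      refine Finset.sum_congr rfl fun n _ => ?_
      have := (hw0 n).ne'
      field_simp
    have e2 : ∑ n ∈ T, ((1 - ξ n)⁻¹ * Z n) ^ 2 = Y :=
      Finset.sum_congr rfl fun n _ => by rw [mul_pow, inv_pow]
    have e3 : ∑ n ∈ T, ((1 - ξ n) * sphereInner φ (A n)) ^ 2 ≤ Φ := by
      simpa only [mul_pow] using hΦ T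
    rw [e1, e2] at hcs
    exact hcs.trans (mul_le_mul_of_nonneg_right e3 hY0)
  -- q = (1 - Δ)⁻² z, so Y is both the pairing of z with q and the squared W^{2,2} norm of q. By
  -- skewness Y also pairs t = (D_j - x_j) q with v, whence Y² ≤ XN, where N is the squared W^{1,2}
  -- norm of t. Only the smooth finite combination q then needs the bound.
  set c : ℕ → ℝ := fun n => ((1 - ξ n) ^ 2)⁻¹ * Z n with hc
  set q := combo A T c with hq
  have hqs : SphereSmooth q := hE.combo_smooth T _
  have hqm : q ∈ Submodule.span ℝ (Set.range A) := combo_mem_span A T _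
  set p := combo A T fun n => ξ n * c n with hp
  have hps : SphereSmooth p := hE.combo_smooth T _
  have hqp : sphereLaplacian q = p := hE.laplacian_combo T c
  set t := fun θ => sphereD j q θ - coordFn j θ * q θ with ht
  have hts : SphereSmooth t := (hqs.diff j).sub (hqs.coord_mul j)
  have htm : t ∈ Submodule.span ℝ (Set.range A) :=
    Submodule.sub_mem _ (hE.sphereD_mem_span hqm j) (hE.coord_mul_mem_span hqm j)
  have hY1 : Y = ∑ n ∈ S, (1 - ξ n) * β n * sphereInner t (A n) := by
    rw [← hE.sphereInner_combo hts.continuous, ← hv, hadj hqs.one hvs, ← hz, hzT, hq,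
      hE.sphereInner_combo_combo]
    exact Finset.sum_congr rfl fun n _ => by simp only [hc]; ring
  set N := sphereInner t t - sphereInner t (sphereLaplacian t) with hN
  have hN1 : ∑ n ∈ S, (1 - ξ n) * sphereInner t (A n) ^ 2 ≤ N := by
    obtain ⟨U, hU0, hU⟩ := hE.exists_combo htm
    have e : N = ∑ n ∈ U, (1 - ξ n) * sphereInner t (A n) ^ 2 := by
      have h1 : sphereInner t t = ∑ n ∈ U, sphereInner t (A n) * sphereInner t (A n) := by
        conv_lhs => rw [hU]
        exact hE.sphereInner_combo_combo U _ _
      have h2 : sphereInner t (sphereLaplacian t)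
          = ∑ n ∈ U, sphereInner t (A n) * (ξ n * sphereInner t (A n)) := by
        conv_lhs => rw [hU]
        rw [hE.laplacian_combo, hE.sphereInner_combo_combo]
      rw [hN, h1, h2, ← Finset.sum_sub_distrib]
      exact Finset.sum_congr rfl fun n _ => by ring
    have hUS : U ⊆ S ∪ U := Finset.subset_union_right
    have hSU : S ⊆ S ∪ U := Finset.subset_union_left
    rw [e, Finset.sum_subset hUS fun n _ hn => by rw [hU0 n hn]; ring]
    exact Finset.sum_le_sum_of_subset_of_nonneg hSU
      fun n _ _ => mul_nonneg (hw0 n).le (sq_nonneg _)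
  have hY2 : Y ^ 2 ≤ X * N := by
    have hcs := Finset.sum_mul_sq_le_sq_mul_sq S (fun n => √(1 - ξ n) * β n)
      fun n => √(1 - ξ n) * sphereInner t (A n)
    have e1 : ∑ n ∈ S, √(1 - ξ n) * β n * (√(1 - ξ n) * sphereInner t (A n)) = Y := by
      rw [hY1]
      refine Finset.sum_congr rfl fun n _ => ?_
      linear_combination (β n * sphereInner t (A n)) * Real.mul_self_sqrt (hw0 n).le
    have e2 : ∑ n ∈ S, (√(1 - ξ n) * β n) ^ 2 = X :=
      Finset.sum_congr rfl fun n _ => by rw [mul_pow, Real.sq_sqrt (hw0 n).le]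
    have e3 : ∑ n ∈ S, (√(1 - ξ n) * sphereInner t (A n)) ^ 2 ≤ N := by
      refine le_trans (le_of_eq ?_) hN1
      exact Finset.sum_congr rfl fun n _ => by rw [mul_pow, Real.sq_sqrt (hw0 n).le]
    rw [e1, e2] at hcs
    exact hcs.trans (mul_le_mul_of_nonneg_left e3 hX0)
  have hYc : Y = ∑ n ∈ T, (1 - ξ n) ^ 2 * c n ^ 2 := by
    refine Finset.sum_congr rfl fun n _ => ?_
    have := (hw0 n).ne'
    simp only [hc]
    field_simp
  have hT : sphereInner t t ≤ 2 * Y := by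
    have h1 := sphereInner_self_sub_le (hqs.diff j).continuous (hqs.coord_mul j).continuous
    have h2 := sphereInner_sphereD_self_le hqs j
    have h3 := sphereInner_self_coord_mul_le hqs.continuous j
    have h4 : sphereInner q q - sphereInner q p ≤ Y := by
      rw [hq, hp, hE.sphereInner_combo_combo, hE.sphereInner_combo_combo,
        ← Finset.sum_sub_distrib, hYc]
      refine Finset.sum_le_sum fun n _ => ?_
      nlinarith [hw n, hw0 n, mul_nonneg (neg_nonneg.2 (hE.nonpos n)) (sq_nonneg (c n)),
        sq_nonneg (ξ n * c n)]
    rw [hqp] at h2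
    linarith
  have hP : sphereInner p p ≤ Y := by
    rw [hp, hE.sphereInner_combo_combo, hYc]
    refine Finset.sum_le_sum fun n _ => ?_
    nlinarith [hE.sq_mul_le_weight n (c n), sq_nonneg (c n)]
  -- Integration by parts gives N = 3⟨t,t⟩ + ⟨p, x_j t⟩ + ⟨p, D_j t⟩. Here ⟨D_j t, D_j t⟩ ≤ N -
  -- ⟨t,t⟩, so half of N is absorbed and N/2 ≤ 3⟨t,t⟩ + ⟨p,p⟩ ≤ 7Y.
  have hN2 : N ≤ 14 * Y := by
    have hLt : sphereLaplacian t
        = fun θ => (sphereD j p θ - 3 * (coordFn j θ * p θ)) - 2 * t θ := by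
      funext θ
      rw [ht, sphereLaplacian_sub (hqs.diff j) (hqs.coord_mul j), sphereLaplacian_sphereD hqs,
        sphereLaplacian_coord_mul hqs, hqp]
      ring
    have hDp := (hps.diff j).continuous
    have hxp := (hps.coord_mul j).continuous
    have hxt := (hts.coord_mul j).continuous
    have h1 : sphereInner t (sphereLaplacian t) = sphereInner (sphereD j p) t
        - 3 * sphereInner (fun θ => coordFn j θ * p θ) t - 2 * sphereInner t t := by
      rw [hLt, sphereInner_sub_right ((hps.diff j).sub ((hps.coord_mul j).const_mul 3)).continuous
        (hts.const_mul 2).continuous hts.continuous,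
        sphereInner_sub_right hDp ((hps.coord_mul j).const_mul 3).continuous hts.continuous,
        sphereInner_const_mul_right, sphereInner_const_mul_right, sphereInner_comm t,
        sphereInner_comm t fun θ => coordFn j θ * p θ]
    have h2 := sphereInner_sphereD hps.one hts.one j
    have h3 : sphereInner (fun θ => coordFn j θ * p θ) t
        = sphereInner p fun θ => coordFn j θ * t θ := by
      simp only [sphereInner]
      congr 1
      funext θ
      ring
    have h4 := sphereInner_le_half hps.continuous (hts.diff j).continuous
    have h5 := sphereInner_le_half hps.continuous hxt
    have h6 := sphereInner_sphereD_self_le hts j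
    have h7 := sphereInner_self_coord_mul_le hts.continuous j
    rw [h3] at h1
    linarith
  -- From Y² ≤ XN and N ≤ 14Y. With X² ≤ ΦY this closes the argument: X ≤ 14Φ.
  have hYX : Y ≤ 14 * X := by
    rcases hY0.eq_or_lt with h | h
    · rw [← h]; positivity
    · have : Y * Y ≤ (14 * X) * Y := by nlinarith [mul_le_mul_of_nonneg_left hN2 hX0]
      exact le_of_mul_le_mul_right this h
  rcases hX0.eq_or_lt with h | h
  · rw [← h]
    have := hΦ ∅
    simp at this
    positivity
  · have hΦ0 : 0 ≤ Φ := by simpa using hΦ ∅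
    have : X * X ≤ (14 * Φ) * X := by nlinarith [mul_le_mul_of_nonneg_left hYX hΦ0]
    exact le_of_mul_le_mul_right this h

end IsSphericalEigensystem

/-! ### Series of functions on the sphere -/

/-- The hypothesis applies to every finite block of the series, so the tails are uniformly Cauchy as
soon as the numerical series of the c_n converges. -/
lemma summable_of_sq_sum_le {F : ℕ → C(S2, ℝ)} {c : ℕ → ℝ} {K Φ : ℝ} (hK : 0 ≤ K)
    (hc : ∀ n, 0 ≤ c n) (hΦ : ∀ S : Finset ℕ, ∑ n ∈ S, c n ≤ Φ)
    (hF : ∀ (S : Finset ℕ) (θ : S2), (∑ n ∈ S, F n θ) ^ 2 ≤ K * ∑ n ∈ S, c n) :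
    Summable F ∧ ∀ θ, (∑' n, F n) θ ^ 2 ≤ K * Φ := by
  have hcs : Summable c := summable_of_sum_le hc hΦ
  have hs : Summable F := by
    rw [summable_iff_vanishing_norm]
    intro ε hε
    have hK1 : 0 < K + 1 := by linarith
    obtain ⟨s, hs⟩ := summable_iff_vanishing_norm.1 hcs (ε ^ 2 / 4 / (K + 1)) (by positivity)
    refine ⟨s, fun t ht => ?_⟩
    have h1 := hs t ht
    rw [Real.norm_eq_abs, abs_of_nonneg (Finset.sum_nonneg fun n _ => hc n),
      lt_div_iff₀ hK1] at h1
    have h2 : ‖∑ n ∈ t, F n‖ ≤ ε / 2 := by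
      rw [ContinuousMap.norm_le _ (by positivity)]
      intro θ
      have h3 := hF t θ
      rw [ContinuousMap.sum_apply, Real.norm_eq_abs]
      refine abs_le_of_sq_le_sq ?_ (by positivity)
      have := Finset.sum_nonneg (s := t) fun n _ => hc n
      nlinarith
    linarith
  refine ⟨hs, fun θ => ?_⟩
  have ht : Filter.Tendsto (fun S : Finset ℕ => (∑ n ∈ S, F n θ) ^ 2) Filter.atTop
      (nhds ((∑' n, F n) θ ^ 2)) := by
    have := ((continuous_eval_const θ).tendsto (∑' n, F n)).comp hs.hasSum
    refine (this.congr fun S => ?_).pow 2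
    simp [ContinuousMap.sum_apply]
  exact le_of_tendsto' ht fun S => (hF S θ).trans (mul_le_mul_of_nonneg_left (hΦ S) hK)

lemma fderiv_radialExt {u : S2 → ℝ} {x : E3} (hx : x ≠ 0) :
    fderiv ℝ (radialExt u) x = ∑ j, (‖x‖⁻¹ * radialExt (sphereD j u) x) •
      (EuclideanSpace.proj j : E3 →L[ℝ] ℝ) := by
  ext v
  rw [fderiv_apply_eq_sum]
  simp only [FunLike.coe_sum, Finset.sum_apply, _root_.smul_apply, smul_eq_mul,
    PiLp.proj_apply, partialD_radialExt u hx]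
  exact Finset.sum_congr rfl fun j _ => mul_comm _ _

lemma norm_proj_le (j : Fin 3) : ‖(EuclideanSpace.proj j : E3 →L[ℝ] ℝ)‖ ≤ 1 :=
  ContinuousLinearMap.opNorm_le_bound _ zero_le_one fun x => by
    simpa using PiLp.norm_apply_le x j

/-- Term-by-term differentiation of a series of functions on the sphere. -/
lemma contMDiff_tsum_S2 {a : ℕ → S2 → ℝ} (ha : ∀ n, ContMDiff (𝓡 2) 𝓘(ℝ, ℝ) 1 (a n))
    {F : ℕ → C(S2, ℝ)} (hFa : ∀ n θ, F n θ = a n θ) {D : Fin 3 → ℕ → C(S2, ℝ)}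
    (hDa : ∀ j n θ, D j n θ = sphereD j (a n) θ) (hF : Summable F) (hD : ∀ j, Summable (D j)) :
    ContMDiff (𝓡 2) 𝓘(ℝ, ℝ) 1 (fun θ => (∑' n, F n) θ) ∧
      ∀ j θ, sphereD j (∑' n, F n : C(S2, ℝ)) θ = (∑' n, D j n) θ := by
  let g : E3 → ℝ := radialExt (∑' n, F n : C(S2, ℝ))
  let G : Fin 3 → E3 → ℝ := fun j => radialExt (∑' n, D j n : C(S2, ℝ))
  let g' : E3 → E3 →L[ℝ] ℝ := fun x => ∑ j, (‖x‖⁻¹ * G j x) •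
      (EuclideanSpace.proj j : E3 →L[ℝ] ℝ)
  have hder : ∀ x ≠ (0 : E3), HasFDerivAt g (g' x) x := by
    intro x hx
    have hxn : 0 < ‖x‖ := norm_pos_iff.2 hx
    refine hasFDerivAt_of_tendstoUniformlyOnFilter (l := (Filter.atTop : Filter (Finset ℕ)))
      (f := fun S y => radialExt (fun θ => ∑ n ∈ S, a n θ) y)
      (f' := fun S y => fderiv ℝ (radialExt fun θ => ∑ n ∈ S, a n θ) y) ?_ ?_ ?_
    · rw [Metric.tendstoUniformlyOnFilter_iff]
      intro ε hε
      -- Near x one has 1/|y| ≤ 2/|x|, so each of the three components contributes at most ε/4.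
      have hδ : 0 < ε * ‖x‖ / 8 := by positivity
      have h1 : ∀ᶠ S : Finset ℕ in Filter.atTop, ∀ j, ‖∑ n ∈ S, D j n - ∑' n, D j n‖
          < ε * ‖x‖ / 8 := by
        rw [Filter.eventually_all]
        intro j
        have := (hD j).hasSum.eventually (Metric.ball_mem_nhds _ hδ)
        filter_upwards [this] with S hS
        rwa [dist_eq_norm] at hS
      have h2 : ∀ᶠ y : E3 in nhds x, ‖x‖ / 2 < ‖y‖ :=
        continuous_norm.continuousAt.eventually (lt_mem_nhds (half_lt_self hxn))
      refine (h1.prod_mk h2).mono fun p hp => ?_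
      obtain ⟨hp1, hp2⟩ := hp
      have hy : 0 < ‖p.2‖ := by linarith
      rw [dist_comm, dist_eq_norm, fderiv_radialExt (norm_pos_iff.1 hy), ← Finset.sum_sub_distrib]
      have hj : ∀ j, ‖(‖p.2‖⁻¹ * radialExt (sphereD j fun θ => ∑ n ∈ p.1, a n θ) p.2) •
          (EuclideanSpace.proj j : E3 →L[ℝ] ℝ) - (‖p.2‖⁻¹ * G j p.2) •
          (EuclideanSpace.proj j : E3 →L[ℝ] ℝ)‖ ≤ ε / 4 := by
        intro j
        rw [← sub_smul, ← mul_sub, norm_smul, norm_mul, norm_inv, norm_norm]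
        have e : radialExt (sphereD j fun θ => ∑ n ∈ p.1, a n θ) p.2 - G j p.2
            = (∑ n ∈ p.1, D j n - ∑' n, D j n) (dir p.2) := by
          rw [ContinuousMap.sub_apply, ContinuousMap.sum_apply]
          simp only [radialExt, G, hDa]
          rw [sphereD_sum fun n _ => ha n]
        have h3 : ‖radialExt (sphereD j fun θ => ∑ n ∈ p.1, a n θ) p.2 - G j p.2‖
            ≤ ε * ‖x‖ / 8 := by
          rw [e]
          exact (ContinuousMap.norm_coe_le_norm _ _).trans (hp1 j).le
        have h4 : ‖p.2‖⁻¹ ≤ 2 / ‖x‖ := by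
          rw [inv_le_comm₀ hy (by positivity), inv_div]
          exact hp2.le
        calc _ ≤ (2 / ‖x‖ * (ε * ‖x‖ / 8)) * 1 := by
              gcongr
              exact norm_proj_le j
          _ = ε / 4 := by field_simp; norm_num
      refine (norm_sum_le _ _).trans_lt ((Finset.sum_le_sum fun j _ => hj j).trans_lt ?_)
      simp
      linarith
    · refine Filter.Eventually.prod_inr (p := fun y : E3 => y ≠ 0) (isOpen_ne.mem_nhds hx)
        (Filter.atTop : Filter (Finset ℕ)) |>.mono fun p hp => ?_
      exact (differentiableAt_radialExt (contMDiff_finsetSum fun n _ => ha n) hp).hasFDerivAt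
    · refine Filter.Eventually.of_forall fun y => ?_
      have := ((continuous_eval_const (dir y)).tendsto (∑' n, F n)).comp hF.hasSum
      refine this.congr fun S => ?_
      simp [ContinuousMap.sum_apply, radialExt, hFa]
  have hG : ∀ j, ∀ x ≠ (0 : E3), ContinuousAt (G j) x := fun j x hx =>
    (contDiffAt_radialExt (contMDiff_zero_iff.2 (ContinuousMap.continuous _)) hx).continuousAt
  have hg' : ContinuousOn g' {0}ᶜ := by
    intro x hx
    refine ContinuousAt.continuousWithinAt ?_
    refine tendsto_finsetSum _ fun j _ => ?_
    exact ((continuous_norm.continuousAt.inv₀ (norm_ne_zero_iff.2 hx)).mul (hG j x hx)).smul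
      continuousAt_const
  have hC1 : ∀ x ≠ (0 : E3), ContDiffAt ℝ 1 g x := fun x hx =>
    contDiffAt_one_iff.2 ⟨g', {0}ᶜ, isOpen_compl_singleton.mem_nhds hx, hg', fun y hy => hder y hy⟩
  constructor
  · have := contMDiff_restrict fun θ => hC1 θ (S2_ne_zero θ)
    simpa only [g, radialExt_S2] using this
  · intro j θ
    rw [sphereD, partialD, (hder θ (S2_ne_zero θ)).fderiv]
    simp only [g', FunLike.coe_sum, Finset.sum_apply, _root_.smul_apply, smul_eq_mul,
      PiLp.proj_apply, norm_S2, G, radialExt_S2]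
    simp

namespace IsSphericalEigensystem

variable {ξ : ℕ → ℝ} {A : ℕ → S2 → ℝ}

/-- The Sobolev inequality for continuous functions with square-summable weighted coefficients. -/
lemma sup_le_of_coeff (hE : IsSphericalEigensystem ξ A) {K : ℝ} (hK0 : 0 ≤ K)
    (hK : ∀ u : S2 → ℝ, SphereSmooth u → ∀ θ, u θ ^ 2 ≤ K * (∫ η, u η ^ 2 ∂surfaceMeasure
      + ∫ η, sphereLaplacian u η ^ 2 ∂surfaceMeasure)) {f : S2 → ℝ} (hf : Continuous f) {Φ : ℝ}
    (hΦ : ∀ S : Finset ℕ, ∑ n ∈ S, (1 - ξ n) ^ 2 * sphereInner f (A n) ^ 2 ≤ Φ) (θ : S2) :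
    f θ ^ 2 ≤ K * Φ := by
  let F : ℕ → C(S2, ℝ) := fun n =>
    ⟨fun η => sphereInner f (A n) * A n η, ((hE.smooth n).const_mul _).continuous⟩
  obtain ⟨hs, hb⟩ := summable_of_sq_sum_le (F := F) hK0 (fun n => by positivity) hΦ
    fun S θ => hE.combo_sup_le hK0 hK S _ θ
  -- f and the sum of its series have the same coefficients; completeness identifies them.
  have hzero := hE.eq_zero_of_forall_coeff (f := fun η => f η - (∑' n, F n) η)
    (hf.sub (ContinuousMap.continuous _)) (fun k => ?_) θ
  · rw [sub_eq_zero.1 hzero]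
    exact hb θ
  · rw [sphereInner_sub_left hf (ContinuousMap.continuous _) (hE.smooth k).continuous, sub_eq_zero,
      sphereInner_comm (⇑(∑' n, F n)) (A k)]
    have h1 := ((continuous_sphereInner (hE.smooth k).continuous).tendsto (∑' n, F n)).comp
      hs.hasSum
    refine tendsto_nhds_unique (tendsto_const_nhds.congr' ?_) h1
    filter_upwards [Filter.eventually_ge_atTop {k}] with S hS
    have hk : k ∈ S := hS (Finset.mem_singleton_self k)
    have e : ((∑ n ∈ S, F n : C(S2, ℝ)) : S2 → ℝ) = combo A S fun n => sphereInner f (A n) := by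
      funext θ
      simp [F, combo]
    rw [Function.comp_apply, e, sphereInner_comm (A k), hE.combo_coeff, if_pos hk]

end IsSphericalEigensystem

/-! ### The source term and the harmonic coordinates -/

/-- This form uses only the operators D_j - x_j, to which `coeff_sphereD_sub_le` applies. -/
lemma source_eq {h : Fin 3 → Fin 3 → S2 → ℝ} (k : Fin 3) (θ : S2) :
    source h k θ = ∑ j, (sphereD j (h j k) θ - coordFn j θ * h j k θ)
      - 1 / 2 * ∑ j, (sphereD k (h j j) θ - coordFn k θ * h j j θ) := by
  simp only [source, fTensor, sphereD, coordFn, Fin.sum_univ_three]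
  ring

/-- The source is linear in h, and for h = δ it is -θ_k + (3/2)θ_k = θ_k / 2. -/
lemma source_sub_one {h : Fin 3 → Fin 3 → S2 → ℝ}
    (hh : ∀ i j, ContMDiff (𝓡 2) 𝓘(ℝ, ℝ) 1 (h i j)) (k : Fin 3) (θ : S2) :
    source h k θ = 1 / 2 * coordFn k θ
      + source (fun i j η => h i j η - (1 : Matrix (Fin 3) (Fin 3) ℝ) i j) k θ := by
  have hd : ∀ i j l, sphereD l (fun η => h i j η - (1 : Matrix (Fin 3) (Fin 3) ℝ) i j) θ
      = sphereD l (h i j) θ := by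
    intro i j l
    rw [sphereD_sub (hh i j) contMDiff_const, sphereD_const, sub_zero]
  rw [source_eq, source_eq]
  simp only [hd]
  fin_cases k <;> simp [Fin.sum_univ_three, Matrix.one_apply] <;> ring

namespace IsSphericalEigensystem

variable {ξ : ℕ → ℝ} {A : ℕ → S2 → ℝ}

/-- Since 1 - ξ_n ≥ 1, the weight with exponent m dominates the one with exponent 2. -/
lemma sum_sq_le_of_sobolevNorm_le (hE : IsSphericalEigensystem ξ A) {m ε : ℝ} (hm : 2 ≤ m)
    (hε : 0 ≤ ε) {f : S2 → ℝ} (hf : sobolevNorm ξ A m f ≤ ENNReal.ofReal ε) (S : Finset ℕ) :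
    ∑ n ∈ S, (1 - ξ n) ^ 2 * sphereInner f (A n) ^ 2 ≤ ε ^ 2 := by
  have hw : ∀ n, 1 ≤ 1 - ξ n := fun n => by linarith [hE.nonpos n]
  have hterm : ∀ n, 0 ≤ (1 - ξ n) ^ m * sphereInner f (A n) ^ 2 := fun n =>
    mul_nonneg (Real.rpow_nonneg (by linarith [hw n]) _) (sq_nonneg _)
  have h1 := ENNReal.rpow_le_rpow hf (zero_le_two (α := ℝ))
  rw [sobolevNorm, ← ENNReal.rpow_mul, one_div, inv_mul_cancel₀ two_ne_zero, ENNReal.rpow_one,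
    ENNReal.ofReal_rpow_of_nonneg hε zero_le_two, Real.rpow_two] at h1
  have h2 := (ENNReal.sum_le_tsum S).trans h1
  rw [← ENNReal.ofReal_sum_of_nonneg fun n _ => hterm n,
    ENNReal.ofReal_le_ofReal_iff (sq_nonneg ε)] at h2
  refine le_trans (Finset.sum_le_sum fun n _ => ?_) h2
  refine mul_le_mul_of_nonneg_right ?_ (sq_nonneg _)
  rw [← Real.rpow_two]
  exact Real.rpow_le_rpow_of_exponent_le (hw n) hm

lemma sum_sq_coeff_le (hE : IsSphericalEigensystem ξ A) {f : Fin 3 → Fin 3 → S2 → ℝ}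
    (hf : ∀ i j, ContMDiff (𝓡 2) 𝓘(ℝ, ℝ) 1 (f i j)) {Φ : ℝ}
    (hΦ : ∀ i j (S : Finset ℕ), ∑ n ∈ S, (1 - ξ n) ^ 2 * sphereInner (f i j) (A n) ^ 2 ≤ Φ)
    (k : Fin 3) (S : Finset ℕ) : ∑ n ∈ S, (1 - ξ n) * coeff A f k n ^ 2 ≤ 504 * Φ := by
  have hc : ∀ i j l, Continuous fun θ => sphereD l (f i j) θ - coordFn l θ * f i j θ :=
    fun i j l => (contMDiff_sphereD (hf i j) (m := 0) (by simp) l).continuous.sub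
      ((sphereSmooth_coordFn l).continuous.mul (hf i j).continuous)
  let β : Fin 3 → Fin 3 → Fin 3 → ℕ → ℝ := fun i j l n =>
    sphereInner (fun θ => sphereD l (f i j) θ - coordFn l θ * f i j θ) (A n)
  have hβ : ∀ i j l, ∑ n ∈ S, (1 - ξ n) * β i j l n ^ 2 ≤ 14 * Φ := fun i j l =>
    hE.coeff_sphereD_sub_le (hf i j) (hΦ i j) l S
  have e : ∀ n, coeff A f k n = ∑ j, β j k j n - 1 / 2 * ∑ j, β j j k n := by
    intro n
    have hA := (hE.smooth n).continuous
    have h1 : source f k = fun θ => (∑ j, (sphereD j (f j k) θ - coordFn j θ * f j k θ))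
        - 1 / 2 * ∑ j, (sphereD k (f j j) θ - coordFn k θ * f j j θ) :=
      funext fun θ => source_eq k θ
    have h2 : Continuous fun θ =>
        1 / 2 * ∑ j, (sphereD k (f j j) θ - coordFn k θ * f j j θ) :=
      continuous_const.mul (continuous_finsetSum _ fun j _ => hc j j k)
    rw [coeff, h1, sphereInner_sub_left (continuous_finsetSum _ fun j _ => hc j k j) h2 hA,
      sphereInner_const_mul_left,
      sphereInner_sum_left (fun j _ => hc j k j) hA, sphereInner_sum_left (fun j _ => hc j j k) hA]
  -- Two groups of three coefficients, each with weighted sum at most 14Φ, give 504 = 6 · (3 · 14 +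
  -- 3 · 14).
  have hle : ∀ n, (1 - ξ n) * coeff A f k n ^ 2
      ≤ 6 * (∑ j, (1 - ξ n) * β j k j n ^ 2 + ∑ j, (1 - ξ n) * β j j k n ^ 2) := by
    intro n
    have hw : 0 ≤ 1 - ξ n := by linarith [hE.nonpos n]
    rw [e, ← Finset.mul_sum, ← Finset.mul_sum, ← mul_add, mul_left_comm]
    refine mul_le_mul_of_nonneg_left ?_ hw
    have h1 := sq_sum_le_card_mul_sum_sq (s := Finset.univ) (f := fun j => β j k j n)
    have h2 := sq_sum_le_card_mul_sum_sq (s := Finset.univ) (f := fun j => β j j k n)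
    have h3 : 0 ≤ ∑ j, β j j k n ^ 2 := Finset.sum_nonneg fun j _ => sq_nonneg _
    simp only [Finset.card_univ, Fintype.card_fin, Nat.cast_ofNat] at h1 h2
    nlinarith [sq_nonneg (∑ j, β j k j n + 1 / 2 * ∑ j, β j j k n)]
  refine (Finset.sum_le_sum fun n _ => hle n).trans ?_
  rw [← Finset.mul_sum, Finset.sum_add_distrib, Finset.sum_comm, Finset.sum_comm (s := S)]
  have h1 := Finset.sum_le_sum (s := Finset.univ) fun j _ => hβ j k j
  have h2 := Finset.sum_le_sum (s := Finset.univ) fun j _ => hβ j j k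
  simp only [Finset.sum_const, Finset.card_univ, Fintype.card_fin, nsmul_eq_mul] at h1 h2
  push_cast at h1 h2
  linarith

/-- The sum of an eigenfunction series is `C¹`, with bounds, when the coefficients of its
Laplacian are square-summable with one weight. -/
lemma exists_series (hE : IsSphericalEigensystem ξ A) {K : ℝ} (hK0 : 0 ≤ K)
    (hK : ∀ u : S2 → ℝ, SphereSmooth u → ∀ θ, u θ ^ 2 ≤ K * (∫ η, u η ^ 2 ∂surfaceMeasure
      + ∫ η, sphereLaplacian u η ^ 2 ∂surfaceMeasure)) {b : ℕ → ℝ} (hb : b 0 = 0) {Φ : ℝ}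
    (hΦ : ∀ S : Finset ℕ, ∑ n ∈ S, (1 - ξ n) * (ξ n * b n) ^ 2 ≤ Φ) :
    ∃ u : S2 → ℝ, ContMDiff (𝓡 2) 𝓘(ℝ, ℝ) 1 u ∧ (∀ θ, HasSum (fun n => b n * A n θ) (u θ)) ∧
      (∀ θ, u θ ^ 2 ≤ K * Φ) ∧ ∀ i θ, sphereD i u θ ^ 2 ≤ 9 * K * Φ := by
  have hs : ∀ n, SphereSmooth fun θ => b n * A n θ := fun n => (hE.smooth n).const_mul _
  have hc : ∀ n, 0 ≤ (1 - ξ n) * (ξ n * b n) ^ 2 := fun n =>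
    mul_nonneg (by linarith [hE.nonpos n]) (sq_nonneg _)
  let F : ℕ → C(S2, ℝ) := fun n => ⟨fun θ => b n * A n θ, (hs n).continuous⟩
  let D : Fin 3 → ℕ → C(S2, ℝ) := fun i n =>
    ⟨sphereD i fun θ => b n * A n θ, ((hs n).diff i).continuous⟩
  have hF := summable_of_sq_sum_le (F := F) hK0 hc hΦ fun S θ => by
    refine (hE.combo_sup_le hK0 hK S b θ).trans (mul_le_mul_of_nonneg_left ?_ hK0)
    refine Finset.sum_le_sum fun n _ => ?_
    by_cases hn : n = 0
    · simp [hn, hb]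
    · have h := hE.eigenvalue_le_neg_two hn
      -- The spectral gap lets the weight (1 - ξ)ξ² dominate (1 - ξ)² away from n = 0.
      have h2 : (1 - ξ n) ≤ ξ n ^ 2 := by nlinarith
      calc (1 - ξ n) ^ 2 * b n ^ 2 = (1 - ξ n) * b n ^ 2 * (1 - ξ n) := by ring
        _ ≤ (1 - ξ n) * b n ^ 2 * ξ n ^ 2 :=
          mul_le_mul_of_nonneg_left h2 (mul_nonneg (by linarith) (sq_nonneg _))
        _ = _ := by ring
  have hD := fun i => summable_of_sq_sum_le (F := D i) (by positivity : 0 ≤ 9 * K) hc hΦ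
    fun S θ => by
      refine le_trans (le_of_eq ?_) (hE.combo_gradient_sup_le hK0 hK S hb i θ)
      congr 1
      exact (sphereD_sum (fun n _ => (hs n).one) i θ).symm
  obtain ⟨h1, h2⟩ := contMDiff_tsum_S2 (a := fun n θ => b n * A n θ) (fun n => (hs n).one)
    (F := F) (fun _ _ => rfl) (D := D) (fun _ _ _ => rfl) hF.1 fun i => (hD i).1
  refine ⟨fun θ => (∑' n, F n) θ, h1, fun θ => ?_, hF.2, fun i θ => ?_⟩
  · have := ((continuous_eval_const θ).tendsto (∑' n, F n)).comp hF.1.hasSum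
    refine this.congr fun S => ?_
    simp [ContinuousMap.sum_apply, F]
  · have := (hD i).2 θ
    rw [← h2 i θ] at this
    exact this

/-- The Sobolev inequality bounds the constant A_0 without the area of the sphere. -/
lemma sq_zero_le (hE : IsSphericalEigensystem ξ A) {K : ℝ}
    (hK : ∀ u : S2 → ℝ, SphereSmooth u → ∀ θ, u θ ^ 2 ≤ K * (∫ η, u η ^ 2 ∂surfaceMeasure
      + ∫ η, sphereLaplacian u η ^ 2 ∂surfaceMeasure)) (θ : S2) : A 0 θ ^ 2 ≤ K := by
  have h1 := hK (A 0) (hE.smooth 0) θ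
  have h2 : ∫ η, A 0 η ^ 2 ∂surfaceMeasure = 1 := by
    have := hE.orthonormal 0 0
    simpa only [sphereInner, ← pow_two, if_true] using this
  have h3 : ∀ η, sphereLaplacian (A 0) η = 0 := fun η => by
    rw [(hE.eigen 0).2 η, hE.zero, zero_mul]
  simpa [h2, h3] using h1

/-- The shape of the asymptotically harmonic coordinates for a perturbation of `h = δ`. -/
lemma hasSum_harmonicCoord (hE : IsSphericalEigensystem ξ A) {K : ℝ} (hK0 : 0 ≤ K)
    (hK : ∀ u : S2 → ℝ, SphereSmooth u → ∀ θ, u θ ^ 2 ≤ K * (∫ η, u η ^ 2 ∂surfaceMeasure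
      + ∫ η, sphereLaplacian u η ^ 2 ∂surfaceMeasure)) {h : Fin 3 → Fin 3 → S2 → ℝ}
    (hh : ∀ i j, ContMDiff (𝓡 2) 𝓘(ℝ, ℝ) 1 (h i j)) {Φ : ℝ}
    (hΦ : ∀ i j (S : Finset ℕ), ∑ n ∈ S, (1 - ξ n) ^ 2 *
      sphereInner (fun θ => h i j θ - (1 : Matrix (Fin 3) (Fin 3) ℝ) i j) (A n) ^ 2 ≤ Φ)
    (k : Fin 3) :
    ∃ (c : ℝ) (u : S2 → ℝ), c ^ 2 ≤ 504 * K * Φ ∧ ContMDiff (𝓡 2) 𝓘(ℝ, ℝ) 1 u ∧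
      (∀ θ, u θ ^ 2 ≤ 504 * K * Φ) ∧ (∀ i θ, sphereD i u θ ^ 2 ≤ 9 * 504 * K * Φ) ∧
      ∀ x : E3, HasSum (fun n => radialCoeff ξ A h k n ‖x‖ * radialExt (A n) x)
        (c * Real.log ‖x‖ + radialExt u x - 1 / 4 * radialExt (coordFn k) x) := by
  set f : Fin 3 → Fin 3 → S2 → ℝ := fun i j θ => h i j θ - (1 : Matrix (Fin 3) (Fin 3) ℝ) i j
    with hfdef
  have hf : ∀ i j, ContMDiff (𝓡 2) 𝓘(ℝ, ℝ) 1 (f i j) := fun i j =>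
    (hh i j).sub contMDiff_const
  have hsum := hE.sum_sq_coeff_le hf hΦ k
  have hfs : Continuous (source f k) := by
    have : source f k = fun θ => _ := funext fun θ => source_eq k θ
    have hc : ∀ i j l, Continuous fun θ => sphereD l (f i j) θ - coordFn l θ * f i j θ :=
      fun i j l => (contMDiff_sphereD (hf i j) (m := 0) (by simp) l).continuous.sub
        ((sphereSmooth_coordFn l).continuous.mul (hf i j).continuous)
    rw [this]
    exact (continuous_finsetSum _ fun j _ => hc j k j).sub
      (continuous_const.mul (continuous_finsetSum _ fun j _ => hc j j k))
  have hcoeff : ∀ n, coeff A h k n = 1 / 2 * sphereInner (coordFn k) (A n) + coeff A f k n := by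
    intro n
    have : source h k = fun θ => 1 / 2 * coordFn k θ + source f k θ :=
      funext fun θ => source_sub_one hh k θ
    have hc : Continuous fun θ => 1 / 2 * coordFn k θ :=
      continuous_const.mul (sphereSmooth_coordFn k).continuous
    rw [coeff, this, sphereInner_add_left hc hfs (hE.smooth n).continuous,
      sphereInner_const_mul_left, coeff]
  have hx0 : sphereInner (coordFn k) (A 0) = 0 := by
    by_contra hne
    have := hE.eigenvalue_eq (isEigenfunction_coordFn k) hne
    rw [hE.zero] at this
    norm_num at this
  obtain ⟨T, hT0, hT⟩ := hE.exists_combo (hE.exhaustive _ _ (isEigenfunction_coordFn k))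
  let b : ℕ → ℝ := fun n => if n = 0 then 0 else coeff A f k n / ξ n
  obtain ⟨u, hu, hus, hub, hud⟩ := hE.exists_series hK0 hK (b := b) (by simp [b])
    (Φ := 504 * Φ) fun S => by
      refine (Finset.sum_le_sum fun n _ => ?_).trans (hsum S)
      refine mul_le_mul_of_nonneg_left ?_ (by linarith [hE.nonpos n])
      by_cases hn : n = 0
      · simp [hn, b, sq_nonneg]
      · have hne : ξ n ≠ 0 := by linarith [hE.eigenvalue_le_neg_two hn]
        simp only [b, if_neg hn]
        rw [mul_div_cancel₀ _ hne]
  obtain ⟨a, -, ha⟩ := hE.exists_const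
  -- θ_k has no component along A_0, so the logarithm comes from f alone.
  refine ⟨coeff A f k 0 * a, u, ?_, hu, fun θ => ?_, fun i θ => ?_, fun x => ?_⟩
  · have h1 := hE.sq_zero_le hK (dir 0)
    have h2 := hsum {0}
    rw [Finset.sum_singleton, hE.zero, sub_zero, one_mul] at h2
    rw [ha] at h1
    rw [mul_pow]
    calc coeff A f k 0 ^ 2 * a ^ 2 ≤ 504 * Φ * K :=
          mul_le_mul h2 h1 (sq_nonneg _) ((sq_nonneg _).trans h2)
      _ = _ := by ring
  · linarith [hub θ]
  · linarith [hud i θ]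
  · have h1 : HasSum (fun n => if n = 0 then coeff A f k 0 * a * Real.log ‖x‖ else 0)
        (coeff A f k 0 * a * Real.log ‖x‖) := hasSum_ite_eq 0 _
    have h2 : HasSum (fun n => b n * radialExt (A n) x) (radialExt u x) := hus (dir x)
    have h3 : HasSum (fun n => sphereInner (coordFn k) (A n) * radialExt (A n) x)
        (radialExt (coordFn k) x) := by
      have e : radialExt (coordFn k) x
          = ∑ n ∈ T, sphereInner (coordFn k) (A n) * radialExt (A n) x := congrFun hT (dir x)
      rw [e]
      exact hasSum_sum_of_ne_finset_zero fun n hn => by rw [hT0 n hn, zero_mul]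
    refine ((h1.add h2).sub (h3.mul_left (1 / 4))).congr_fun fun n => ?_
    by_cases hn : n = 0
    · subst hn
      simp only [radialCoeff, if_true, hcoeff, hx0, b]
      simp only [ha, radialExt]
      ring
    · simp only [radialCoeff, if_neg hn, hcoeff, b]
      have hne : ξ n ≠ 0 := by linarith [hE.eigenvalue_le_neg_two hn]
      by_cases hz : sphereInner (coordFn k) (A n) = 0
      · rw [hz]
        ring
      -- Where θ_k has a nonzero coefficient, ξ_n = -2; hence the factor (1/2)/(-2) = -1/4.
      · rw [hE.eigenvalue_eq (isEigenfunction_coordFn k) hz]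
        ring

end IsSphericalEigensystem

/-! ### Small perturbations of the identity near infinity -/

/-- A map with derivative `O(1 / |x|)` is Lipschitz on balls away from the origin. -/
lemma norm_sub_le_of_fderiv_le {G : E3 → E3} {L R : ℝ} (hL : 0 ≤ L) (hR : 0 < R)
    (hd : ∀ x : E3, x ≠ 0 → DifferentiableAt ℝ G x)
    (hb : ∀ x : E3, x ≠ 0 → ‖fderiv ℝ G x‖ ≤ L / ‖x‖) {z : E3} (hz : 2 * R ≤ ‖z‖)
    {x y : E3} (hx : x ∈ closedBall z (‖z‖ / 2)) (hy : y ∈ closedBall z (‖z‖ / 2)) :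
    ‖G y - G x‖ ≤ L / R * ‖y - x‖ := by
  have hn : ∀ w ∈ closedBall z (‖z‖ / 2), R ≤ ‖w‖ := by
    intro w hw
    rw [mem_closedBall, dist_comm, dist_eq_norm] at hw
    have := norm_sub_norm_le z w
    linarith
  refine (convex_closedBall z (‖z‖ / 2)).norm_image_sub_le_of_norm_fderiv_le (𝕜 := ℝ)
    (fun w hw => hd w ?_) (fun w hw => ?_) hx hy
  · exact norm_pos_iff.1 (hR.trans_le (hn w hw))
  · refine (hb w (norm_pos_iff.1 (hR.trans_le (hn w hw)))).trans ?_
    exact div_le_div_of_nonneg_left hL hR (hn w hw)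

/-- The exterior region is not convex, so two cases are needed. Points at distance at most |x|/2 lie
in a ball away from the origin, where G is a contraction. For more distant points with equal images,
the bound |G| ≤ |x|/16 is contradicted. -/
lemma injOn_add_of_fderiv_le {G : E3 → E3} {L R : ℝ} (hL : 0 ≤ L) (hR : 0 < R) (hLR : 8 * L ≤ R)
    (hd : ∀ x : E3, x ≠ 0 → DifferentiableAt ℝ G x)
    (hb : ∀ x : E3, x ≠ 0 → ‖fderiv ℝ G x‖ ≤ L / ‖x‖)
    (hG : ∀ x ∈ ext R, ‖G x‖ ≤ ‖x‖ / 16) : Set.InjOn (fun x => x + G x) (ext R) := by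
  intro x hx y hy hxy
  have e : y - x = G x - G y := by
    have : x + G x = y + G y := hxy
    rw [sub_eq_sub_iff_add_eq_add, ← this, add_comm]
  have hxR : R < ‖x‖ := hx
  rcases le_or_gt ‖y - x‖ (‖x‖ / 2) with h | h
  · have h1 := norm_sub_le_of_fderiv_le hL (half_pos hR) hd hb (z := x) (by linarith)
      (mem_closedBall_self (by positivity)) (by rwa [mem_closedBall, dist_eq_norm])
    rw [norm_sub_rev (G y), ← e] at h1
    have h2 : L / (R / 2) ≤ 1 / 4 := by
      rw [div_le_iff₀ (half_pos hR)]
      linarith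
    have h3 : ‖y - x‖ ≤ 0 := by nlinarith [norm_nonneg (y - x)]
    exact (sub_eq_zero.1 (norm_le_zero_iff.1 h3)).symm
  · have h1 : ‖y - x‖ ≤ ‖x‖ / 16 + ‖y‖ / 16 := by
      rw [e]
      exact (norm_sub_le _ _).trans (add_le_add (hG x hx) (hG y hy))
    have h2 := norm_sub_norm_le y x
    have : 0 < ‖x‖ := hR.trans hxR
    linarith

/-- A preimage of z is a fixed point of x ↦ z - G(x), a contraction of the closed ball of radius
|z|/2 about z. -/
lemma ext_subset_image_add_of_fderiv_le {G : E3 → E3} {L R : ℝ} (hL : 0 ≤ L) (hR : 0 < R)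
    (hLR : 8 * L ≤ R) (hd : ∀ x : E3, x ≠ 0 → DifferentiableAt ℝ G x)
    (hb : ∀ x : E3, x ≠ 0 → ‖fderiv ℝ G x‖ ≤ L / ‖x‖)
    (hG : ∀ x ∈ ext R, ‖G x‖ ≤ ‖x‖ / 16) : ext (2 * R) ⊆ (fun x => x + G x) '' ext R := by
  intro z hz
  have hzR : 2 * R < ‖z‖ := hz
  have hball : ∀ w ∈ closedBall z (‖z‖ / 2), w ∈ ext R ∧ ‖w‖ ≤ 2 * ‖z‖ := by
    intro w hw
    rw [mem_closedBall, dist_eq_norm] at hw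
    have h1 := norm_sub_norm_le z w
    have h2 := norm_sub_norm_le w z
    rw [norm_sub_rev] at h1
    constructor
    · change R < ‖w‖
      linarith
    · linarith [norm_nonneg z]
  have hmaps : Set.MapsTo (fun x => z - G x) (closedBall z (‖z‖ / 2)) (closedBall z (‖z‖ / 2)) := by
    intro w hw
    obtain ⟨h1, h2⟩ := hball w hw
    rw [mem_closedBall, dist_eq_norm, sub_sub_cancel_left, norm_neg]
    have := hG w h1
    linarith [norm_nonneg z]
  have hLip : ContractingWith (1 / 8) (hmaps.restrict _ _ _) := by
    refine ⟨by norm_num, LipschitzWith.of_dist_le_mul fun p q => ?_⟩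
    rw [Subtype.dist_eq, Subtype.dist_eq, dist_eq_norm, dist_eq_norm]
    have h1 := norm_sub_le_of_fderiv_le hL hR hd hb hzR.le p.2 q.2
    have h2 : L / R ≤ 1 / 8 := by
      rw [div_le_iff₀ hR]
      linarith
    simp only [Set.MapsTo.val_restrict_apply, sub_sub_sub_cancel_left]
    rw [norm_sub_rev (p : E3)]
    push_cast
    exact h1.trans (mul_le_mul_of_nonneg_right h2 (norm_nonneg _))
  obtain ⟨x, hx, hfix, -⟩ := hLip.exists_fixedPoint' isClosed_closedBall.isComplete hmaps
    (mem_closedBall_self (by positivity : 0 ≤ ‖z‖ / 2)) (edist_ne_top _ _)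
  refine ⟨x, (hball x hx).1, ?_⟩
  have : z - G x = x := hfix
  exact (sub_eq_iff_eq_add.1 this).symm

/-! ### The metric in perturbed coordinates, at one point -/

lemma sum_sq_sum_mul_le {P : Fin 3 → Fin 3 → ℝ} {p : ℝ} (hP : ∀ k i, |P k i| ≤ p)
    (w : Fin 3 → ℝ) : ∑ k, (∑ i, P k i * w i) ^ 2 ≤ 9 * p ^ 2 * ∑ i, w i ^ 2 := by
  have hp : ∀ k i, P k i ^ 2 ≤ p ^ 2 := fun k i => by
    rw [← sq_abs]
    exact pow_le_pow_left₀ (abs_nonneg _) (hP k i) 2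
  have h : ∀ k, (∑ i, P k i * w i) ^ 2 ≤ 3 * p ^ 2 * ∑ i, w i ^ 2 := by
    intro k
    refine (Finset.sum_mul_sq_le_sq_mul_sq _ _ _).trans ?_
    refine mul_le_mul_of_nonneg_right ?_ (Finset.sum_nonneg fun i _ => sq_nonneg _)
    refine (Finset.sum_le_sum fun i _ => hp k i).trans (le_of_eq ?_)
    simp
  refine (Finset.sum_le_sum fun k _ => h k).trans (le_of_eq ?_)
  simp
  ring

lemma abs_sum_sum_mul_le {P : Fin 3 → Fin 3 → ℝ} {p : ℝ} (hP : ∀ k i, |P k i| ≤ p)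
    (w : Fin 3 → ℝ) : |∑ i, ∑ j, P i j * w i * w j| ≤ 3 * p * ∑ i, w i ^ 2 := by
  have hp : 0 ≤ p := (abs_nonneg _).trans (hP 0 0)
  have h : ∀ i j, |P i j * w i * w j| ≤ p * (w i ^ 2 / 2 + w j ^ 2 / 2) := by
    intro i j
    rw [mul_assoc, abs_mul]
    refine mul_le_mul (hP i j) ?_ (abs_nonneg _) hp
    rw [abs_le]
    constructor <;> nlinarith [sq_nonneg (w i - w j), sq_nonneg (w i + w j)]
  calc |∑ i, ∑ j, P i j * w i * w j| ≤ ∑ i, ∑ j, p * (w i ^ 2 / 2 + w j ^ 2 / 2) :=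
        (Finset.abs_sum_le_sum_abs _ _).trans (Finset.sum_le_sum fun i _ =>
          (Finset.abs_sum_le_sum_abs _ _).trans (Finset.sum_le_sum fun j _ => h i j))
    _ = 3 * p * ∑ i, w i ^ 2 := by
        simp only [Fin.sum_univ_three]
        ring

/-- Comparison of the metric `1 + s (1 + f) + Q` with the pull-back of the Euclidean metric by
a linear map `1 + s (B - (1 - θ θᵀ) / 4)`. -/
lemma metric_sub_pullback_estimate {s q : ℝ} (hs : 0 < s) (hs1 : s ≤ 1 / 10)
    (hsq : s * (3 * q + 9 / 4) ≤ 1 / 10) {θ : Fin 3 → ℝ} (hθ : ∑ i, θ i ^ 2 = 1)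
    {B f Q : Fin 3 → Fin 3 → ℝ} (hB : ∀ k i, |B k i| ≤ 1 / 100) (hf : ∀ i j, |f i j| ≤ 1 / 100)
    (hQ : ∀ i j, |Q i j| ≤ q * s ^ 2) {g J : Matrix (Fin 3) (Fin 3) ℝ}
    (hg : ∀ i j, g i j = (1 : Matrix (Fin 3) (Fin 3) ℝ) i j
      + s * ((1 : Matrix (Fin 3) (Fin 3) ℝ) i j + f i j) + Q i j)
    (hJ : ∀ k i, J k i = (1 : Matrix (Fin 3) (Fin 3) ℝ) k i
      + s * (B k i - 1 / 4 * ((1 : Matrix (Fin 3) (Fin 3) ℝ) k i - θ k * θ i))) (w : Fin 3 → ℝ) :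
    (1 / 2 * ∑ i, w i ^ 2 ≤ ∑ k, (∑ i, J k i * w i) ^ 2 ∧
      ∑ k, (∑ i, J k i * w i) ^ 2 ≤ 2 * ∑ i, w i ^ 2) ∧
    1 / 2 * s * ∑ i, w i ^ 2 ≤
      ∑ i, ∑ j, g i j * w i * w j - ∑ k, (∑ i, J k i * w i) ^ 2 ∧
    ∑ i, ∑ j, g i j * w i * w j - ∑ k, (∑ i, J k i * w i) ^ 2 ≤ 2 * s * ∑ i, w i ^ 2 := by
  have hθ1 : ∀ i, |θ i| ≤ 1 := fun i => by
    rw [← sq_le_one_iff_abs_le_one, ← hθ]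
    exact Finset.single_le_sum (fun j _ => sq_nonneg (θ j)) (Finset.mem_univ i)
  have hone : ∀ k i, |(1 : Matrix (Fin 3) (Fin 3) ℝ) k i| ≤ 1 := fun k i => by
    rw [Matrix.one_apply]
    split_ifs <;> simp
  set P : Fin 3 → Fin 3 → ℝ := fun k i =>
    B k i - 1 / 4 * ((1 : Matrix (Fin 3) (Fin 3) ℝ) k i - θ k * θ i) with hPdef
  -- 1/100 from B, and at most 2/4 from the rest.
  have hP : ∀ k i, |P k i| ≤ 51 / 100 := fun k i => by
    have h1 := hB k i
    have h2 := hone k i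
    have h3 : |θ k * θ i| ≤ 1 := by
      rw [abs_mul]
      exact mul_le_one₀ (hθ1 k) (abs_nonneg _) (hθ1 i)
    rw [abs_le] at h1 h2 h3 ⊢
    constructor <;> simp only [hPdef] <;> linarith [h1.1, h1.2, h2.1, h2.2, h3.1, h3.2]
  have hP2 := sum_sq_sum_mul_le hP w
  have hX := abs_le.1 (abs_sum_sum_mul_le hB w)
  have hF := abs_le.1 (abs_sum_sum_mul_le hf w)
  have hZ := abs_le.1 (abs_sum_sum_mul_le hQ w)
  have hP0 : 0 ≤ ∑ k, (∑ i, P k i * w i) ^ 2 := Finset.sum_nonneg fun k _ => sq_nonneg _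
  have hT := Finset.sum_mul_sq_le_sq_mul_sq Finset.univ θ w
  rw [hθ, one_mul] at hT
  have hT0 : 0 ≤ (∑ i, θ i * w i) ^ 2 := sq_nonneg _
  have hW0 : 0 ≤ ∑ i, w i ^ 2 := Finset.sum_nonneg fun i _ => sq_nonneg _
  have eJ : ∑ k, (∑ i, J k i * w i) ^ 2 = ∑ i, w i ^ 2 + 2 * s * (∑ i, ∑ j, B i j * w i * w j
      - 1 / 4 * (∑ i, w i ^ 2 - (∑ i, θ i * w i) ^ 2)) + s ^ 2 * ∑ k, (∑ i, P k i * w i) ^ 2 := by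
    have hJw : ∀ k, ∑ i, J k i * w i = w k + s * ∑ i, P k i * w i := by
      intro k
      have h : ∀ i, J k i = (1 : Matrix (Fin 3) (Fin 3) ℝ) k i + s * P k i := hJ k
      simp only [h, add_mul, Finset.sum_add_distrib, Matrix.one_apply, ite_mul, one_mul,
        zero_mul, Finset.sum_ite_eq, Finset.mem_univ, if_true, Finset.mul_sum, mul_assoc]
    have hPw : ∑ k, w k * ∑ i, P k i * w i = ∑ i, ∑ j, B i j * w i * w j
        - 1 / 4 * (∑ i, w i ^ 2 - (∑ i, θ i * w i) ^ 2) := by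
      simp [hPdef, Fin.sum_univ_three, Matrix.one_apply]
      ring
    rw [← hPw, Finset.mul_sum, Finset.mul_sum, ← Finset.sum_add_distrib, ← Finset.sum_add_distrib]
    refine Finset.sum_congr rfl fun k _ => ?_
    rw [hJw]
    ring
  have eg : ∑ i, ∑ j, g i j * w i * w j = ∑ i, w i ^ 2
      + s * (∑ i, w i ^ 2 + ∑ i, ∑ j, f i j * w i * w j) + ∑ i, ∑ j, Q i j * w i * w j := by
    simp only [hg]
    simp [Fin.sum_univ_three, Matrix.one_apply]
    ring
  -- The difference is s(3W/2 - T/2 + F - 2X) + Z - s²V, with 0 ≤ T ≤ W. Its main part lies between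
  -- sW and 3sW/2, while sF, 2sX and Z - s²V are at most 3/100, 6/100 and 12/100 of sW in absolute
  -- value.
  rw [eg, eJ]
  generalize (∑ i, w i ^ 2) = W at *
  generalize (∑ i, θ i * w i) ^ 2 = T at *
  generalize (∑ k, (∑ i, P k i * w i) ^ 2) = V at *
  generalize (∑ i, ∑ j, B i j * w i * w j) = X at *
  generalize (∑ i, ∑ j, f i j * w i * w j) = F at *
  generalize (∑ i, ∑ j, Q i j * w i * w j) = Z at *
  have hV : V ≤ 5 / 2 * W := by nlinarith
  have hsV : s ^ 2 * V ≤ s * (1 / 4 * W) := by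
    have : s * V ≤ 1 / 4 * W := by nlinarith
    nlinarith
  have hsV0 : 0 ≤ s ^ 2 * V := by positivity
  have hZs : 3 * (q * s ^ 2) * W + s ^ 2 * V ≤ s * (12 / 100 * W) := by
    have h1 : 3 * (q * s ^ 2) * W + s ^ 2 * V ≤ s * (s * (3 * q + 9 * (51 / 100) ^ 2)) * W := by
      nlinarith [mul_le_mul_of_nonneg_left hP2 (sq_nonneg s)]
    have h2 : s * (3 * q + 9 * (51 / 100) ^ 2) ≤ 12 / 100 := by nlinarith
    have h3 := mul_le_mul_of_nonneg_left (mul_le_mul_of_nonneg_right h2 hW0) hs.le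
    nlinarith
  have hsW : s * W ≤ 1 / 10 * W := mul_le_mul_of_nonneg_right hs1 hW0
  have hsW0 : 0 ≤ s * W := by positivity
  have hsX1 := mul_le_mul_of_nonneg_left hX.1 hs.le
  have hsX2 := mul_le_mul_of_nonneg_left hX.2 hs.le
  have hsF1 := mul_le_mul_of_nonneg_left hF.1 hs.le
  have hsF2 := mul_le_mul_of_nonneg_left hF.2 hs.le
  have hsT := mul_le_mul_of_nonneg_left hT hs.le
  have hsT0 : 0 ≤ s * T := by positivity
  refine ⟨⟨?_, ?_⟩, ?_, ?_⟩ <;> linarith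

/-- Diagonal entries come from the vectors e_i, the others by polarisation from e_i ± e_j. -/
lemma abs_apply_le_of_quadratic {M : Matrix (Fin 3) (Fin 3) ℝ} (hM : M.transpose = M) {a : ℝ}
    (h0 : ∀ v : Fin 3 → ℝ, 0 ≤ ∑ i, ∑ j, M i j * v i * v j)
    (h1 : ∀ v : Fin 3 → ℝ, ∑ i, ∑ j, M i j * v i * v j ≤ a * ∑ i, v i ^ 2) (i j : Fin 3) :
    |M i j| ≤ a := by
  have ha : 0 ≤ a := by
    have := (h0 ![1, 0, 0]).trans (h1 ![1, 0, 0])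
    simpa [Fin.sum_univ_three] using this
  have hs : ∀ i j, M i j = M j i := fun i j => congrFun (congrFun hM j) i |>.symm ▸ rfl
  have h01 := hs 0 1
  have h02 := hs 0 2
  have h12 := hs 1 2
  have a1 := h0 ![1, 0, 0]
  have a2 := h0 ![0, 1, 0]
  have a3 := h0 ![0, 0, 1]
  have a4 := h0 ![1, 1, 0]
  have a5 := h0 ![1, 0, 1]
  have a6 := h0 ![0, 1, 1]
  have a7 := h0 ![1, -1, 0]
  have a8 := h0 ![1, 0, -1]
  have a9 := h0 ![0, 1, -1]
  have b1 := h1 ![1, 0, 0]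
  have b2 := h1 ![0, 1, 0]
  have b3 := h1 ![0, 0, 1]
  have b4 := h1 ![1, 1, 0]
  have b5 := h1 ![1, 0, 1]
  have b6 := h1 ![0, 1, 1]
  have b7 := h1 ![1, -1, 0]
  have b8 := h1 ![1, 0, -1]
  have b9 := h1 ![0, 1, -1]
  simp [Fin.sum_univ_three] at a1 a2 a3 a4 a5 a6 a7 a8 a9 b1 b2 b3 b4 b5 b6 b7 b8 b9
  rw [abs_le]
  fin_cases i <;> fin_cases j <;> constructor <;> simp <;> linarith

/-- The metric components in the new coordinates, from estimates in the old ones. -/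
lemma metricInCoord_estimate {s : ℝ} (hs : 0 < s) {g J : Matrix (Fin 3) (Fin 3) ℝ}
    (hgs : g.transpose = g)
    (h1 : ∀ w : Fin 3 → ℝ, 1 / 2 * ∑ i, w i ^ 2 ≤ ∑ k, (∑ i, J k i * w i) ^ 2)
    (h2 : ∀ w : Fin 3 → ℝ, ∑ k, (∑ i, J k i * w i) ^ 2 ≤ 2 * ∑ i, w i ^ 2)
    (h3 : ∀ w : Fin 3 → ℝ, 1 / 2 * s * ∑ i, w i ^ 2 ≤
      ∑ i, ∑ j, g i j * w i * w j - ∑ k, (∑ i, J k i * w i) ^ 2)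
    (h4 : ∀ w : Fin 3 → ℝ,
      ∑ i, ∑ j, g i j * w i * w j - ∑ k, (∑ i, J k i * w i) ^ 2 ≤ 2 * s * ∑ i, w i ^ 2) :
    J.det ≠ 0 ∧ (∀ v : Fin 3 → ℝ, 1 / 4 * s * ∑ i, v i ^ 2
        ≤ ∑ i, ∑ j, (J⁻¹.transpose * g * J⁻¹ - 1) i j * v i * v j ∧
      ∑ i, ∑ j, (J⁻¹.transpose * g * J⁻¹ - 1) i j * v i * v j ≤ 4 * s * ∑ i, v i ^ 2) ∧
    ∀ i j, |(J⁻¹.transpose * g * J⁻¹ - 1) i j| ≤ 4 * s := by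
  have hdet : J.det ≠ 0 := by
    intro h0
    obtain ⟨w, hw, hJw⟩ := Matrix.exists_mulVec_eq_zero_iff.2 h0
    have h5 := h1 w
    have h6 : ∀ k, ∑ i, J k i * w i = 0 := fun k => congrFun hJw k
    simp only [h6, ne_eq, OfNat.ofNat_ne_zero, not_false_eq_true, zero_pow,
      Finset.sum_const_zero] at h5
    have h7 : ∑ i, w i ^ 2 = 0 :=
      le_antisymm (by linarith) (Finset.sum_nonneg fun i _ => sq_nonneg _)
    rw [Finset.sum_eq_zero_iff_of_nonneg fun i _ => sq_nonneg _] at h7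
    exact hw (funext fun i => pow_eq_zero_iff two_ne_zero |>.1 (h7 i (Finset.mem_univ i)))
  have hJ : J * J⁻¹ = 1 := Matrix.mul_nonsing_inv J (isUnit_iff_ne_zero.2 hdet)
  have hq : ∀ (M : Matrix (Fin 3) (Fin 3) ℝ) (v : Fin 3 → ℝ),
      ∑ i, ∑ j, M i j * v i * v j = v ⬝ᵥ M.mulVec v := by
    intro M v
    simp only [dotProduct, Matrix.mulVec, Finset.mul_sum]
    exact Finset.sum_congr rfl fun i _ => Finset.sum_congr rfl fun j _ => by ring
  have hquad : ∀ v : Fin 3 → ℝ, 1 / 4 * s * ∑ i, v i ^ 2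
        ≤ ∑ i, ∑ j, (J⁻¹.transpose * g * J⁻¹ - 1) i j * v i * v j ∧
      ∑ i, ∑ j, (J⁻¹.transpose * g * J⁻¹ - 1) i j * v i * v j ≤ 4 * s * ∑ i, v i ^ 2 := by
    intro v
    -- With Jw = v the form to estimate is g(w,w) - |Jw|², so J⁻¹ is never expanded. The bounds
    -- |v|²/2 ≤ |w|² ≤ 2|v|² turn 1/2 and 2 into 1/4 and 4.
    set w := J⁻¹.mulVec v with hw
    have hJw : ∀ k, ∑ i, J k i * w i = v k := by
      intro k
      have : J.mulVec w = v := by rw [hw, Matrix.mulVec_mulVec, hJ, Matrix.one_mulVec]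
      exact congrFun this k
    have e : ∑ i, ∑ j, (J⁻¹.transpose * g * J⁻¹ - 1) i j * v i * v j
        = ∑ i, ∑ j, g i j * w i * w j - ∑ k, v k ^ 2 := by
      rw [hq, hq, Matrix.sub_mulVec, dotProduct_sub, Matrix.one_mulVec, ← Matrix.mulVec_mulVec,
        ← Matrix.mulVec_mulVec, ← hw, Matrix.dotProduct_mulVec, Matrix.vecMul_transpose, ← hw]
      simp [dotProduct, pow_two]
    have k1 := h1 w
    have k2 := h2 w
    have k3 := h3 w
    have k4 := h4 w
    simp only [hJw] at k1 k2 k3 k4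
    rw [e]
    constructor <;> nlinarith
  refine ⟨hdet, hquad, abs_apply_le_of_quadratic ?_ (fun v => ?_) fun v => (hquad v).2⟩
  · rw [Matrix.transpose_sub, Matrix.transpose_one, Matrix.transpose_mul, Matrix.transpose_mul,
      Matrix.transpose_transpose, hgs, Matrix.mul_assoc]
  · exact le_trans (mul_nonneg (by positivity) (Finset.sum_nonneg fun i _ => sq_nonneg _))
      (hquad v).1

/-! ### Logarithmic perturbations of the identity -/

/-- The vector field with components `c_k log |x| + v_k(x / |x|)`. -/
def logPerturbation (c : Fin 3 → ℝ) (v : Fin 3 → S2 → ℝ) (x : E3) : E3 :=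
  WithLp.toLp 2 fun k => c k * Real.log ‖x‖ + radialExt (v k) x

section

variable {c : Fin 3 → ℝ} {v : Fin 3 → S2 → ℝ}

lemma contDiffAt_logPerturbation (hv : ∀ k, ContMDiff (𝓡 2) 𝓘(ℝ, ℝ) 1 (v k)) {x : E3}
    (hx : x ≠ 0) : ContDiffAt ℝ 1 (logPerturbation c v) x := by
  rw [contDiffAt_euclidean]
  intro k
  exact (contDiffAt_const.mul ((contDiffAt_norm ℝ hx).log (norm_ne_zero_iff.2 hx))).add
    (contDiffAt_radialExt (hv k) hx)

lemma partialD_logPerturbation (hv : ∀ k, ContMDiff (𝓡 2) 𝓘(ℝ, ℝ) 1 (v k)) {x : E3}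
    (hx : x ≠ 0) (k i : Fin 3) : partialD i (fun z => logPerturbation c v z k) x
      = ‖x‖⁻¹ * (c k * coordFn i (dir x) + sphereD i (v k) (dir x)) := by
  have hx' := norm_ne_zero_iff.2 hx
  have hlog : DifferentiableAt ℝ (fun r => c k * Real.log r) ‖x‖ :=
    (Real.differentiableAt_log hx').const_mul _
  have h1 : DifferentiableAt ℝ (fun z : E3 => c k * Real.log ‖z‖) x :=
    (((contDiffAt_norm ℝ hx).differentiableAt one_ne_zero).log hx').const_mul _
  have h2 := partialD_radial hx hlog i
  rw [deriv_const_mul _ (Real.differentiableAt_log hx'), Real.deriv_log] at h2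
  simp only [logPerturbation]
  rw [partialD_add h1 (differentiableAt_radialExt (hv k) hx), h2, partialD_radialExt _ hx]
  simp only [radialExt]
  ring

lemma norm_fderiv_logPerturbation_le (hv : ∀ k, ContMDiff (𝓡 2) 𝓘(ℝ, ℝ) 1 (v k)) {p : ℝ}
    (hp : ∀ k i θ, |c k * coordFn i θ + sphereD i (v k) θ| ≤ p) {x : E3} (hx : x ≠ 0) :
    ‖fderiv ℝ (logPerturbation c v) x‖ ≤ 3 * p / ‖x‖ := by
  have hp0 : 0 ≤ p := (abs_nonneg _).trans (hp 0 0 (dir 0))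
  have hxn : 0 < ‖x‖ := norm_pos_iff.2 hx
  have hd := (contDiffAt_logPerturbation (c := c) hv hx).differentiableAt one_ne_zero
  refine ContinuousLinearMap.opNorm_le_bound _ (by positivity) fun w => ?_
  have hk : ∀ k, (fderiv ℝ (logPerturbation c v) x w) k
      = ∑ i, ‖x‖⁻¹ * (c k * coordFn i (dir x) + sphereD i (v k) (dir x)) * w i := by
    intro k
    have h1 : HasFDerivAt (fun z => logPerturbation c v z k)
        ((EuclideanSpace.proj k : E3 →L[ℝ] ℝ).comp (fderiv ℝ (logPerturbation c v) x)) x :=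
      (EuclideanSpace.proj k : E3 →L[ℝ] ℝ).hasFDerivAt.comp x hd.hasFDerivAt
    have h2 := fderiv_apply_eq_sum (fun z => logPerturbation c v z k) x w
    rw [h1.fderiv] at h2
    refine h2.trans (Finset.sum_congr rfl fun i _ => ?_)
    rw [partialD_logPerturbation hv hx, mul_comm]
  have h := sum_sq_sum_mul_le (p := p / ‖x‖) (P := fun k i =>
    ‖x‖⁻¹ * (c k * coordFn i (dir x) + sphereD i (v k) (dir x))) (fun k i => by
      rw [abs_mul, abs_of_pos (inv_pos.2 hxn), div_eq_inv_mul]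
      exact mul_le_mul_of_nonneg_left (hp k i _) (inv_pos.2 hxn).le) w
  refine abs_le_of_sq_le_sq' ?_ (by positivity) |>.2
  rw [EuclideanSpace.norm_sq_eq]
  simp only [hk, Real.norm_eq_abs, sq_abs]
  refine h.trans (le_of_eq ?_)
  rw [mul_pow, EuclideanSpace.norm_sq_eq w]
  simp only [Real.norm_eq_abs, sq_abs]
  ring

lemma exists_norm_logPerturbation_le (hc : ∀ k, |c k| ≤ 1) (hv : ∀ k θ, |v k θ| ≤ 1) :
    ∃ R : ℝ, ∀ x ∈ ext R, ‖logPerturbation c v x‖ ≤ ‖x‖ / 16 := by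
  obtain ⟨R, hR⟩ := Filter.eventually_atTop.1
    (Real.isLittleO_log_id_atTop.def (by norm_num : (0 : ℝ) < 1 / 100))
  -- Beyond 200 the bounded angular part is at most |x|/200 and the logarithm at most |x|/100, so
  -- each component is below |x|/50; √3/50 < 1/16.
  refine ⟨max R 200, fun x hx => ?_⟩
  have hx1 : max R 200 < ‖x‖ := hx
  have h1 := hR ‖x‖ ((le_max_left _ _).trans hx1.le)
  have h2 : 200 < ‖x‖ := (le_max_right _ _).trans_lt hx1
  rw [Real.norm_eq_abs, id, norm_norm] at h1
  have hk : ∀ k, |logPerturbation c v x k| ≤ ‖x‖ / 50 := by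
    intro k
    refine (abs_add_le _ _).trans ?_
    rw [abs_mul]
    have h3 := mul_le_mul (hc k) h1 (abs_nonneg _) zero_le_one
    have h4 : |radialExt (v k) x| ≤ 1 := hv k (dir x)
    linarith
  refine abs_le_of_sq_le_sq' ?_ (by positivity) |>.2
  rw [EuclideanSpace.norm_sq_eq]
  simp only [Real.norm_eq_abs, Fin.sum_univ_three]
  have h5 : ∀ k, |logPerturbation c v x k| ^ 2 ≤ (‖x‖ / 50) ^ 2 := fun k =>
    pow_le_pow_left₀ (abs_nonneg _) (hk k) 2
  nlinarith [h5 0, h5 1, h5 2]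

end

lemma IsO5.exists_abs_le {R₀ : ℝ} (hR₀ : 0 < R₀) {Q : Fin 3 → Fin 3 → E3 → ℝ}
    (hQ : ∀ i j, IsO5 R₀ (Q i j)) :
    ∃ q : ℝ, ∀ x ∈ ext R₀, ∀ i j, |Q i j x| ≤ q * ‖x‖⁻¹ ^ 2 := by
  choose C hC using fun i j => (hQ i j).2
  refine ⟨∑ i, ∑ j, |C i j|, fun x hx i j => ?_⟩
  have hxn : 0 < ‖x‖ := hR₀.trans hx
  have h := hC i j 0 (by norm_num) x hx
  rw [norm_iteratedFDeriv_zero, Real.norm_eq_abs, add_zero] at h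
  rw [inv_pow, ← div_eq_mul_inv, le_div_iff₀ (by positivity), mul_comm]
  refine (h.trans (le_abs_self _)).trans ?_
  refine (Finset.single_le_sum (f := fun j => |C i j|) (fun j _ => abs_nonneg _)
    (Finset.mem_univ j)).trans ?_
  exact Finset.single_le_sum (f := fun i => ∑ j, |C i j|)
    (fun i _ => Finset.sum_nonneg fun j _ => abs_nonneg _) (Finset.mem_univ i)

end

/-- For each real `m > 2` there is `ε > 0` such that, if `g_{ij} = δ_{ij} + h_{ij}(θ)/r + Q_{ij}`
and each `h_{ij} - δ_{ij}` has `W^{m,2}` norm at most `ε` on the sphere, then the series that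
defines the asymptotically harmonic coordinates `y` converges, `y` is a coordinate system near
infinity, and there the metric is `δ_{ij} + h̃_{ij}` with `h̃_{ij} = O(|y|^{-1})` and `|y| h̃_{ij}`
uniformly elliptic. -/
theorem lemma5p2 (m : ℝ) (hm : 2 < m) :
    ∃ ε : ℝ, 0 < ε ∧
      ∀ (ξ : ℕ → ℝ) (A : ℕ → S2 → ℝ), IsSphericalEigensystem ξ A →
      ∀ (R₀ : ℝ) (g : E3 → Matrix (Fin 3) (Fin 3) ℝ)
        (h : Fin 3 → Fin 3 → S2 → ℝ) (Q : Fin 3 → Fin 3 → E3 → ℝ),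
      IsExpandedMetric R₀ g h Q →
      (∀ i j, sobolevNorm ξ A m (fun θ => h i j θ - (1 : Matrix (Fin 3) (Fin 3) ℝ) i j)
        ≤ ENNReal.ofReal ε) →
      (∀ k, ∀ x ∈ ext R₀, Summable fun n => radialCoeff ξ A h k n ‖x‖ * radialExt (A n) x) ∧
      ∃ R₁ : ℝ, R₀ ≤ R₁ ∧
        IsCoordinateSystemAtInfinity (harmonicCoord ξ A h) R₁ ∧
        (∀ x ∈ ext R₁, harmonicCoord ξ A h x ≠ 0) ∧
        (∃ C : ℝ, ∀ x ∈ ext R₁, ∀ i j,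
          |(metricInCoord g (harmonicCoord ξ A h) x - 1) i j| ≤ C / ‖harmonicCoord ξ A h x‖) ∧
        UniformlyEllipticOn
          (fun x => ‖harmonicCoord ξ A h x‖ • (metricInCoord g (harmonicCoord ξ A h) x - 1))
          (ext R₁) := by
  obtain ⟨K, hK0, hK⟩ := sphere_sobolev
  have hε : 0 < 1 / (14000 * (K + 1)) := by positivity
  refine ⟨1 / (14000 * (K + 1)), hε, fun ξ A hE R₀ g h Q hg hsob => ?_⟩
  set Φ := (1 / (14000 * (K + 1))) ^ 2 with hΦdef
  -- The constant 14000 is chosen here: 9 · 504 · 200² ≤ 14000² and K ≤ (K + 1)². Each of c, u and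
  -- D_i u is then at most 1/200.
  have hKΦ : 9 * 504 * K * Φ ≤ (1 / 200) ^ 2 := by
    rw [hΦdef, div_pow, one_pow, mul_pow, mul_one_div, div_le_iff₀ (by positivity)]
    nlinarith [sq_nonneg K]
  have hKΦ0 : 0 ≤ K * Φ := by positivity
  have hh : ∀ i j, ContMDiff (𝓡 2) 𝓘(ℝ, ℝ) 1 (h i j) := fun i j =>
    (hg.smooth i j).of_le (by norm_num)
  have hΦ := fun i j S => hE.sum_sq_le_of_sobolevNorm_le hm.le hε.le (hsob i j) S
  have hfsup : ∀ i j θ, |h i j θ - (1 : Matrix (Fin 3) (Fin 3) ℝ) i j| ≤ 1 / 100 := by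
    intro i j θ
    have hcont : Continuous fun θ => h i j θ - (1 : Matrix (Fin 3) (Fin 3) ℝ) i j :=
      (hh i j).continuous.sub continuous_const
    have := hE.sup_le_of_coeff hK0 hK hcont (hΦ i j) θ
    exact abs_le_of_sq_le_sq (by linarith) (by norm_num)
  choose c u hc hu hub hud hsum using fun k => hE.hasSum_harmonicCoord hK0 hK hh hΦ k
  -- The contribution -θ/4 of h = δ joins u, so that y - x is a single logarithmic perturbation.
  let v : Fin 3 → S2 → ℝ := fun k θ => u k θ - 1 / 4 * coordFn k θ
  have hv : ∀ k, ContMDiff (𝓡 2) 𝓘(ℝ, ℝ) 1 (v k) := fun k =>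
    (hu k).sub (contMDiff_const.mul (contMDiff_coordFn 1 k))
  have hy : harmonicCoord ξ A h = fun x => x + logPerturbation c v x := by
    funext x
    ext k
    change x k + ∑' n, radialCoeff ξ A h k n ‖x‖ * radialExt (A n) x
      = x k + (c k * Real.log ‖x‖ + (radialExt (u k) x - 1 / 4 * radialExt (coordFn k) x))
    rw [(hsum k x).tsum_eq, add_sub_assoc]
  have hcoord : ∀ k θ, |coordFn k θ| ≤ 1 := fun k θ => by
    rw [← sq_le_one_iff_abs_le_one, ← sum_sq_S2 θ]
    exact Finset.single_le_sum (fun j _ => sq_nonneg ((θ : E3) j)) (Finset.mem_univ k)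
  have hc1 : ∀ k, |c k| ≤ 1 / 200 := fun k =>
    abs_le_of_sq_le_sq (by linarith [hc k]) (by norm_num)
  have hu1 : ∀ k θ, |u k θ| ≤ 1 / 200 := fun k θ =>
    abs_le_of_sq_le_sq (by linarith [hub k θ]) (by norm_num)
  have hD1 : ∀ k i θ, |sphereD i (u k) θ| ≤ 1 / 200 := fun k i θ =>
    abs_le_of_sq_le_sq (by linarith [hud k i θ]) (by norm_num)
  have hB : ∀ k i θ, |c k * coordFn i θ + sphereD i (u k) θ| ≤ 1 / 100 := by
    intro k i θ
    refine (abs_add_le _ _).trans ?_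
    rw [abs_mul]
    have := mul_le_mul (hc1 k) (hcoord i θ) (abs_nonneg _) (by norm_num)
    linarith [hD1 k i θ]
  have hDv : ∀ k i θ, c k * coordFn i θ + sphereD i (v k) θ
      = (c k * coordFn i θ + sphereD i (u k) θ)
        - 1 / 4 * ((1 : Matrix (Fin 3) (Fin 3) ℝ) k i - coordFn k θ * coordFn i θ) := by
    intro k i θ
    have h1 : sphereD i (v k) θ = sphereD i (u k) θ - 1 / 4 * sphereD i (coordFn k) θ := by
      have hx4 : ContMDiff (𝓡 2) 𝓘(ℝ, ℝ) 1 fun θ => 1 / 4 * coordFn k θ :=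
        contMDiff_const.mul (contMDiff_coordFn 1 k)
      rw [sphereD_sub (hu k) hx4,
        sphereD_const_mul (contMDiff_coordFn 1 k)]
    rw [h1, sphereD_coordFn, Matrix.one_apply]
    simp only [coordFn]
    ring
  have hp : ∀ k i θ, |c k * coordFn i θ + sphereD i (v k) θ| ≤ 1 := by
    intro k i θ
    rw [hDv]
    have h1 := abs_le.1 (hB k i θ)
    have h2 : |coordFn k θ * coordFn i θ| ≤ 1 := by
      rw [abs_mul]
      exact mul_le_one₀ (hcoord k θ) (abs_nonneg _) (hcoord i θ)
    have h3 := abs_le.1 h2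
    have h4 : (1 : Matrix (Fin 3) (Fin 3) ℝ) k i = 0 ∨ (1 : Matrix (Fin 3) (Fin 3) ℝ) k i = 1 := by
      rw [Matrix.one_apply]
      split_ifs <;> simp
    rw [abs_le]
    rcases h4 with h4 | h4 <;> rw [h4] <;> constructor <;> linarith
  obtain ⟨Ra, hRa⟩ := exists_norm_logPerturbation_le (c := c) (v := v)
    (fun k => (hc1 k).trans (by norm_num)) fun k θ => by
      have h1 := abs_le.1 (hu1 k θ)
      have h2 := abs_le.1 (hcoord k θ)
      rw [abs_le]
      constructor <;> simp only [v] <;> linarith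
  obtain ⟨q, hq⟩ := IsO5.exists_abs_le hg.radius_pos hg.decay
  refine ⟨fun k x _ => (hsum k x).summable, ?_⟩
  -- 24 = 8 · 3 meets the requirement 8L ≤ R with L = 3, and also gives s ≤ 1/10. The last threshold
  -- makes the O(s²) terms small against s.
  obtain ⟨R₁, h0, h1, h2, h3⟩ : ∃ R₁, R₀ ≤ R₁ ∧ Ra ≤ R₁ ∧ 24 ≤ R₁ ∧ 10 * (3 * q + 9 / 4) ≤ R₁ :=
    ⟨max (max R₀ Ra) (max 24 (10 * (3 * q + 9 / 4))), by simp⟩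
  have hR1 : 0 < R₁ := by linarith
  have hne : ∀ x ∈ ext R₁, x ≠ 0 := fun x hx => norm_pos_iff.1 (hR1.trans hx)
  have hsmall : ∀ x ∈ ext R₁, ‖logPerturbation c v x‖ ≤ ‖x‖ / 16 := fun x hx =>
    hRa x (h1.trans_lt hx)
  have hdiff : ∀ x : E3, x ≠ 0 → DifferentiableAt ℝ (logPerturbation c v) x := fun x hx =>
    (contDiffAt_logPerturbation hv hx).differentiableAt one_ne_zero
  have hder : ∀ x : E3, x ≠ 0 → ‖fderiv ℝ (logPerturbation c v) x‖ ≤ 3 / ‖x‖ := fun x hx => by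
    simpa using norm_fderiv_logPerturbation_le hv hp hx
  have hyn : ∀ x ∈ ext R₁, 15 / 16 * ‖x‖ ≤ ‖harmonicCoord ξ A h x‖ ∧
      ‖harmonicCoord ξ A h x‖ ≤ 17 / 16 * ‖x‖ := by
    intro x hx
    rw [hy]
    have k1 := hsmall x hx
    have k2 := norm_add_le x (logPerturbation c v x)
    have k3 := norm_sub_norm_le x (-logPerturbation c v x)
    rw [norm_neg, sub_neg_eq_add] at k3
    constructor <;> linarith
  have hJ : ∀ x ∈ ext R₁, ∀ k i, jacobian (harmonicCoord ξ A h) x k i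
      = (1 : Matrix (Fin 3) (Fin 3) ℝ) k i + ‖x‖⁻¹ * ((c k * coordFn i (dir x)
        + sphereD i (u k) (dir x)) - 1 / 4 * ((1 : Matrix (Fin 3) (Fin 3) ℝ) k i
        - coordFn k (dir x) * coordFn i (dir x))) := by
    intro x hx k i
    have k1 : DifferentiableAt ℝ (fun z => logPerturbation c v z k) x :=
      differentiableAt_euclidean.1 (hdiff x (hne x hx)) k
    have k2 : DifferentiableAt ℝ (fun z : E3 => z k) x :=
      ((contDiff_coord 1 k).differentiable one_ne_zero).differentiableAt
    rw [jacobian, Matrix.of_apply, hy, ← hDv, ← partialD_logPerturbation hv (hne x hx),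
      Matrix.one_apply, ← partialD_coord x k i, ← partialD_add k2 k1]
    rfl
  have hest : ∀ x ∈ ext R₁, (jacobian (harmonicCoord ξ A h) x).det ≠ 0 ∧
      (∀ w : Fin 3 → ℝ, 1 / 4 * ‖x‖⁻¹ * ∑ i, w i ^ 2
        ≤ ∑ i, ∑ j, (metricInCoord g (harmonicCoord ξ A h) x - 1) i j * w i * w j ∧
      ∑ i, ∑ j, (metricInCoord g (harmonicCoord ξ A h) x - 1) i j * w i * w j
        ≤ 4 * ‖x‖⁻¹ * ∑ i, w i ^ 2) ∧
      ∀ i j, |(metricInCoord g (harmonicCoord ξ A h) x - 1) i j| ≤ 4 * ‖x‖⁻¹ := by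
    intro x hx
    have hx0 : x ∈ ext R₀ := h0.trans_lt hx
    have hxR : R₁ < ‖x‖ := hx
    have hxn : 0 < ‖x‖ := hR1.trans hx
    have hs1 : ‖x‖⁻¹ ≤ 1 / 10 := by
      rw [inv_le_comm₀ hxn (by norm_num)]
      norm_num
      linarith
    have hsq : ‖x‖⁻¹ * (3 * q + 9 / 4) ≤ 1 / 10 := by
      rw [inv_mul_le_iff₀ hxn]
      linarith
    have key := metric_sub_pullback_estimate (inv_pos.2 hxn) hs1 hsq (sum_sq_S2 (dir x))
      (B := fun k i => c k * coordFn i (dir x) + sphereD i (u k) (dir x))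
      (f := fun i j => h i j (dir x) - (1 : Matrix (Fin 3) (Fin 3) ℝ) i j)
      (Q := fun i j => Q i j x) (fun k i => hB k i _) (fun i j => hfsup i j _)
      (fun i j => hq x hx0 i j) (g := g x) (J := jacobian (harmonicCoord ξ A h) x)
      (fun i j => by
        rw [hg.expansion x hx0, add_sub_cancel, div_eq_inv_mul]
        rfl) (fun k i => hJ x hx k i)
    refine metricInCoord_estimate (inv_pos.2 hxn) ?_ (fun w => (key w).1.1)
      (fun w => (key w).1.2) (fun w => (key w).2.1) fun w => (key w).2.2
    simpa [Matrix.IsHermitian] using (hg.posDef x hx0).isHermitian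
  -- Since |y|/|x| lies in [15/16, 17/16], the constants are 4 · 17/16 ≤ 5 and (1/4) · 15/16 ≥ 1/8.
  refine ⟨R₁, h0, ⟨?_, ?_, fun x hx => (hest x hx).1, 2 * R₁, ?_⟩, fun x hx => ?_,
    ⟨5, fun x hx i j => ?_⟩, 1 / 8, 5, by norm_num, by norm_num, fun x hx w => ?_⟩
  · rw [hy]
    exact fun x hx => (contDiffAt_id.add
      (contDiffAt_logPerturbation hv (hne x hx))).contDiffWithinAt
  · rw [hy]
    exact injOn_add_of_fderiv_le zero_le_three hR1 (by linarith) hdiff hder hsmall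
  · rw [hy]
    exact ext_subset_image_add_of_fderiv_le zero_le_three hR1 (by linarith) hdiff hder hsmall
  · have hxn : 0 < ‖x‖ := hR1.trans hx
    exact norm_pos_iff.1 (by linarith [(hyn x hx).1])
  · have hxn : 0 < ‖x‖ := hR1.trans hx
    have hyp : 0 < ‖harmonicCoord ξ A h x‖ := by linarith [(hyn x hx).1]
    refine ((hest x hx).2.2 i j).trans ?_
    rw [le_div_iff₀ hyp, mul_assoc, mul_comm, ← le_div_iff₀ (by norm_num), inv_mul_le_iff₀ hxn]
    linarith [(hyn x hx).2]
  · have hxn : 0 < ‖x‖ := hR1.trans hx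
    obtain ⟨k1, k2⟩ := (hest x hx).2.1 w
    obtain ⟨k3, k4⟩ := hyn x hx
    have hW : 0 ≤ ∑ i, w i ^ 2 := Finset.sum_nonneg fun i _ => sq_nonneg _
    have e : ∑ i, ∑ j, (‖harmonicCoord ξ A h x‖ •
        (metricInCoord g (harmonicCoord ξ A h) x - 1)) i j * w i * w j
        = ‖harmonicCoord ξ A h x‖ *
          ∑ i, ∑ j, (metricInCoord g (harmonicCoord ξ A h) x - 1) i j * w i * w j := by
      simp only [Matrix.smul_apply, smul_eq_mul, Finset.mul_sum, mul_assoc]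
    rw [e]
    have l1 : 15 / 16 ≤ ‖harmonicCoord ξ A h x‖ * ‖x‖⁻¹ := by
      rw [← div_eq_mul_inv, le_div_iff₀ hxn]
      exact k3
    have l2 : ‖harmonicCoord ξ A h x‖ * ‖x‖⁻¹ ≤ 17 / 16 := by
      rw [← div_eq_mul_inv, div_le_iff₀ hxn]
      exact k4
    have m1 := mul_le_mul_of_nonneg_left k1 (norm_nonneg (harmonicCoord ξ A h x))
    have m2 := mul_le_mul_of_nonneg_left k2 (norm_nonneg (harmonicCoord ξ A h x))
    have n1 := mul_le_mul_of_nonneg_right l1 hW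
    have n2 := mul_le_mul_of_nonneg_right l2 hW
    constructor <;> nlinarith
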